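/- **Definitions.** An *igraph* on $[n]$ is a colouring $C$ of all pairs of $[n]$ with the colours red, blue and green. Let $C_r$ be the graph of pairs that are red or green, and $C_b$ the graph of pairs that are blue or green. For $p\in[0,1]$ the *$p$-weight* of $C$ is $w_p(C)=p|C_r|+(1-p)|C_b|$. Let $H$ be a finite graph. A *copy* of $H$ in $C$ is the image of $H$ (with its edges regarded as red pairs and its non-edges as blue pairs) under an injection $f:V(H)\to[n]$ that maps edges of $H$ to pairs of $C_r$ and non-edges of $H$ to pairs of $C_b$; injections that differ by an automorphism of $H$ give the same copy. If there is no copy, $C$ is *$H$-free*. Let $\mathrm{kex}_p(H,n)$ be the maximum of $w_p(C)$ over the $H$-free igraphs $C$ on $[n]$, and $$\kappa_p(H)=\lim_{n\to\infty}\mathrm{kex}_p(H,n)\Big/\binom n2 .$$ For integers $a,b\ge 2$ let $I_{a,b}=K_{a+b}\setminus K_b$, the complete graph on $a+b$ vertices with all edges inside a fixed set of $b$ vertices removed. Let $\mathcal B_a(n)$ be the set of igraphs on $[n]$ that consist of $a$ disjoint blue cliques (some possibly empty) covering $[n]$, with all pairs between different cliques green. Let $\mathcal R_{b-1}(n)$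 be the set of igraphs on $[n]$ that consist of $b-1$ disjoint red cliques (some possibly empty) covering $[n]$, with all pairs between different cliques green. Put $$\mathcal G_p(n)=\begin{cases}\mathcal B_a(n) & \text{if } p<\frac{a}{a+b-1},\\ \mathcal R_{b-1}(n) & \text{if } p>\frac{a}{a+b-1},\\ \mathcal B_a(n)\cup\mathcal R_{b-1}(n) & \text{if } p=\frac{a}{a+b-1}.\end{cases}$$ **Theorem 1.2 (superstability).** For every $\varepsilon>0$, all integers $a,b\ge 2$ and every $p\in(0,1)$ there exist $n_0$ and $\delta>0$ such that the following holds for every $n>n_0$ and every igraph $G$ on $[n]$. If $G$ contains fewer than $\delta n^{a+b}$ copies of $I_{a,b}$ and $$w_p(G)>\big(\kappa_p(I_{a,b})-\delta\big)\binom n2,$$ then one can change the colours of at most $\varepsilon n^2$ pairs of $G$ to obtain an igraph $G'\in\mathcal G_p(n)$. -/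

import Mathlib

open Filter Topology

/-- The three colours of the edges of an igraph. -/
inductive EyeColour where
  | red
  | blue
  | green
deriving DecidableEq

instance : Fintype EyeColour :=
  ⟨{EyeColour.red, EyeColour.blue, EyeColour.green}, by rintro (_ | _ | _) <;> simp⟩

/-- An *igraph* on `V`: a colouring of the edges of the complete graph on `V` with the colours
red, blue and green. -/
abbrev IGraph (V : Type*) := SimpleGraph.TopEdgeLabeling V EyeColour

namespace IGraph

/-- `C_r`: the pairs that are red in the two-coloured viewpoint, that is, red or green. -/
def redGraph {V : Type*} (C : IGraph V) : SimpleGraph V :=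
  C.labelGraph EyeColour.red ⊔ C.labelGraph EyeColour.green

/-- `C_b`: the pairs that are blue in the two-coloured viewpoint, that is, blue or green. -/
def blueGraph {V : Type*} (C : IGraph V) : SimpleGraph V :=
  C.labelGraph EyeColour.blue ⊔ C.labelGraph EyeColour.green

/-- The `p`-weight `w_p(C) = p |C_r| + (1 - p) |C_b|`. -/
noncomputable def weight {V : Type*} (p : ℝ) (C : IGraph V) : ℝ :=
  p * (C.redGraph.edgeSet.ncard : ℝ) + (1 - p) * (C.blueGraph.edgeSet.ncard : ℝ)

/-- The injection `f` places the graph `H` in the igraph `C`: edges of `H` go to pairs of `C_r`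
and non-edges of `H` go to pairs of `C_b`. -/
def Places {V W : Type*} (C : IGraph V) (H : SimpleGraph W) (f : W ↪ V) : Prop :=
  H.map f ≤ C.redGraph ∧ Hᶜ.map f ≤ C.blueGraph

/-- `C` is `H`-free. -/
def Free {V W : Type*} (C : IGraph V) (H : SimpleGraph W) : Prop :=
  ∀ f : W ↪ V, ¬ C.Places H f

/-- The set of copies of `H` in `C`. A copy is the image of `H`, viewed as a complete graph with
edges red and non-edges blue, under an injection that places `H` in `C`; it consists of a set of
vertices, a set of red pairs and a set of blue pairs. Injections that differ by an automorphism
of `H` give the same copy. -/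
def copies {V W : Type*} (C : IGraph V) (H : SimpleGraph W) :
    Set (Set V × SimpleGraph V × SimpleGraph V) :=
  {K | ∃ f : W ↪ V, C.Places H f ∧ K = (Set.range f, H.map f, Hᶜ.map f)}

/-- The number of pairs on which two igraphs have different colours. -/
noncomputable def editDist {V : Type*} (C C' : IGraph V) : ℕ :=
  {e | C e ≠ C' e}.ncard

/-- `kex_p(H, n)`: the maximum `p`-weight of an `H`-free igraph on `n` vertices. -/
noncomputable def kex {W : Type*} (p : ℝ) (H : SimpleGraph W) (n : ℕ) : ℝ :=
  sSup {w | ∃ C : IGraph (Fin n), C.Free H ∧ C.weight p = w}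

/-- The induced `p`-density `κ_p(H) = lim kex_p(H, n) / (n choose 2)`. The limit exists, see
`tendsto_kappa` below. -/
noncomputable def kappa {W : Type*} (p : ℝ) (H : SimpleGraph W) : ℝ :=
  limUnder atTop (fun n : ℕ => kex p H n / (n.choose 2 : ℝ))

/-- The vertices split into `k` cliques (some possibly empty) of the colour `c`, and all pairs
between different cliques are green. -/
def IsCliquePartition {V : Type*} (c : EyeColour) (k : ℕ) (C : IGraph V) : Prop :=
  ∃ P : V → Fin k, ∀ (x y : V) (h : x ≠ y),
    C.get x y h = if P x = P y then c else EyeColour.green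

/-- `𝓑_k(n)`: the igraphs on `n` vertices that consist of `k` disjoint blue cliques joined by
green edges. -/
def blueFamily (k n : ℕ) : Set (IGraph (Fin n)) :=
  {C | C.IsCliquePartition EyeColour.blue k}

/-- `𝓡_k(n)`: the igraphs on `n` vertices that consist of `k` disjoint red cliques joined by
green edges. -/
def redFamily (k n : ℕ) : Set (IGraph (Fin n)) :=
  {C | C.IsCliquePartition EyeColour.red k}

open Classical in
/-- `𝓖_p(n)`: it is `𝓑_a(n)`, `𝓡_{b-1}(n)` or their union when `p` is less than, greater than or
equal to `a / (a + b - 1)`. -/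
noncomputable def extremalFamily (a b : ℕ) (p : ℝ) (n : ℕ) : Set (IGraph (Fin n)) :=
  if p < (a : ℝ) / ((a : ℝ) + (b : ℝ) - 1) then blueFamily a n
  else if p > (a : ℝ) / ((a : ℝ) + (b : ℝ) - 1) then redFamily (b - 1) n
  else blueFamily a n ∪ redFamily (b - 1) n

end IGraph

/-- The eye `I_{a,b} = K_{a+b} \ K_b`: the complete graph on `a + b` vertices with the edges of a
complete graph on `b` of the vertices deleted. -/
def eye (a b : ℕ) : SimpleGraph (Fin a ⊕ Fin b) :=
  ⊤ \ (⊤ : SimpleGraph (Fin b)).map Function.Embedding.inr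

namespace IGraph

/-! Existence of the limit that defines `kappa`, by averaging over the deletion of a vertex. -/

lemma weight_nonneg {V : Type*} {p : ℝ} (h0 : 0 ≤ p) (h1 : p ≤ 1) (C : IGraph V) :
    0 ≤ C.weight p := by
  have : 0 ≤ 1 - p := by linarith
  unfold weight
  positivity

lemma kex_bddAbove {W : Type*} (p : ℝ) (H : SimpleGraph W) (n : ℕ) :
    BddAbove {w | ∃ C : IGraph (Fin n), C.Free H ∧ C.weight p = w} := by
  refine ((Set.finite_range fun C : IGraph (Fin n) => C.weight p).subset ?_).bddAbove
  rintro w ⟨C, -, rfl⟩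
  exact ⟨C, rfl⟩

lemma kex_nonneg {W : Type*} {p : ℝ} (h0 : 0 ≤ p) (h1 : p ≤ 1) (H : SimpleGraph W) (n : ℕ) :
    0 ≤ kex p H n := by
  refine Real.sSup_nonneg ?_
  rintro w ⟨C, -, rfl⟩
  exact weight_nonneg h0 h1 C

lemma redGraph_pullback {V V' : Type*} (C : IGraph V) (f : V' ↪ V) :
    redGraph (C.pullback f) = C.redGraph.comap f := by
  ext x y
  simp only [redGraph, SimpleGraph.sup_adj, SimpleGraph.comap_adj,
    SimpleGraph.TopEdgeLabeling.labelGraph_adj, SimpleGraph.EdgeLabeling.get_eq, ne_eq,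
    EmbeddingLike.apply_eq_iff_eq]
  rfl

lemma blueGraph_pullback {V V' : Type*} (C : IGraph V) (f : V' ↪ V) :
    blueGraph (C.pullback f) = C.blueGraph.comap f := by
  ext x y
  simp only [blueGraph, SimpleGraph.sup_adj, SimpleGraph.comap_adj,
    SimpleGraph.TopEdgeLabeling.labelGraph_adj, SimpleGraph.EdgeLabeling.get_eq, ne_eq,
    EmbeddingLike.apply_eq_iff_eq]
  rfl

lemma Free.pullback {V V' W : Type*} {C : IGraph V} {H : SimpleGraph W} (h : C.Free H)
    (f : V' ↪ V) : Free (C.pullback f) H := by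
  intro g hg
  refine h (g.trans f) ?_
  obtain ⟨hr, hb⟩ := hg
  rw [redGraph_pullback, ← SimpleGraph.map_le_iff_le_comap, SimpleGraph.map_map] at hr
  rw [blueGraph_pullback, ← SimpleGraph.map_le_iff_le_comap, SimpleGraph.map_map] at hb
  exact ⟨hr, hb⟩

lemma sum_ncard_comap_succAbove {n : ℕ} (R : SimpleGraph (Fin (n + 1))) :
    ∑ v : Fin (n + 1), ((R.comap (v.succAboveEmb)).edgeSet.ncard : ℝ)
      = ((n : ℝ) - 1) * (R.edgeSet.ncard : ℝ) := by
  classical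
  have h : ∀ v : Fin (n + 1), ((R.comap (v.succAboveEmb)).edgeSet.ncard : ℝ)
      = (R.edgeSet.ncard : ℝ) - (R.degree v : ℝ) := by
    intro v
    have e : R.comap (v.succAboveEmb) ≃g R.induce {v}ᶜ :=
      { toEquiv := finSuccAboveEquiv v
        map_rel_iff' := Iff.rfl }
    have h1 := e.card_edgeFinset_eq
    have h2 := R.card_edgeFinset_induce_compl_singleton v
    have h3 : R.degree v ≤ R.edgeFinset.card := by
      rw [← R.card_incidenceFinset_eq_degree v]
      exact Finset.card_le_card (R.incidenceFinset_subset v)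
    rw [← SimpleGraph.coe_edgeFinset, ← SimpleGraph.coe_edgeFinset (G := R),
      Set.ncard_coe_finset, Set.ncard_coe_finset, h1]
    have h4 : ((R.induce {v}ᶜ).edgeFinset.card) = R.edgeFinset.card - R.degree v := by
      rw [← SimpleGraph.card_edgeFinset_deleteIncidenceSet]
      convert h2
    rw [h4, Nat.cast_sub h3]
  have hs : (∑ v : Fin (n + 1), (R.degree v : ℝ)) = 2 * (R.edgeSet.ncard : ℝ) := by
    rw [← SimpleGraph.coe_edgeFinset (G := R), Set.ncard_coe_finset]
    exact_mod_cast R.sum_degrees_eq_twice_card_edges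
  simp only [h, Finset.sum_sub_distrib, hs]
  simp
  ring

lemma sum_weight_pullback {n : ℕ} (p : ℝ) (C : IGraph (Fin (n + 1))) :
    ∑ v : Fin (n + 1), weight p (C.pullback (v.succAboveEmb))
      = ((n : ℝ) - 1) * C.weight p := by
  simp only [weight, redGraph_pullback, blueGraph_pullback, Finset.sum_add_distrib,
    ← Finset.mul_sum, sum_ncard_comap_succAbove]
  ring

lemma kex_succ_le {W : Type*} {p : ℝ} (h0 : 0 ≤ p) (h1 : p ≤ 1) (H : SimpleGraph W) {n : ℕ}
    (hn : 2 ≤ n) : ((n : ℝ) - 1) * kex p H (n + 1) ≤ ((n : ℝ) + 1) * kex p H n := by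
  have hn' : (0 : ℝ) < (n : ℝ) - 1 := by
    have : (2 : ℝ) ≤ n := by exact_mod_cast hn
    linarith
  rw [mul_comm, ← le_div_iff₀ hn']
  refine Real.sSup_le ?_ (div_nonneg (mul_nonneg (by positivity) (kex_nonneg h0 h1 H n)) hn'.le)
  rintro w ⟨C, hC, rfl⟩
  rw [le_div_iff₀ hn', mul_comm, ← sum_weight_pullback]
  calc ∑ v : Fin (n + 1), weight p (C.pullback (v.succAboveEmb))
      ≤ ∑ _v : Fin (n + 1), kex p H n :=
        Finset.sum_le_sum fun v _ => le_csSup (kex_bddAbove p H n) ⟨_, hC.pullback _, rfl⟩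
    _ = ((n : ℝ) + 1) * kex p H n := by simp

/-- The limit in the definition of the induced `p`-density exists. -/
theorem tendsto_kappa {W : Type*} {p : ℝ} (h0 : 0 ≤ p) (h1 : p ≤ 1) (H : SimpleGraph W) :
    Tendsto (fun n : ℕ => kex p H n / (n.choose 2 : ℝ)) atTop (𝓝 (kappa p H)) := by
  refine tendsto_nhds_limUnder ?_
  have ha : Antitone fun n : ℕ => kex p H (n + 2) / ((n + 2).choose 2 : ℝ) := by
    refine antitone_nat_of_succ_le fun n => ?_
    have h := kex_succ_le h0 h1 H (n := n + 2) (by omega)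
    simp only [Nat.cast_choose_two]
    push_cast at h ⊢
    have hn : (0 : ℝ) ≤ n := Nat.cast_nonneg n
    rw [div_le_div_iff₀ (by nlinarith) (by nlinarith)]
    have h2 : (0 : ℝ) ≤ ((n : ℝ) + 2) / 2 := by positivity
    have h' := mul_le_mul_of_nonneg_left h h2
    ring_nf at h' ⊢
    linarith
  have hb : BddBelow (Set.range fun n : ℕ => kex p H (n + 2) / ((n + 2).choose 2 : ℝ)) := by
    refine ⟨0, ?_⟩
    rintro _ ⟨n, rfl⟩
    exact div_nonneg (kex_nonneg h0 h1 H _) (by positivity)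
  exact ⟨_, (tendsto_add_atTop_iff_nat 2).1 (tendsto_atTop_ciInf ha hb)⟩

end IGraph

/-! Write b = k + 1 and q = 1 - p; let R be the graph of red or green pairs and B that of blue or
green pairs. A pair outside R is truly blue and loses p, a pair outside B is truly red and loses q.
Over all ordered pairs, diagonal included, the loss is n² - 2w. Balanced blue cliques, a in number,
lose about (p/a)n², and k balanced red cliques about (q/k)n²; the threshold for p is where p/a =
q/k.

The optimal loss is not computed in advance. For any asymptotic lower bound c on the loss
(`IsLossBound`) with c ≤ p/a and c ≤ q/k, an igraph with few eyes and loss at most (c + δ)n² is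
close to one of the two structures, and the structure found forces p/a ≤ c + ε or q/k ≤ c + ε
(`IsLossBound.exists_stability`). At the supremum of all loss bounds, near-extremal igraphs exist by
maximality, so c = min(p/a, q/k) (`isLossBound_min`). A second application, with this c, gives the
theorem.

For stability, call a vertex rich if it lies in many R-cliques of size a + 1. By Ramsey counting, a
vertex with linearly many R-neighbours among rich vertices is itself rich, at a lower threshold
(`exists_many_red_cliques`). So almost all pairs between rich and poor vertices are truly blue.
Applying c inside both classes and p across them exceeds cn², because c ≤ p/2, unless one class is
small (`IsLossBound.dichotomy`).

If almost all vertices are poor, there are few R-cliques of size a + 1, while the loss bounds almost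
all codegrees in R by about n/a. Turán stability (`exists_turan_partition`) gives the blue cliques.

If almost all are rich, almost no vertex has many B-cliques of size k in its green neighbourhood
(`exists_few_blue_cliques`). Take a vertex of largest red degree r, with blue degree β. Greedily,
its green degree is at most (k - 1)r, so n ≤ kr + β up to small errors, and pβ + qr ≤ cn forces r ≈
n/k and β ≈ 0. This spreads along green pairs to almost all vertices (`exists_red_degrees`), and
Turán stability for B gives the red cliques. -/

/-! ### Counting cliques: greedy construction and Ramsey. -/

section CliqueCounting

open Finset
open scoped Classical

/-- The ordered `s`-cliques of `F` with all vertices in `U`. -/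
noncomputable def cliqueTuples {V : Type*} [Fintype V] (F : SimpleGraph V) (s : ℕ)
    (U : Finset V) : Finset (Fin s → V) :=
  {f | (∀ i, f i ∈ U) ∧ ∀ i j, i ≠ j → F.Adj (f i) (f j)}

/-- The neighbourhood of `u` in `F`. -/
noncomputable def nbhd {V : Type*} [Fintype V] (F : SimpleGraph V) (u : V) : Finset V :=
  {y | F.Adj u y}

/-- The number of vertices not adjacent to `u`, including `u` itself. -/
noncomputable def codeg {V : Type*} [Fintype V] (F : SimpleGraph V) (u : V) : ℝ :=
  ((univ.filter fun y => ¬ F.Adj u y).card : ℝ)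

variable {V : Type*} [Fintype V]

lemma mem_cliqueTuples {F : SimpleGraph V} {s : ℕ} {U : Finset V} {f : Fin s → V} :
    f ∈ cliqueTuples F s U ↔ (∀ i, f i ∈ U) ∧ ∀ i j, i ≠ j → F.Adj (f i) (f j) := by
  simp [cliqueTuples]

@[simp] lemma mem_nbhd {F : SimpleGraph V} {u y : V} : y ∈ nbhd F u ↔ F.Adj u y := by
  simp [nbhd]

lemma cliqueTuples_mono {F : SimpleGraph V} {s : ℕ} {U W : Finset V} (h : U ⊆ W) :
    cliqueTuples F s U ⊆ cliqueTuples F s W := by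
  intro f hf
  rw [mem_cliqueTuples] at hf ⊢
  exact ⟨fun i => h (hf.1 i), hf.2⟩

lemma cons_mem_cliqueTuples {F : SimpleGraph V} {s : ℕ} {U : Finset V} {u : V} {f : Fin s → V} :
    (Fin.cons u f : Fin (s + 1) → V) ∈ cliqueTuples F (s + 1) U ↔
      u ∈ U ∧ f ∈ cliqueTuples F s (U ∩ nbhd F u) := by
  simp only [mem_cliqueTuples, Fin.forall_fin_succ, Fin.cons_zero, Fin.cons_succ, mem_inter,
    mem_nbhd]
  constructor
  · rintro ⟨⟨h1, h2⟩, ⟨-, h3⟩, h4⟩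
    exact ⟨h1, fun i => ⟨h2 i, h3 i (by simp [Fin.ext_iff])⟩,
      fun i j hij => (h4 i).2 j (by simpa using hij)⟩
  · rintro ⟨h1, h2, h3⟩
    exact ⟨⟨h1, fun i => (h2 i).1⟩, ⟨fun h => absurd rfl h, fun i _ => (h2 i).2⟩,
      fun i => ⟨fun _ => (h2 i).2.symm, fun j hij => h3 i j (by simpa using hij)⟩⟩

lemma card_cliqueTuples_succ (F : SimpleGraph V) (s : ℕ) (U : Finset V) :
    (cliqueTuples F (s + 1) U).card = ∑ u ∈ U, (cliqueTuples F s (U ∩ nbhd F u)).card := by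
  rw [← Finset.card_sigma]
  symm
  refine Finset.card_bij (fun x _ => (Fin.cons x.1 x.2 : Fin (s + 1) → V)) ?_ ?_ ?_
  · rintro ⟨u, f⟩ h
    rw [mem_sigma] at h
    exact cons_mem_cliqueTuples.2 h
  · rintro ⟨u, f⟩ - ⟨v, g⟩ - h
    have h' := Fin.cons_injective2 h
    simp only [Sigma.mk.injEq, heq_eq_eq]
    exact h'
  · intro f hf
    refine ⟨⟨f 0, Fin.tail f⟩, ?_, Fin.cons_self_tail f⟩
    rw [mem_sigma]
    exact cons_mem_cliqueTuples.1 ((Fin.cons_self_tail f).symm ▸ hf)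

@[simp] lemma card_cliqueTuples_zero (F : SimpleGraph V) (U : Finset V) :
    (cliqueTuples F 0 U).card = 1 := by
  rw [Finset.card_eq_one]
  refine ⟨Fin.elim0, ?_⟩
  ext f
  rw [mem_cliqueTuples, mem_singleton]
  exact ⟨fun _ => Subsingleton.elim _ _, fun _ => ⟨fun i => i.elim0, fun i => i.elim0⟩⟩

lemma codeg_nonneg (F : SimpleGraph V) (u : V) : 0 ≤ codeg F u := Nat.cast_nonneg _

lemma codeg_le (F : SimpleGraph V) (u : V) : codeg F u ≤ Fintype.card V := by
  unfold codeg
  exact_mod_cast Finset.card_le_univ _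

lemma card_sub_codeg_le (F : SimpleGraph V) (U : Finset V) (u : V) :
    (U.card : ℝ) - codeg F u ≤ ((U ∩ nbhd F u).card : ℝ) := by
  have h : U ⊆ (U ∩ nbhd F u) ∪ univ.filter fun y => ¬ F.Adj u y := by
    intro y hy
    by_cases h : F.Adj u y <;> simp [h, hy]
  have h2 := (Finset.card_le_card h).trans (Finset.card_union_le _ _)
  have h3 : (U.card : ℝ) ≤ ((U ∩ nbhd F u).card : ℝ) + codeg F u := by
    unfold codeg
    exact_mod_cast h2
  linarith

lemma card_cliqueTuples_le (F : SimpleGraph V) (s : ℕ) (U : Finset V) :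
    ((cliqueTuples F s U).card : ℝ) ≤ (Fintype.card V : ℝ) ^ s := by
  have h := Finset.card_le_univ (cliqueTuples F s U)
  rw [Fintype.card_fun, Fintype.card_fin] at h
  exact_mod_cast h

/-- Greedy construction of cliques in a set of vertices of small co-degree. -/
lemma pow_le_card_cliqueTuples (F : SimpleGraph V) {μ ρ : ℝ} (hμ : 0 ≤ μ) (hρ : 0 ≤ ρ) (s : ℕ)
    (U : Finset V) (hU : ∀ v ∈ U, codeg F v ≤ μ) (hs : ((s : ℝ) - 1) * μ + ρ ≤ U.card) :
    ρ ^ s ≤ (cliqueTuples F s U).card := by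
  induction s generalizing U with
  | zero => simp
  | succ s ih =>
    rw [card_cliqueTuples_succ, pow_succ']
    push_cast at hs ⊢
    have h1 : ρ ≤ U.card := by nlinarith [mul_nonneg (Nat.cast_nonneg (α := ℝ) s) hμ]
    calc ρ * ρ ^ s ≤ U.card * ρ ^ s := by gcongr
      _ = ∑ u ∈ U, ρ ^ s := by simp
      _ ≤ _ := by
        -- Choosing u costs at most μ vertices, so the required size falls from sμ + ρ to (s - 1)μ +
        -- ρ.
        refine Finset.sum_le_sum fun u hu => ih _ (fun v hv => hU v (mem_inter.1 hv).1) ?_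
        have := card_sub_codeg_le F U u
        have := hU u hu
        linarith

/-- Greedy construction of cliques whose first vertex has a smaller co-degree. -/
lemma mul_pow_le_card_cliqueTuples (F : SimpleGraph V) {μ₀ μ ρ : ℝ} (hμ : 0 ≤ μ) (hρ : 0 ≤ ρ)
    (s : ℕ) (U X : Finset V) (hX : X ⊆ U) (hX' : ∀ v ∈ X, codeg F v ≤ μ₀)
    (hU : ∀ v ∈ U, codeg F v ≤ μ) (hs : μ₀ + ((s : ℝ) - 1) * μ + ρ ≤ U.card) :
    X.card * ρ ^ s ≤ (cliqueTuples F (s + 1) U).card := by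
  rw [card_cliqueTuples_succ]
  push_cast
  calc X.card * ρ ^ s = ∑ u ∈ X, ρ ^ s := by simp
    _ ≤ ∑ u ∈ X, ((cliqueTuples F s (U ∩ nbhd F u)).card : ℝ) := by
      refine Finset.sum_le_sum fun u hu => pow_le_card_cliqueTuples F hμ hρ s _
        (fun v hv => hU v (mem_inter.1 hv).1) ?_
      have := card_sub_codeg_le F U u
      have := hX' u hu
      linarith
    _ ≤ _ := Finset.sum_le_sum_of_subset_of_nonneg hX fun _ _ _ => Nat.cast_nonneg _

/-- A counting form of Ramsey's theorem. -/
lemma exists_ramsey_count (s t : ℕ) : ∃ c : ℝ, 0 < c ∧ ∃ m : ℕ, ∀ (V : Type) [Fintype V]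
    (R B : SimpleGraph V), R ⊔ B = ⊤ → ∀ U : Finset V, m ≤ U.card →
      c * (U.card : ℝ) ^ s ≤ (cliqueTuples R s U).card ∨
      c * (U.card : ℝ) ^ t ≤ (cliqueTuples B t U).card := by
  induction s generalizing t with
  | zero => exact ⟨1, one_pos, 0, fun V _ R B _ U _ => Or.inl (by simp)⟩
  | succ s ihs =>
    induction t with
    | zero => exact ⟨1, one_pos, 0, fun V _ R B _ U _ => Or.inr (by simp)⟩
    | succ t iht =>
      obtain ⟨c₁, hc₁, m₁, h₁⟩ := ihs (t + 1)
      obtain ⟨c₂, hc₂, m₂, h₂⟩ := iht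
      -- The inductive step common to both colours: half of U may serve as first vertex, each with a
      -- neighbourhood of size at least |U|/4 that has its share of r-cliques.
      have key : ∀ (V : Type) [Fintype V] (F : SimpleGraph V) (U X : Finset V) (r : ℕ) (c : ℝ),
          0 ≤ c → X ⊆ U → (U.card : ℝ) / 2 ≤ X.card →
          (∀ u ∈ X, (U.card : ℝ) / 4 ≤ (U ∩ nbhd F u).card ∧
            c * ((U ∩ nbhd F u).card : ℝ) ^ r ≤ (cliqueTuples F r (U ∩ nbhd F u)).card) →
          c / 4 ^ (r + 1) * (U.card : ℝ) ^ (r + 1) ≤ (cliqueTuples F (r + 1) U).card := by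
        intro V _ F U X r c hc hXU hX h
        rw [card_cliqueTuples_succ]
        push_cast
        calc c / 4 ^ (r + 1) * (U.card : ℝ) ^ (r + 1)
            = ((U.card : ℝ) / 4) * (c * ((U.card : ℝ) / 4) ^ r) := by
              rw [div_pow, pow_succ, pow_succ]; field_simp
          _ ≤ X.card * (c * ((U.card : ℝ) / 4) ^ r) := by
              have : (0 : ℝ) ≤ U.card := Nat.cast_nonneg _
              gcongr
              linarith
          _ = ∑ u ∈ X, (c * ((U.card : ℝ) / 4) ^ r) := by simp
          _ ≤ ∑ u ∈ X, ((cliqueTuples F r (U ∩ nbhd F u)).card : ℝ) := by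
              refine Finset.sum_le_sum fun u hu => le_trans ?_ (h u hu).2
              have := (h u hu).1
              gcongr
          _ ≤ _ := Finset.sum_le_sum_of_subset_of_nonneg hXU fun _ _ _ => Nat.cast_nonneg _
      refine ⟨min (c₁ / 4 ^ (s + 1 + (t + 1))) (c₂ / 4 ^ (s + 1 + (t + 1))), by positivity,
        4 * (m₁ + m₂ + 1), fun V _ R B hRB U hU => ?_⟩
      have hU' : (4 : ℝ) * (m₁ + m₂ + 1) ≤ U.card := by exact_mod_cast hU
      have hU0 : (0 : ℝ) ≤ U.card := Nat.cast_nonneg _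
      have hm1 : (0 : ℝ) ≤ m₁ := Nat.cast_nonneg _
      have hm2 : (0 : ℝ) ≤ m₂ := Nat.cast_nonneg _
      have mono : ∀ (F : SimpleGraph V) (W : Finset V) (r : ℕ),
          ((cliqueTuples F r (U ∩ W)).card : ℝ) ≤ (cliqueTuples F r U).card := by
        intro F W r
        exact_mod_cast Finset.card_le_card (cliqueTuples_mono inter_subset_left)
      -- The weaker power of 4 lets one constant serve all four branches.
      have low : ∀ (r j : ℕ) (c : ℝ) (m : ℝ), 0 < c → r ≤ j → (U.card : ℝ) / 4 ≤ m →
          c / 4 ^ j * (U.card : ℝ) ^ r ≤ c * m ^ r := by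
        intro r j c m hc hj hm
        calc c / 4 ^ j * (U.card : ℝ) ^ r ≤ c / 4 ^ r * (U.card : ℝ) ^ r := by
              gcongr
              norm_num
          _ = c * ((U.card : ℝ) / 4) ^ r := by rw [div_pow]; ring
          _ ≤ c * m ^ r := by gcongr
      have hsplit : ∀ u ∈ U, (U.card : ℝ) / 4 ≤ (U ∩ nbhd R u).card ∨
          (U.card : ℝ) / 4 ≤ (U ∩ nbhd B u).card := by
        intro u hu
        have hsub : U ⊆ insert u ((U ∩ nbhd R u) ∪ (U ∩ nbhd B u)) := by
          intro y hy
          by_cases hyu : y = u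
          · simp [hyu]
          · have : (R ⊔ B).Adj u y := by rw [hRB]; exact fun h => hyu h.symm
            rw [SimpleGraph.sup_adj] at this
            simp [hy, this]
        have h := (Finset.card_le_card hsub).trans ((Finset.card_insert_le _ _).trans
          (Nat.add_le_add_right (Finset.card_union_le _ _) 1))
        have h' : (U.card : ℝ) ≤ (U ∩ nbhd R u).card + (U ∩ nbhd B u).card + 1 := by
          exact_mod_cast h
        by_contra! hcon
        linarith [hcon.1, hcon.2]
      set X := U.filter fun u => (U.card : ℝ) / 4 ≤ (U ∩ nbhd R u).card with hXdef
      by_cases hX : (U.card : ℝ) / 2 ≤ X.card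
      · by_cases hgood : ∀ u ∈ X, c₁ * ((U ∩ nbhd R u).card : ℝ) ^ s ≤
            (cliqueTuples R s (U ∩ nbhd R u)).card
        · left
          refine le_trans ?_ (key V R U X s c₁ hc₁.le (filter_subset _ _) hX
            fun u hu => ⟨(mem_filter.1 hu).2, hgood u hu⟩)
          gcongr
          refine (min_le_left _ _).trans ?_
          exact div_le_div_of_nonneg_left hc₁.le (by positivity)
            (pow_le_pow_right₀ (by norm_num) (by omega))
        -- One failing neighbourhood suffices: there the hypothesis for (s, t + 1) already gives
        -- enough B-cliques of size t + 1.
        · push Not at hgood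
          obtain ⟨u, hu, hlt⟩ := hgood
          have hsz := (mem_filter.1 hu).2
          right
          have := (h₁ V R B hRB (U ∩ nbhd R u) (by
            have : (m₁ : ℝ) ≤ (U ∩ nbhd R u).card := by linarith
            exact_mod_cast this)).resolve_left (not_le.2 hlt)
          refine le_trans ?_ (this.trans (mono _ _ _))
          refine le_trans ?_ (low (t + 1) (s + 1 + (t + 1)) c₁ _ hc₁ (by omega) hsz)
          gcongr
          exact min_le_left _ _
      · set Y := U.filter fun u => ¬ (U.card : ℝ) / 4 ≤ (U ∩ nbhd R u).card with hYdef
        have hY : (U.card : ℝ) / 2 ≤ Y.card := by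
          have : X.card + Y.card = U.card := Finset.card_filter_add_card_filter_not _
          have : (X.card : ℝ) + Y.card = U.card := by exact_mod_cast this
          linarith
        have hYsz : ∀ u ∈ Y, (U.card : ℝ) / 4 ≤ (U ∩ nbhd B u).card := fun u hu =>
          (hsplit u (mem_filter.1 hu).1).resolve_left (mem_filter.1 hu).2
        by_cases hgood : ∀ u ∈ Y, c₂ * ((U ∩ nbhd B u).card : ℝ) ^ t ≤
            (cliqueTuples B t (U ∩ nbhd B u)).card
        · right
          refine le_trans ?_ (key V B U Y t c₂ hc₂.le (filter_subset _ _) hY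
            fun u hu => ⟨hYsz u hu, hgood u hu⟩)
          gcongr
          refine (min_le_right _ _).trans ?_
          exact div_le_div_of_nonneg_left hc₂.le (by positivity)
            (pow_le_pow_right₀ (by norm_num) (by omega))
        · push Not at hgood
          obtain ⟨u, hu, hlt⟩ := hgood
          have hsz := hYsz u hu
          left
          have := (h₂ V R B hRB (U ∩ nbhd B u) (by
            have : (m₂ : ℝ) ≤ (U ∩ nbhd B u).card := by linarith
            exact_mod_cast this)).resolve_right (not_le.2 hlt)
          refine le_trans ?_ (this.trans (mono _ _ _))
          refine le_trans ?_ (low (s + 1) (s + 1 + (t + 1)) c₂ _ hc₂ (by omega) hsz)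
          gcongr
          exact min_le_right _ _

end CliqueCounting

/-! ### Consequences of having few eyes. -/

section EyeCounting

open Finset
open scoped Classical

/-- The common neighbourhood in `F` of the entries of `f`. -/
noncomputable def commonNbhd {V : Type*} [Fintype V] (F : SimpleGraph V) {s : ℕ}
    (f : Fin s → V) : Finset V :=
  {y | ∀ i, F.Adj (f i) y}

/-- The placements of the eye `I_{a,b}` in the igraph with red pairs `R` and blue pairs `B`. -/
noncomputable def eyeTuples {V : Type*} [Fintype V] (R B : SimpleGraph V) (a b : ℕ) :
    Finset ((Fin a → V) × (Fin b → V)) :=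
  {f | f.1 ∈ cliqueTuples R a univ ∧ f.2 ∈ cliqueTuples B b (commonNbhd R f.1)}

variable {V : Type*} [Fintype V]

@[simp] lemma mem_commonNbhd {F : SimpleGraph V} {s : ℕ} {f : Fin s → V} {y : V} :
    y ∈ commonNbhd F f ↔ ∀ i, F.Adj (f i) y := by
  simp [commonNbhd]

lemma mem_eyeTuples {R B : SimpleGraph V} {a b : ℕ} {f : (Fin a → V) × (Fin b → V)} :
    f ∈ eyeTuples R B a b ↔
      f.1 ∈ cliqueTuples R a univ ∧ f.2 ∈ cliqueTuples B b (commonNbhd R f.1) := by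
  simp [eyeTuples]

lemma card_eyeTuples (R B : SimpleGraph V) (a b : ℕ) :
    (eyeTuples R B a b).card
      = ∑ α ∈ cliqueTuples R a univ, (cliqueTuples B b (commonNbhd R α)).card := by
  rw [← Finset.card_sigma]
  refine Finset.card_bij (fun f _ => ⟨f.1, f.2⟩) ?_ ?_ ?_
  · intro f hf
    rw [mem_eyeTuples] at hf
    exact mem_sigma.2 hf
  · rintro ⟨f, f'⟩ - ⟨g, g'⟩ - h
    simpa using h
  · rintro ⟨α, β⟩ h
    exact ⟨(α, β), mem_eyeTuples.2 (mem_sigma.1 h), rfl⟩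

lemma cliqueTuples_eq_filter (F : SimpleGraph V) (s : ℕ) (U : Finset V) :
    cliqueTuples F s U = (cliqueTuples F s univ).filter fun f => ∀ i, f i ∈ U := by
  ext f
  simp only [mem_cliqueTuples, mem_filter, mem_univ, implies_true, true_and]
  exact and_comm

/-- Double counting of pairs consisting of a clique and a vertex joined to all of it. -/
lemma sum_card_filter_forall_mem (F : SimpleGraph V) (s : ℕ) (U : Finset V)
    (N : V → Finset V) :
    ∑ f ∈ cliqueTuples F s univ, (U.filter fun u => ∀ i, f i ∈ N u).card
      = ∑ u ∈ U, (cliqueTuples F s (N u)).card := by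
  have := Finset.sum_card_bipartiteAbove_eq_sum_card_bipartiteBelow
    (s := cliqueTuples F s univ) (t := U) (fun f u => ∀ i, f i ∈ N u)
  simp only [bipartiteAbove, bipartiteBelow] at this
  rw [this]
  exact Finset.sum_congr rfl fun u _ => by rw [cliqueTuples_eq_filter F s (N u)]

/-- A bounded function with a large sum is often large. -/
lemma half_le_mul_card_filter {ι : Type*} (A : Finset ι) (f : ι → ℝ) {M θ T : ℝ}
    (hM : ∀ i ∈ A, f i ≤ M) (hθ : 0 ≤ θ) (hT : T ≤ ∑ i ∈ A, f i)
    (hA : A.card * θ ≤ T / 2) : T / 2 ≤ M * (A.filter fun i => θ ≤ f i).card := by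
  have h1 : ∑ i ∈ A.filter (fun i => θ ≤ f i), f i ≤ M * (A.filter fun i => θ ≤ f i).card := by
    rw [mul_comm, ← nsmul_eq_mul]
    exact Finset.sum_le_card_nsmul _ _ _ fun i hi => hM i (mem_filter.1 hi).1
  have h2 : ∑ i ∈ A.filter (fun i => ¬ θ ≤ f i), f i ≤ A.card * θ := by
    calc ∑ i ∈ A.filter (fun i => ¬ θ ≤ f i), f i
        ≤ (A.filter (fun i => ¬ θ ≤ f i)).card * θ := by
          rw [← nsmul_eq_mul]
          exact Finset.sum_le_card_nsmul _ _ _ fun i hi => (not_le.1 (mem_filter.1 hi).2).le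
      _ ≤ A.card * θ := by
          gcongr
          exact filter_subset _ _
  have h3 := Finset.sum_filter_add_sum_filter_not A (fun i => θ ≤ f i) f
  linarith

/-- In an igraph with few eyes, a large set of vertices that lie in many red cliques of size
`a + 1` contains many red cliques of any size. -/
lemma exists_many_red_cliques (a b s : ℕ) {η : ℝ} (hη : 0 < η) :
    ∃ δ : ℝ, 0 < δ ∧ ∃ c : ℝ, 0 < c ∧ ∃ n₀ : ℕ, ∀ (V : Type) [Fintype V] (R B : SimpleGraph V),
      R ⊔ B = ⊤ → n₀ ≤ Fintype.card V →
      ((eyeTuples R B a b).card : ℝ) ≤ δ * (Fintype.card V : ℝ) ^ (a + b) →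
      ∀ U : Finset V,
        (∀ u ∈ U, η * (Fintype.card V : ℝ) ^ a ≤ (cliqueTuples R a (nbhd R u)).card) →
        η * Fintype.card V ≤ U.card →
        c * (Fintype.card V : ℝ) ^ s ≤ (cliqueTuples R s U).card := by
  obtain ⟨c₀, hc₀, m, hram⟩ := exists_ramsey_count s b
  set ζ := η ^ 2 / 2 with hζ
  have hζ0 : 0 < ζ := by positivity
  obtain ⟨n₀, hn₀⟩ := exists_nat_ge (m / ζ)
  refine ⟨c₀ * ζ ^ (b + 1) / 2, by positivity, c₀ * ζ ^ s, by positivity, n₀ + 1,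
    fun V _ R B hRB hV hE U hU hUη => ?_⟩
  set N : ℝ := (Fintype.card V : ℝ) with hN
  have hNpos : 0 < N := by
    have : 0 < Fintype.card V := by omega
    rw [hN]; exact_mod_cast this
  have hNm : (m : ℝ) ≤ ζ * N := by
    rw [div_le_iff₀ hζ0] at hn₀
    have : (n₀ : ℝ) ≤ N := by
      rw [hN]; exact_mod_cast (by omega : n₀ ≤ Fintype.card V)
    nlinarith
  set A := cliqueTuples R a (univ : Finset V) with hA
  -- Double counting pairs of an a-clique and a vertex of U joined to all of it makes W f linear in
  -- size for many f.
  set W : (Fin a → V) → Finset V := fun f => U.filter fun u => ∀ i, f i ∈ nbhd R u with hW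
  have hWsub : ∀ f, W f ⊆ commonNbhd R f := by
    intro f u hu
    simp only [hW, mem_filter, mem_nbhd] at hu
    rw [mem_commonNbhd]
    exact fun i => (hu.2 i).symm
  have hsum : η ^ 2 * N ^ (a + 1) ≤ ∑ f ∈ A, ((W f).card : ℝ) := by
    have h := sum_card_filter_forall_mem R a U (nbhd R)
    have h' : ∑ f ∈ A, ((W f).card : ℝ) = ∑ u ∈ U, ((cliqueTuples R a (nbhd R u)).card : ℝ) := by
      exact_mod_cast h
    rw [h']
    calc η ^ 2 * N ^ (a + 1) = (η * N) * (η * N ^ a) := by ring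
      _ ≤ U.card * (η * N ^ a) := by gcongr
      _ = ∑ u ∈ U, (η * N ^ a) := by simp
      _ ≤ _ := Finset.sum_le_sum hU
  have hcardA : (A.card : ℝ) ≤ N ^ a := card_cliqueTuples_le _ _ _
  have hmany := half_le_mul_card_filter A (fun f => ((W f).card : ℝ)) (M := N) (θ := ζ * N)
    (fun f _ => by rw [hN]; exact_mod_cast Finset.card_le_univ _) (by positivity) hsum (by
      calc (A.card : ℝ) * (ζ * N) ≤ N ^ a * (ζ * N) := by gcongr
        _ = η ^ 2 * N ^ (a + 1) / 2 := by rw [hζ]; ring)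
  set A' := A.filter fun f => ζ * N ≤ ((W f).card : ℝ) with hA'
  have hmany' : ζ * N ^ a ≤ A'.card := by
    have : N * (ζ * N ^ a) ≤ N * A'.card := by
      refine le_trans (le_of_eq ?_) hmany
      rw [hζ]; ring
    exact le_of_mul_le_mul_left this hNpos
  -- If every such W f has many B-cliques of size b, they form too many eyes with centre f.
  -- Otherwise Ramsey counting in a single W f yields the R-cliques.
  by_cases hall : ∀ f ∈ A', c₀ * ((W f).card : ℝ) ^ b ≤ (cliqueTuples B b (W f)).card
  · exfalso
    have : c₀ * ζ ^ (b + 1) * N ^ (a + b) ≤ (eyeTuples R B a b).card := by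
      rw [card_eyeTuples]
      push_cast
      calc c₀ * ζ ^ (b + 1) * N ^ (a + b) = (ζ * N ^ a) * (c₀ * (ζ * N) ^ b) := by
            rw [mul_pow]; ring
        _ ≤ A'.card * (c₀ * (ζ * N) ^ b) := by gcongr
        _ = ∑ f ∈ A', (c₀ * (ζ * N) ^ b) := by simp
        _ ≤ ∑ f ∈ A', ((cliqueTuples B b (commonNbhd R f)).card : ℝ) := by
            refine Finset.sum_le_sum fun f hf => ?_
            have h1 := (mem_filter.1 hf).2
            calc c₀ * (ζ * N) ^ b ≤ c₀ * ((W f).card : ℝ) ^ b := by gcongr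
              _ ≤ _ := hall f hf
              _ ≤ _ := by exact_mod_cast Finset.card_le_card (cliqueTuples_mono (hWsub f))
        _ ≤ _ := Finset.sum_le_sum_of_subset_of_nonneg (filter_subset _ _)
            fun _ _ _ => Nat.cast_nonneg _
    have hpos : 0 < c₀ * ζ ^ (b + 1) * N ^ (a + b) := by positivity
    linarith
  · push Not at hall
    obtain ⟨f, hf, hlt⟩ := hall
    have h1 := (mem_filter.1 hf).2
    have h2 := (hram V R B hRB (W f) (by
      have := hNm.trans h1
      exact_mod_cast this)).resolve_right (not_le.2 hlt)
    calc c₀ * ζ ^ s * N ^ s = c₀ * (ζ * N) ^ s := by rw [mul_pow]; ring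
      _ ≤ c₀ * ((W f).card : ℝ) ^ s := by gcongr
      _ ≤ _ := h2
      _ ≤ _ := by exact_mod_cast Finset.card_le_card (cliqueTuples_mono (filter_subset _ _))

/-- In an igraph with few eyes `I_{a,k+1}`, almost every vertex that lies in many red cliques of
size `a + 1` has few blue cliques of size `k` in its green neighbourhood. -/
lemma exists_few_blue_cliques (a k : ℕ) {η τ : ℝ} (hη : 0 < η) (hτ : 0 < τ) :
    ∃ δ : ℝ, 0 < δ ∧ ∃ n₀ : ℕ, ∀ (V : Type) [Fintype V] (R B : SimpleGraph V),
      R ⊔ B = ⊤ → n₀ ≤ Fintype.card V →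
      ((eyeTuples R B a (k + 1)).card : ℝ) ≤ δ * (Fintype.card V : ℝ) ^ (a + (k + 1)) →
      (((univ : Finset V).filter fun u =>
        η * (Fintype.card V : ℝ) ^ a ≤ (cliqueTuples R a (nbhd R u)).card ∧
        τ * (Fintype.card V : ℝ) ^ k < (cliqueTuples B k (nbhd R u ∩ nbhd B u)).card).card : ℝ)
        ≤ τ * Fintype.card V := by
  have hη' : 0 < min η (τ ^ 2 / 2) := by positivity
  -- Size a + 1 is one more than the centre of an eye: the extra vertex will complete the blue
  -- clique.
  obtain ⟨δ, hδ, c, hc, n₀, hS⟩ := exists_many_red_cliques a (k + 1) (a + 1) hη'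
  refine ⟨min δ (c * (τ ^ 2 / 2) / 2), by positivity, n₀ + 1, fun V _ R B hRB hV hE => ?_⟩
  set N : ℝ := (Fintype.card V : ℝ) with hN
  have hNpos : 0 < N := by
    have : 0 < Fintype.card V := by omega
    rw [hN]; exact_mod_cast this
  have hE1 : ((eyeTuples R B a (k + 1)).card : ℝ) ≤ δ * N ^ (a + (k + 1)) :=
    hE.trans (by gcongr; exact min_le_left _ _)
  have hE2 : ((eyeTuples R B a (k + 1)).card : ℝ) ≤ c * (τ ^ 2 / 2) / 2 * N ^ (a + (k + 1)) :=
    hE.trans (by gcongr; exact min_le_right _ _)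
  by_contra! hcon
  set X := (univ : Finset V).filter fun u =>
        η * N ^ a ≤ (cliqueTuples R a (nbhd R u)).card ∧
        τ * N ^ k < (cliqueTuples B k (nbhd R u ∩ nbhd B u)).card with hX
  set Z := cliqueTuples B k (univ : Finset V) with hZ
  set W : (Fin k → V) → Finset V :=
    fun f => X.filter fun u => ∀ i, f i ∈ nbhd R u ∩ nbhd B u with hW
  have hsum : τ ^ 2 * N ^ (k + 1) ≤ ∑ f ∈ Z, ((W f).card : ℝ) := by
    have h := sum_card_filter_forall_mem B k X (fun u => nbhd R u ∩ nbhd B u)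
    have h' : ∑ f ∈ Z, ((W f).card : ℝ)
        = ∑ u ∈ X, ((cliqueTuples B k (nbhd R u ∩ nbhd B u)).card : ℝ) := by
      exact_mod_cast h
    rw [h']
    calc τ ^ 2 * N ^ (k + 1) = (τ * N) * (τ * N ^ k) := by ring
      _ ≤ X.card * (τ * N ^ k) := by gcongr
      _ = ∑ u ∈ X, (τ * N ^ k) := by simp
      _ ≤ _ := Finset.sum_le_sum fun u hu => (mem_filter.1 hu).2.2.le
  have hcardZ : (Z.card : ℝ) ≤ N ^ k := card_cliqueTuples_le _ _ _
  have hmany := half_le_mul_card_filter Z (fun f => ((W f).card : ℝ)) (M := N)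
    (θ := τ ^ 2 / 2 * N)
    (fun f _ => by rw [hN]; exact_mod_cast Finset.card_le_univ _) (by positivity) hsum (by
      calc (Z.card : ℝ) * (τ ^ 2 / 2 * N) ≤ N ^ k * (τ ^ 2 / 2 * N) := by gcongr
        _ = τ ^ 2 * N ^ (k + 1) / 2 := by ring)
  set Z' := Z.filter fun f => τ ^ 2 / 2 * N ≤ ((W f).card : ℝ) with hZ'
  have hmany' : τ ^ 2 / 2 * N ^ k ≤ Z'.card := by
    have : N * (τ ^ 2 / 2 * N ^ k) ≤ N * Z'.card := by
      refine le_trans (le_of_eq ?_) hmany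
      ring
    exact le_of_mul_le_mul_left this hNpos
  have hcl : ∀ z ∈ Z', c * N ^ (a + 1) ≤ (cliqueTuples R (a + 1) (W z)).card := by
    intro z hz
    refine hS V R B hRB (by omega) hE1 (W z) (fun u hu => ?_) ?_
    · refine le_trans ?_ (mem_filter.1 (mem_filter.1 hu).1).2.1
      gcongr
      exact min_le_left _ _
    · refine le_trans ?_ (mem_filter.1 hz).2
      gcongr
      exact min_le_right _ _
  -- In the clique γ inside W z, the entries after the first form the centre of an eye, and entry 0
  -- enlarges z to a B-clique of size k + 1. This works because W z consists of common green
  -- neighbours of z, which are adjacent to z in both graphs.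
  have hcount : (∑ z ∈ Z', (cliqueTuples R (a + 1) (W z)).card) ≤ (eyeTuples R B a (k + 1)).card := by
    rw [← Finset.card_sigma]
    refine Finset.card_le_card_of_injOn
      (fun x => (Fin.tail x.2, (Fin.cons (x.2 0) x.1 : Fin (k + 1) → V))) ?_ ?_
    · rintro ⟨z, γ⟩ hx
      rw [mem_coe, mem_sigma] at hx
      obtain ⟨hz, hγ⟩ := hx
      have hγ' := hγ
      rw [← Fin.cons_self_tail γ, cons_mem_cliqueTuples] at hγ'
      have hzZ := (mem_filter.1 hz).1
      simp only [hZ, mem_cliqueTuples] at hzZ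
      have hγW : ∀ i j, z j ∈ nbhd R (γ i) ∩ nbhd B (γ i) := fun i j =>
        (mem_filter.1 ((mem_cliqueTuples.1 hγ).1 i)).2 j
      simp only [mem_inter, mem_nbhd] at hγW
      rw [mem_coe, mem_eyeTuples]
      refine ⟨cliqueTuples_mono (subset_univ _) hγ'.2, ?_⟩
      rw [cons_mem_cliqueTuples]
      refine ⟨?_, ?_⟩
      · rw [mem_commonNbhd]
        intro i
        exact (mem_cliqueTuples.1 hγ).2 i.succ 0 (by simp [Fin.ext_iff])
      · rw [mem_cliqueTuples]
        refine ⟨fun j => ?_, hzZ.2⟩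
        rw [mem_inter, mem_commonNbhd, mem_nbhd]
        exact ⟨fun i => (hγW i.succ j).1, (hγW 0 j).2⟩
    · rintro ⟨z, γ⟩ - ⟨z', γ'⟩ - h
      simp only [Prod.mk.injEq] at h
      obtain ⟨h1, h2⟩ := h
      have h3 := Fin.cons_injective2 h2
      simp only [Sigma.mk.injEq, heq_eq_eq]
      refine ⟨h3.2, ?_⟩
      rw [← Fin.cons_self_tail γ, ← Fin.cons_self_tail γ', h1, h3.1]
  have hlow : c * (τ ^ 2 / 2) * N ^ (a + (k + 1)) ≤ (eyeTuples R B a (k + 1)).card := by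
    calc c * (τ ^ 2 / 2) * N ^ (a + (k + 1)) = (τ ^ 2 / 2 * N ^ k) * (c * N ^ (a + 1)) := by ring
      _ ≤ Z'.card * (c * N ^ (a + 1)) := by gcongr
      _ = ∑ z ∈ Z', (c * N ^ (a + 1)) := by simp
      _ ≤ ∑ z ∈ Z', ((cliqueTuples R (a + 1) (W z)).card : ℝ) := Finset.sum_le_sum hcl
      _ ≤ _ := by exact_mod_cast hcount
  have hpos : 0 < c * (τ ^ 2 / 2) * N ^ (a + (k + 1)) := by positivity
  linarith

end EyeCounting

/-! ### Loss, loss bounds, and the dichotomy between poor and rich vertices. -/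

section Loss

open Finset
open scoped Classical

/-- The loss of a pair in the igraph with red pairs `R` and blue pairs `B`: the weight that the
pair would gain by becoming green. -/
noncomputable def pairLoss {V : Type*} (p : ℝ) (R B : SimpleGraph V) (x y : V) : ℝ :=
  (if R.Adj x y then 0 else p) + (if B.Adj x y then 0 else 1 - p)

/-- The total loss of the ordered pairs in `U × W`. -/
noncomputable def lossBetween {V : Type*} (p : ℝ) (R B : SimpleGraph V) (U W : Finset V) : ℝ :=
  ∑ x ∈ U, ∑ y ∈ W, pairLoss p R B x y

/-- Asymptotically, igraphs with few eyes `I_{a,b}` have loss at least `c` per ordered pair. -/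
def IsLossBound (p : ℝ) (a b : ℕ) (c : ℝ) : Prop :=
  ∀ ε : ℝ, 0 < ε → ∃ δ : ℝ, 0 < δ ∧ ∃ n₀ : ℕ, ∀ (V : Type) [Fintype V] (R B : SimpleGraph V),
    R ⊔ B = ⊤ → n₀ ≤ Fintype.card V →
    ((eyeTuples R B a b).card : ℝ) ≤ δ * (Fintype.card V : ℝ) ^ (a + b) →
    (c - ε) * (Fintype.card V : ℝ) ^ 2 ≤ lossBetween p R B univ univ

section

variable {V : Type*} {p : ℝ} {R B : SimpleGraph V}

lemma pairLoss_nonneg (h0 : 0 ≤ p) (h1 : p ≤ 1) (x y : V) : 0 ≤ pairLoss p R B x y := by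
  unfold pairLoss
  split_ifs <;> linarith

lemma pairLoss_le_one (h0 : 0 ≤ p) (h1 : p ≤ 1) (x y : V) : pairLoss p R B x y ≤ 1 := by
  unfold pairLoss
  split_ifs <;> linarith

lemma pairLoss_comm (x y : V) : pairLoss p R B x y = pairLoss p R B y x := by
  simp only [pairLoss, SimpleGraph.adj_comm]

lemma lossBetween_comm (U W : Finset V) : lossBetween p R B U W = lossBetween p R B W U := by
  unfold lossBetween
  rw [Finset.sum_comm]
  simp only [pairLoss_comm]

lemma lossBetween_nonneg (h0 : 0 ≤ p) (h1 : p ≤ 1) (U W : Finset V) :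
    0 ≤ lossBetween p R B U W :=
  Finset.sum_nonneg fun _ _ => Finset.sum_nonneg fun _ _ => pairLoss_nonneg h0 h1 _ _

lemma lossBetween_le (h0 : 0 ≤ p) (h1 : p ≤ 1) (U W : Finset V) :
    lossBetween p R B U W ≤ U.card * W.card := by
  calc lossBetween p R B U W ≤ ∑ x ∈ U, ∑ y ∈ W, (1 : ℝ) :=
        Finset.sum_le_sum fun _ _ => Finset.sum_le_sum fun _ _ => pairLoss_le_one h0 h1 _ _
    _ = _ := by simp

lemma lossBetween_union_left {U W : Finset V} (h : Disjoint U W) (X : Finset V) :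
    lossBetween p R B (U ∪ W) X = lossBetween p R B U X + lossBetween p R B W X :=
  Finset.sum_union h

lemma lossBetween_union_right {U W : Finset V} (h : Disjoint U W) (X : Finset V) :
    lossBetween p R B X (U ∪ W) = lossBetween p R B X U + lossBetween p R B X W := by
  rw [lossBetween_comm, lossBetween_union_left h, lossBetween_comm U, lossBetween_comm W]

lemma lossBetween_mono (h0 : 0 ≤ p) (h1 : p ≤ 1) {U U' W W' : Finset V} (hU : U ⊆ U')
    (hW : W ⊆ W') : lossBetween p R B U W ≤ lossBetween p R B U' W' := by
  calc lossBetween p R B U W ≤ ∑ x ∈ U, ∑ y ∈ W', pairLoss p R B x y :=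
        Finset.sum_le_sum fun _ _ => Finset.sum_le_sum_of_subset_of_nonneg hW
          fun _ _ _ => pairLoss_nonneg h0 h1 _ _
    _ ≤ _ := Finset.sum_le_sum_of_subset_of_nonneg hU fun _ _ _ =>
          Finset.sum_nonneg fun _ _ => pairLoss_nonneg h0 h1 _ _

/-- Inclusion–exclusion: subtracting the loss from U to everything twice removes the loss inside U
once too often. -/
lemma lossBetween_compl [Fintype V] (U : Finset V) :
    lossBetween p R B Uᶜ Uᶜ
      = lossBetween p R B univ univ - 2 * lossBetween p R B U univ + lossBetween p R B U U := by
  have hd : Disjoint U Uᶜ := disjoint_compl_right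
  have hu : (univ : Finset V) = U ∪ Uᶜ := (union_compl U).symm
  rw [hu, lossBetween_union_left hd, lossBetween_union_right hd, lossBetween_union_right hd,
    lossBetween_comm Uᶜ U]
  ring

lemma lossBetween_singleton_univ [Fintype V] (u : V) :
    lossBetween p R B {u} univ = p * codeg R u + (1 - p) * codeg B u := by
  simp only [lossBetween, pairLoss, sum_singleton, sum_add_distrib, codeg, card_filter]
  push_cast
  rw [mul_sum, mul_sum]
  congr 1 <;> refine Finset.sum_congr rfl fun y _ => ?_
  · by_cases h : R.Adj u y <;> simp [h]
  · by_cases h : B.Adj u y <;> simp [h]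

lemma lossBetween_univ_eq_sum [Fintype V] (U : Finset V) :
    lossBetween p R B U univ = ∑ u ∈ U, lossBetween p R B {u} univ := by
  simp [lossBetween]

end

lemma card_eyeTuples_comap_le {V : Type*} [Fintype V] (R B : SimpleGraph V) (a b : ℕ)
    (U : Finset V) :
    (eyeTuples (R.comap (Subtype.val : U → V)) (B.comap (Subtype.val : U → V)) a b).card
      ≤ (eyeTuples R B a b).card := by
  refine Finset.card_le_card_of_injOn
    (fun f => (fun i => (f.1 i : V), fun j => (f.2 j : V))) ?_ ?_
  · intro f hf
    simpa [mem_eyeTuples, mem_cliqueTuples] using hf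
  · rintro ⟨f, f'⟩ - ⟨g, g'⟩ - h
    simp only [Prod.mk.injEq, funext_iff] at h
    ext i
    · exact h.1 i
    · exact h.2 i

lemma lossBetween_comap {V : Type*} (p : ℝ) (R B : SimpleGraph V) (U : Finset V) :
    lossBetween p (R.comap (Subtype.val : U → V)) (B.comap (Subtype.val : U → V)) univ univ
      = lossBetween p R B U U := by
  unfold lossBetween
  rw [← Finset.sum_coe_sort U]
  refine Finset.sum_congr rfl fun x _ => ?_
  rw [← Finset.sum_coe_sort U]
  rfl

/-- A loss bound applies to all induced sub-igraphs. -/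
lemma IsLossBound.lossBetween_self {p c : ℝ} {a b : ℕ} (h : IsLossBound p a b c) (h0 : 0 ≤ p)
    (h1 : p ≤ 1) (hc : c ≤ 1) {ε : ℝ} (hε : 0 < ε) :
    ∃ δ : ℝ, 0 < δ ∧ ∃ n₀ : ℕ, ∀ (V : Type) [Fintype V] (R B : SimpleGraph V),
      R ⊔ B = ⊤ → n₀ ≤ Fintype.card V →
      ((eyeTuples R B a b).card : ℝ) ≤ δ * (Fintype.card V : ℝ) ^ (a + b) →
      ∀ U : Finset V,
        c * (U.card : ℝ) ^ 2 - ε * (Fintype.card V : ℝ) ^ 2 ≤ lossBetween p R B U U := by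
  obtain ⟨δ, hδ, n₁, hL⟩ := h ε hε
  -- Sets smaller than θ|V| satisfy c|U|² ≤ ε|V|² and need no argument. For larger ones the eye
  -- count is rescaled, which costs θ^(a + b) in δ.
  set θ := min ε 1 with hθ
  have hθ0 : 0 < θ := by positivity
  have hθ2 : θ ^ 2 ≤ ε := by
    nlinarith [min_le_left ε 1, min_le_right ε 1]
  obtain ⟨n₀, hn₀⟩ := exists_nat_ge (n₁ / θ)
  refine ⟨δ * θ ^ (a + b), by positivity, n₀, fun V _ R B hRB hV hE U => ?_⟩
  have hN0 : (0 : ℝ) ≤ Fintype.card V := Nat.cast_nonneg _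
  have hUN : (U.card : ℝ) ≤ Fintype.card V := by exact_mod_cast Finset.card_le_univ U
  have hU0 : (0 : ℝ) ≤ U.card := Nat.cast_nonneg _
  by_cases hU : (U.card : ℝ) < θ * Fintype.card V
  · have : (U.card : ℝ) ^ 2 ≤ ε * (Fintype.card V : ℝ) ^ 2 := by
      calc (U.card : ℝ) ^ 2 ≤ (θ * Fintype.card V) ^ 2 := by gcongr
        _ = θ ^ 2 * (Fintype.card V : ℝ) ^ 2 := by ring
        _ ≤ _ := by gcongr
    have h3 : c * (U.card : ℝ) ^ 2 ≤ (U.card : ℝ) ^ 2 :=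
      mul_le_of_le_one_left (by positivity) hc
    linarith [lossBetween_nonneg (R := R) (B := B) h0 h1 U U]
  · push Not at hU
    have hsup : R.comap (Subtype.val : U → V) ⊔ B.comap (Subtype.val : U → V) = ⊤ := by
      ext x y
      simp only [SimpleGraph.sup_adj, SimpleGraph.comap_adj, SimpleGraph.top_adj]
      rw [← SimpleGraph.sup_adj, hRB, SimpleGraph.top_adj]
      exact not_congr Subtype.ext_iff.symm
    have := hL U (R.comap (Subtype.val : U → V)) (B.comap (Subtype.val : U → V)) hsup (by
      rw [Fintype.card_coe]
      rw [div_le_iff₀ hθ0] at hn₀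
      have h2 : (n₀ : ℝ) ≤ Fintype.card V := by exact_mod_cast hV
      have : (n₁ : ℝ) ≤ U.card := by nlinarith
      exact_mod_cast this) (by
      rw [Fintype.card_coe]
      calc _ ≤ ((eyeTuples R B a b).card : ℝ) := by
            exact_mod_cast card_eyeTuples_comap_le R B a b U
        _ ≤ _ := hE
        _ = δ * (θ * Fintype.card V) ^ (a + b) := by rw [mul_pow]; ring
        _ ≤ _ := by gcongr)
    rw [lossBetween_comap, Fintype.card_coe] at this
    nlinarith [pow_le_pow_left₀ hU0 hUN 2]

/-- In a near-extremal igraph almost no vertex has a loss much above the average. -/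
lemma IsLossBound.card_filter_le {p c : ℝ} {a b : ℕ} (h : IsLossBound p a b c) (h0 : 0 ≤ p)
    (h1 : p ≤ 1) (hc0 : 0 ≤ c) (hc : c ≤ 1) {η : ℝ} (hη : 0 < η) :
    ∃ δ : ℝ, 0 < δ ∧ ∃ n₀ : ℕ, ∀ (V : Type) [Fintype V] (R B : SimpleGraph V),
      R ⊔ B = ⊤ → n₀ ≤ Fintype.card V →
      ((eyeTuples R B a b).card : ℝ) ≤ δ * (Fintype.card V : ℝ) ^ (a + b) →
      lossBetween p R B univ univ ≤ (c + δ) * (Fintype.card V : ℝ) ^ 2 →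
      ((univ.filter fun u => (c + η) * Fintype.card V < lossBetween p R B {u} univ).card : ℝ)
        ≤ η * Fintype.card V := by
  obtain ⟨δ, hδ, n₁, hL⟩ := h.lossBetween_self h0 h1 hc (ε := η ^ 2 / 8) (by positivity)
  obtain ⟨n₂, hn₂⟩ := exists_nat_ge (2 / η)
  refine ⟨min δ (η ^ 2 / 8), by positivity, max n₁ (n₂ + 1), fun V _ R B hRB hV hE hloss => ?_⟩
  set N : ℝ := (Fintype.card V : ℝ) with hN
  have hVn : n₂ + 1 ≤ Fintype.card V := (le_max_right _ _).trans hV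
  have hNη : 2 ≤ η * N := by
    rw [div_le_iff₀ hη] at hn₂
    have : (n₂ : ℝ) ≤ N := by rw [hN]; exact_mod_cast (by omega : n₂ ≤ Fintype.card V)
    nlinarith
  by_contra! hcon
  set X := univ.filter fun u => (c + η) * N < lossBetween p R B {u} univ with hX
  -- Deleting x bad vertices saves 2xηN more than the average allows, at an error x². Hence only
  -- about ηN of them are deleted, rounding included, so that x ≤ 3ηN/2 and the saving wins.
  obtain ⟨X', hX'X, hX'c⟩ := Finset.exists_subset_card_eq (s := X) (n := ⌈η * N⌉₊)
    (Nat.ceil_le.2 hcon.le)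
  have hx1 : η * N ≤ X'.card := by rw [hX'c]; exact Nat.le_ceil _
  have hx2 : (X'.card : ℝ) < η * N + 1 := by
    rw [hX'c]; exact Nat.ceil_lt_add_one (by linarith)
  have hbig : X'.card * ((c + η) * N) ≤ lossBetween p R B X' univ := by
    rw [lossBetween_univ_eq_sum, ← nsmul_eq_mul]
    exact Finset.card_nsmul_le_sum _ _ _ fun u hu => (mem_filter.1 (hX'X hu)).2.le
  have hcompl := lossBetween_compl (p := p) (R := R) (B := B) X'
  have hsmall := lossBetween_le (R := R) (B := B) h0 h1 X' X'
  have hlow := hL V R B hRB ((le_max_left _ _).trans hV)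
    (hE.trans (by gcongr; exact min_le_left _ _)) X'ᶜ
  have hcc : ((X'ᶜ).card : ℝ) = N - X'.card := by
    rw [Finset.card_compl, Nat.cast_sub (Finset.card_le_univ _)]
  rw [hcc] at hlow
  have hloss' : lossBetween p R B univ univ ≤ (c + η ^ 2 / 8) * N ^ 2 :=
    hloss.trans (by gcongr; exact min_le_right _ _)
  set x : ℝ := (X'.card : ℝ) with hx
  have hx0 : 0 ≤ x := Nat.cast_nonneg _
  have e1 : c * x ^ 2 ≥ 0 := by positivity
  have e2 : x * (2 * (η * N) - x) ≤ η ^ 2 / 4 * N ^ 2 := by nlinarith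
  have e3 : (η * N) * (η * N / 2) ≤ x * (2 * (η * N) - x) := by
    apply mul_le_mul hx1 (by linarith) (by positivity) hx0
  have e4 : 0 < η * N * (η * N) := by positivity
  nlinarith

lemma exists_pos_forall_lt_le (f : ℕ → ℝ) (hf : ∀ j, 0 < f j) (J : ℕ) :
    ∃ δ : ℝ, 0 < δ ∧ ∀ j < J, δ ≤ f j := by
  induction J with
  | zero => exact ⟨1, one_pos, fun j hj => absurd hj (Nat.not_lt_zero j)⟩
  | succ J ih =>
    obtain ⟨δ, hδ, h⟩ := ih
    refine ⟨min δ (f J), lt_min hδ (hf J), fun j hj => ?_⟩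
    rcases Nat.lt_succ_iff_lt_or_eq.1 hj with hj | rfl
    · exact (min_le_left _ _).trans (h j hj)
    · exact min_le_right _ _

/-- Two classes of sizes d and l have inner losses D, W and cross loss X. Since cd² + cl² + 2pdl
exceeds c(d + l)² by 2(p - c)dl ≥ pdl, and d + l is nearly N, a total of at most (c + ε)N² leaves
only O(εN²) for pdl. -/
lemma mul_mul_le_of_loss_split {p c σ ε N d l D W X T : ℝ} (_ : 0 ≤ p) (h1 : p ≤ 1)
    (hc0 : 0 ≤ c) (hc : c ≤ p / 2) (hσ0 : 0 ≤ σ) (hσ : σ ≤ ε) (hN : 0 ≤ N) (hd : 0 ≤ d)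
    (hl : 0 ≤ l) (hlN : l ≤ N) (hdl : (1 - σ) * N ≤ d + l) (hD : c * d ^ 2 - ε * N ^ 2 ≤ D)
    (hW : c * l ^ 2 - ε * N ^ 2 ≤ W) (hX : l * (p * (d - σ * N)) ≤ X)
    (hT : D + W + 2 * X ≤ T) (hT' : T ≤ (c + ε) * N ^ 2) : p * (d * l) ≤ 7 * ε * N ^ 2 := by
  have hε : 0 ≤ ε := hσ0.trans hσ
  have e1 : (1 - 2 * σ) * N ^ 2 ≤ (d + l) ^ 2 := by
    rcases le_total σ 1 with h | h
    · calc (1 - 2 * σ) * N ^ 2 ≤ ((1 - σ) * N) ^ 2 := by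
            have : 0 ≤ (σ * N) ^ 2 := sq_nonneg _
            linarith
        _ ≤ _ := by
            have : 0 ≤ 1 - σ := by linarith
            gcongr
    · have : (1 - 2 * σ) * N ^ 2 ≤ 0 :=
        mul_nonpos_of_nonpos_of_nonneg (by linarith) (sq_nonneg N)
      linarith [sq_nonneg (d + l)]
  have e2 : c * ((1 - 2 * σ) * N ^ 2) ≤ c * (d + l) ^ 2 := by gcongr
  have e3 : c * (σ * N ^ 2) ≤ 1 * (ε * N ^ 2) := by
    gcongr
    linarith
  have e4 : p * l * (σ * N) ≤ 1 * N * (ε * N) := by gcongr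
  have e5 : c * (d * l) ≤ p / 2 * (d * l) := by gcongr
  linarith

/-- In a near-extremal igraph with few eyes, either there are few red cliques of size `a + 1`, or
almost all vertices lie in many of them. -/
lemma IsLossBound.dichotomy {p c : ℝ} {a b : ℕ} (h : IsLossBound p a b c) (h0 : 0 < p)
    (h1 : p ≤ 1) (hc0 : 0 ≤ c) (hc : c ≤ p / 2) {ε : ℝ} (hε : 0 < ε) :
    ∃ η : ℝ, 0 < η ∧ ∃ δ : ℝ, 0 < δ ∧ ∃ n₀ : ℕ, ∀ (V : Type) [Fintype V] (R B : SimpleGraph V),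
      R ⊔ B = ⊤ → n₀ ≤ Fintype.card V →
      ((eyeTuples R B a b).card : ℝ) ≤ δ * (Fintype.card V : ℝ) ^ (a + b) →
      lossBetween p R B univ univ ≤ (c + δ) * (Fintype.card V : ℝ) ^ 2 →
      ((cliqueTuples R (a + 1) univ).card : ℝ) ≤ ε * (Fintype.card V : ℝ) ^ (a + 1) ∨
      ((univ.filter fun u => ¬ η * (Fintype.card V : ℝ) ^ a ≤
        (cliqueTuples R a (nbhd R u)).card).card : ℝ) ≤ ε * Fintype.card V := by
  set s := ε / 3 with hs
  have hs0 : 0 < s := by positivity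
  set ε' := p * s ^ 2 / 16 with hε'
  have hε'0 : 0 < ε' := by positivity
  set σ := min s ε' with hσ
  have hσ0 : 0 < σ := by positivity
  obtain ⟨δ₁, hδ₁, n₁, hL⟩ := h.lossBetween_self h0.le h1 (by linarith) hε'0
  have hclq : ∀ η : ℝ, 0 < η → _ := fun η hη => exists_many_red_cliques a b a hη
  choose! fδ hfδ fc hfc fn hS using hclq
  -- The threshold e (j + 1) is at most the clique density that `exists_many_red_cliques` gives for
  -- level e j. Hence a vertex with more than σN R-neighbours in level set j lies in level set j +
  -- 1.
  set e : ℕ → ℝ := fun j => (fun η => min η (fc (min η σ)))^[j] s with he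
  have hesucc : ∀ j, e (j + 1) = min (e j) (fc (min (e j) σ)) := fun j => by
    simp only [he, Function.iterate_succ_apply']
  have hepos : ∀ j, 0 < e j := by
    intro j
    induction j with
    | zero => exact hs0
    | succ j ih =>
      rw [hesucc]
      exact lt_min ih (hfc _ (lt_min ih hσ0))
  have hanti : Antitone e := antitone_nat_of_succ_le fun j => by
    rw [hesucc]; exact min_le_left _ _
  obtain ⟨J, hJ⟩ := exists_nat_gt (1 / σ)
  obtain ⟨δ₂, hδ₂, hδ₂'⟩ := exists_pos_forall_lt_le (fun j => fδ (min (e j) σ))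
    (fun j => hfδ _ (lt_min (hepos j) hσ0)) J
  refine ⟨e J, hepos J, min δ₁ (min δ₂ ε'), by positivity,
    max 1 (max n₁ ((range J).sup fun j => fn (min (e j) σ))), fun V _ R B hRB hV hE hloss => ?_⟩
  set N : ℝ := (Fintype.card V : ℝ) with hN
  have hNpos : 0 < N := by
    have : 0 < Fintype.card V := lt_of_lt_of_le one_pos ((le_max_left _ _).trans hV)
    rw [hN]; exact_mod_cast this
  have hE1 : ((eyeTuples R B a b).card : ℝ) ≤ δ₁ * N ^ (a + b) :=
    hE.trans (by gcongr; exact min_le_left _ _)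
  have hE2 : ((eyeTuples R B a b).card : ℝ) ≤ δ₂ * N ^ (a + b) :=
    hE.trans (by gcongr; exact (min_le_right _ _).trans (min_le_left _ _))
  have hloss' : lossBetween p R B univ univ ≤ (c + ε') * N ^ 2 :=
    hloss.trans (by gcongr; exact (min_le_right _ _).trans (min_le_right _ _))
  set cnt : V → ℝ := fun u => ((cliqueTuples R a (nbhd R u)).card : ℝ) with hcnt
  set D : ℕ → Finset V := fun j => univ.filter fun u => e j * N ^ a ≤ cnt u with hD
  -- Pigeonhole: more than 1/σ consecutive increments larger than σN would exceed N.
  obtain ⟨j, hjJ, hj⟩ : ∃ j < J, ((D (j + 1)).card : ℝ) ≤ (D j).card + σ * N := by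
    by_contra! hcon
    have : ∀ i ≤ J, i * (σ * N) ≤ (D i).card := by
      intro i
      induction i with
      | zero => intro; simp
      | succ i ih =>
        intro hi
        have := ih (by omega)
        have := hcon i (by omega)
        push_cast
        linarith
    have h2 := this J le_rfl
    have h3 : ((D J).card : ℝ) ≤ N := by rw [hN]; exact_mod_cast Finset.card_le_univ _
    rw [div_lt_iff₀ hσ0] at hJ
    nlinarith
  set W : Finset V := univ.filter fun u => ¬ e (j + 1) * N ^ a ≤ cnt u with hW
  have hcardW : ((D (j + 1)).card : ℝ) + W.card = N := by
    rw [hN, ← Finset.card_univ, ← Finset.card_filter_add_card_filter_not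
      (s := (univ : Finset V)) (fun u => e (j + 1) * N ^ a ≤ cnt u)]
    push_cast
    rfl
  have hdisj : Disjoint (D j) W := by
    rw [Finset.disjoint_left]
    intro u hu hu'
    have h1 := (mem_filter.1 hu).2
    refine (mem_filter.1 hu').2 (le_trans ?_ h1)
    gcongr
    exact hanti (Nat.le_succ j)
  -- A counterexample w would have enough a-cliques in its R-neighbourhood to lie in D (j + 1).
  have hnb : ∀ w ∈ W, ((D j ∩ nbhd R w).card : ℝ) ≤ σ * N := by
    intro w hw
    by_contra! hcon
    have hpos : 0 < min (e j) σ := lt_min (hepos j) hσ0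
    have := hS (min (e j) σ) hpos V R B hRB
      ((Finset.le_sup (f := fun j => fn (min (e j) σ)) (mem_range.2 hjJ)).trans
        (((le_max_right _ _).trans (le_max_right _ _)).trans hV))
      (hE2.trans (by gcongr; exact hδ₂' j hjJ)) (D j ∩ nbhd R w)
      (fun u hu => by
        refine le_trans ?_ (mem_filter.1 (mem_inter.1 hu).1).2
        gcongr
        exact min_le_left _ _)
      (by
        refine le_trans ?_ hcon.le
        gcongr
        exact min_le_right _ _)
    refine (mem_filter.1 hw).2 ?_
    calc e (j + 1) * N ^ a ≤ fc (min (e j) σ) * N ^ a := by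
          gcongr
          rw [hesucc]
          exact min_le_right _ _
      _ ≤ _ := this
      _ ≤ cnt w := by
        simp only [hcnt]
        exact_mod_cast Finset.card_le_card (cliqueTuples_mono inter_subset_right)
  have hcross : W.card * (p * ((D j).card - σ * N)) ≤ lossBetween p R B W (D j) := by
    unfold lossBetween
    rw [← nsmul_eq_mul]
    refine Finset.card_nsmul_le_sum _ _ _ fun w hw => ?_
    have h2 : ((D j).card : ℝ) - σ * N ≤ ((D j).filter fun y => ¬ R.Adj w y).card := by
      have h3 : ((D j).filter fun y => R.Adj w y).card
          + ((D j).filter fun y => ¬ R.Adj w y).card = (D j).card :=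
        Finset.card_filter_add_card_filter_not _
      have h4 : ((D j).filter fun y => R.Adj w y) = D j ∩ nbhd R w := by
        ext y; simp
      rw [h4] at h3
      have h5 : ((D j ∩ nbhd R w).card : ℝ)
          + ((D j).filter fun y => ¬ R.Adj w y).card = (D j).card := by exact_mod_cast h3
      linarith [hnb w hw]
    calc p * ((D j).card - σ * N) ≤ p * ((D j).filter fun y => ¬ R.Adj w y).card := by gcongr
      _ = ∑ y ∈ (D j).filter fun y => ¬ R.Adj w y, p := by simp [mul_comm]
      _ ≤ ∑ y ∈ (D j).filter fun y => ¬ R.Adj w y, pairLoss p R B w y := by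
          refine Finset.sum_le_sum fun y hy => ?_
          unfold pairLoss
          rw [if_neg (mem_filter.1 hy).2]
          split_ifs <;> linarith
      _ ≤ _ := Finset.sum_le_sum_of_subset_of_nonneg (filter_subset _ _)
          fun _ _ _ => pairLoss_nonneg h0.le h1 _ _
  have hVn : n₁ ≤ Fintype.card V :=
    ((le_max_left _ _).trans (le_max_right _ _)).trans hV
  have hLD := hL V R B hRB hVn hE1 (D j)
  have hLW := hL V R B hRB hVn hE1 W
  have htot : lossBetween p R B (D j) (D j) + lossBetween p R B W W
      + 2 * lossBetween p R B W (D j) ≤ lossBetween p R B univ univ := by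
    refine le_trans (le_of_eq ?_) (lossBetween_mono h0.le h1 (subset_univ (D j ∪ W))
      (subset_univ (D j ∪ W)))
    rw [lossBetween_union_left hdisj, lossBetween_union_right hdisj,
      lossBetween_union_right hdisj, lossBetween_comm (D j) W]
    ring
  set d : ℝ := ((D j).card : ℝ) with hd
  set l : ℝ := (W.card : ℝ) with hl
  have hd0 : 0 ≤ d := Nat.cast_nonneg _
  have hl0 : 0 ≤ l := Nat.cast_nonneg _
  have hσε : σ ≤ ε' := min_le_right _ _
  have hσs : σ ≤ s := min_le_left _ _
  have hdl : (1 - σ) * N ≤ d + l := by linarith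
  have hlN : l ≤ N := by rw [hN, hl]; exact_mod_cast Finset.card_le_univ _
  have hprod : p * (d * l) ≤ 7 * ε' * N ^ 2 :=
    mul_mul_le_of_loss_split h0.le h1 hc0 hc hσ0.le hσε hNpos.le hd0 hl0 hlN hdl hLD hLW hcross
      htot hloss'
  -- The denominator 16 in ε' beats the factor 7: two large classes would give p(sN)² = 16ε'N².
  have hor : d ≤ s * N ∨ l ≤ s * N := by
    by_contra! hcon
    have : (s * N) * (s * N) ≤ d * l := mul_le_mul hcon.1.le hcon.2.le (by positivity) hd0
    have h2 : p * ((s * N) * (s * N)) ≤ p * (d * l) := by gcongr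
    have h3 : p * ((s * N) * (s * N)) = 16 * ε' * N ^ 2 := by rw [hε']; ring
    have h4 : 0 < ε' * N ^ 2 := by positivity
    nlinarith
  rcases hor with hd' | hl'
  -- Cliques are sorted by their first vertex. Those starting in D (j + 1) are bounded by its size,
  -- at most d + σN; the others by the initial threshold e 0 = s. The three contributions explain s
  -- = ε/3.
  · left
    rw [card_cliqueTuples_succ]
    push_cast
    simp only [univ_inter]
    rw [← Finset.sum_filter_add_sum_filter_not univ (fun u => e (j + 1) * N ^ a ≤ cnt u)]
    have hfirst : ∑ u ∈ D (j + 1), cnt u ≤ (d + σ * N) * N ^ a := by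
      calc ∑ u ∈ D (j + 1), cnt u ≤ (D (j + 1)).card * N ^ a := by
            rw [← nsmul_eq_mul]
            exact Finset.sum_le_card_nsmul _ _ _ fun u _ => card_cliqueTuples_le _ _ _
        _ ≤ _ := by gcongr
    have hsecond : ∑ u ∈ W, cnt u ≤ N * (s * N ^ a) := by
      calc ∑ u ∈ W, cnt u ≤ W.card * (s * N ^ a) := by
            rw [← nsmul_eq_mul]
            refine Finset.sum_le_card_nsmul _ _ _ fun u hu =>
              (not_le.1 (mem_filter.1 hu).2).le.trans ?_
            gcongr
            exact hanti (Nat.zero_le (j + 1))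
        _ ≤ _ := by gcongr
    calc _ ≤ (d + σ * N) * N ^ a + N * (s * N ^ a) := add_le_add hfirst hsecond
      _ ≤ (s * N + s * N) * N ^ a + N * (s * N ^ a) := by gcongr
      _ = ε * N ^ (a + 1) := by rw [hs]; ring
  · right
    calc _ ≤ l := by
          rw [hl]
          have : (univ.filter fun u => ¬ e J * N ^ a ≤ cnt u) ⊆ W := by
            intro u hu
            rw [mem_filter] at hu ⊢
            refine ⟨hu.1, fun h => hu.2 (le_trans ?_ h)⟩
            gcongr
            exact hanti hjJ
          exact_mod_cast Finset.card_le_card this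
      _ ≤ s * N := hl'
      _ ≤ _ := by
        gcongr
        rw [hs]; linarith

end Loss

/-! ### Stability in Turán's theorem from clique counts and codegrees. -/

section TuranStability

open Finset
open scoped Classical

variable {V : Type*} [Fintype V]

/-- A common neighbour extends the clique, so with few (r + 1)-cliques most r-tuples have a small
common neighbourhood, or else there are few of them. -/
lemma sum_card_commonNbhd (F : SimpleGraph V) (r : ℕ) :
    ∑ f ∈ cliqueTuples F r univ, (commonNbhd F f).card = (cliqueTuples F (r + 1) univ).card := by
  rw [card_cliqueTuples_succ]
  simp only [univ_inter]
  rw [← sum_card_filter_forall_mem]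
  refine Finset.sum_congr rfl fun f _ => ?_
  congr 1
  ext y
  simp [SimpleGraph.adj_comm]

/-- The adjacent pairs in the common neighbourhood of all entries of `f` but the `i`-th. -/
noncomputable def linkPairs (F : SimpleGraph V) {r : ℕ} (f : Fin r → V) (i : Fin r) :
    Finset (V × V) :=
  {z | F.Adj z.1 z.2 ∧ ∀ j, j ≠ i → F.Adj (f j) z.1 ∧ F.Adj (f j) z.2}

/-- Replacing entry i by a link pair turns f into an (r + 1)-clique. Only the value f i is
forgotten, whence the factor |V|. -/
lemma sum_card_linkPairs_le (F : SimpleGraph V) {r : ℕ} (i : Fin r) :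
    ∑ f ∈ cliqueTuples F r univ, (linkPairs F f i).card
      ≤ Fintype.card V * (cliqueTuples F (r + 1) univ).card := by
  rw [← Finset.card_sigma, ← Finset.card_univ, ← Finset.card_product]
  refine Finset.card_le_card_of_injOn
    (fun x => (x.1 i, (Fin.cons x.2.2 (Function.update x.1 i x.2.1) : Fin (r + 1) → V))) ?_ ?_
  · rintro ⟨f, x, y⟩ h
    simp only [mem_coe, mem_sigma, mem_cliqueTuples, linkPairs, mem_filter, mem_univ,
      true_and, implies_true] at h
    obtain ⟨hf, hxy, hl⟩ := h
    rw [mem_coe, mem_product]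
    refine ⟨mem_univ _, ?_⟩
    rw [cons_mem_cliqueTuples, mem_cliqueTuples]
    refine ⟨mem_univ _, fun j => ?_, fun j l hjl => ?_⟩
    · rw [mem_inter, mem_nbhd]
      refine ⟨mem_univ _, ?_⟩
      by_cases hj : j = i
      · subst hj; simpa using hxy.symm
      · simpa [hj] using (hl j hj).2.symm
    · by_cases hj : j = i
      · subst hj
        simpa [Ne.symm hjl] using (hl l (Ne.symm hjl)).1.symm
      · by_cases hl' : l = i
        · subst hl'
          simpa [hj] using (hl j hj).1
        · simpa [hj, hl'] using hf j l hjl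
  · rintro ⟨f, x, y⟩ - ⟨g, x', y'⟩ - h
    simp only [Prod.mk.injEq] at h
    obtain ⟨h1, h2⟩ := h
    have h3 := Fin.cons_injective2 h2
    have hx : x = x' := by simpa using congrFun h3.2 i
    have hfg : f = g := by
      ext j
      by_cases hj : j = i
      · rw [hj, h1]
      · simpa [hj] using congrFun h3.2 j
    subst hx hfg
    simp only at h3
    rw [h3.1]

/-- Markov's inequality. -/
lemma mul_card_filter_lt_le {ι : Type*} (A : Finset ι) (f : ι → ℕ) {θ T : ℝ}
    (hT : ((∑ i ∈ A, f i : ℕ) : ℝ) ≤ T) :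
    θ * ((A.filter fun i => θ < f i).card : ℝ) ≤ T := by
  refine le_trans ?_ hT
  push_cast
  calc θ * ((A.filter fun i => θ < f i).card : ℝ)
      = ∑ i ∈ A.filter (fun i => θ < f i), θ := by simp [mul_comm]
    _ ≤ ∑ i ∈ A.filter (fun i => θ < f i), (f i : ℝ) :=
        Finset.sum_le_sum fun i hi => (mem_filter.1 hi).2.le
    _ ≤ _ := Finset.sum_le_sum_of_subset_of_nonneg (filter_subset _ _)
        fun _ _ _ => Nat.cast_nonneg _

/-- Cauchy–Schwarz for the part sizes. -/
lemma sq_div_le_card_filter_eq {r : ℕ} (hr : 0 < r) (P : V → Fin r) :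
    (Fintype.card V : ℝ) ^ 2 / r
      ≤ ((univ.filter fun z : V × V => P z.1 = P z.2).card : ℝ) := by
  have h1 : (univ.filter fun z : V × V => P z.1 = P z.2).card
      = ∑ i : Fin r, (univ.filter fun x => P x = i).card ^ 2 := by
    rw [Finset.card_eq_sum_card_fiberwise (f := fun z : V × V => P z.1) (t := univ)
      (fun _ _ => mem_univ _)]
    refine Finset.sum_congr rfl fun i _ => ?_
    rw [sq, ← Finset.card_product]
    congr 1
    ext ⟨x, y⟩
    simp only [mem_filter, mem_univ, true_and, mem_product]
    constructor
    · rintro ⟨h, rfl⟩; exact ⟨rfl, h.symm⟩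
    · rintro ⟨h, h'⟩; exact ⟨h.trans h'.symm, h⟩
  have h2 : Fintype.card V = ∑ i : Fin r, (univ.filter fun x => P x = i).card := by
    rw [← Finset.card_univ]
    exact Finset.card_eq_sum_card_fiberwise (fun _ _ => mem_univ _)
  have h3 := sq_sum_le_card_mul_sum_sq (s := (univ : Finset (Fin r)))
    (f := fun i => ((univ.filter fun x => P x = i).card : ℝ))
  rw [h1, h2, div_le_iff₀ (by exact_mod_cast hr)]
  push_cast
  rw [Finset.card_univ, Fintype.card_fin] at h3
  linarith

lemma sum_codeg (F : SimpleGraph V) :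
    ∑ u, codeg F u = ((univ.filter fun z : V × V => ¬ F.Adj z.1 z.2).card : ℝ) := by
  simp only [codeg]
  have : (univ.filter fun z : V × V => ¬ F.Adj z.1 z.2).card
      = ∑ u, (univ.filter fun y => ¬ F.Adj u y).card := by
    rw [← Finset.card_sigma]
    refine Finset.card_bij (fun z _ => ⟨z.1, z.2⟩) ?_ ?_ ?_
    · intro z hz; simpa using hz
    · rintro ⟨x, y⟩ - ⟨x', y'⟩ - h; simpa using h
    · rintro ⟨x, y⟩ h; exact ⟨(x, y), by simpa using h, rfl⟩
  rw [this]
  push_cast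
  rfl

/-- A clique with small common neighbourhood, whose members have small co-degree and whose links
are sparse, gives a partition in which almost no pairs inside a part are adjacent. -/
lemma exists_partition_of_clique (F : SimpleGraph V) {r : ℕ} (hr : 0 < r) {δ τ : ℝ}
    (f : Fin r → V)
    (hdeg : ∀ i, codeg F (f i) ≤ (1 / r + δ) * Fintype.card V)
    (hcom : ((commonNbhd F f).card : ℝ) ≤ τ * Fintype.card V)
    (hlink : ∀ i, ((linkPairs F f i).card : ℝ) ≤ τ * (Fintype.card V : ℝ) ^ 2) :
    ∃ P : V → Fin r, ((univ.filter fun z : V × V => F.Adj z.1 z.2 ∧ P z.1 = P z.2).card : ℝ)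
      ≤ (r * τ + 2 * (r * δ + 2 * τ)) * (Fintype.card V : ℝ) ^ 2 := by
  set N : ℝ := (Fintype.card V : ℝ) with hN
  -- The number of entries of f not adjacent to x. It is positive off the common neighbourhood and
  -- sums to at most (1 + rδ)N, so it equals 1 for almost all x; such an x is put in the part of its
  -- unique non-neighbour.
  set m : V → ℕ := fun x => (univ.filter fun i => ¬ F.Adj (f i) x).card with hm
  set P : V → Fin r := fun x => if h : ∃ i, ¬ F.Adj (f i) x then h.choose else ⟨0, hr⟩ with hP
  have hPspec : ∀ x, x ∉ commonNbhd F f → ¬ F.Adj (f (P x)) x := by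
    intro x hx
    have h : ∃ i, ¬ F.Adj (f i) x := by simpa using hx
    simp only [hP, dif_pos h]
    exact h.choose_spec
  set O : Finset V := univ.filter fun x => 1 < m x with hO
  have hPuniq : ∀ x, x ∉ commonNbhd F f → x ∉ O → ∀ j, j ≠ P x → F.Adj (f j) x := by
    intro x hx hxO j hj
    by_contra hcon
    refine hxO (mem_filter.2 ⟨mem_univ _, Finset.one_lt_card.2 ⟨j, ?_, P x, ?_, hj⟩⟩)
    · simpa using hcon
    · simpa using hPspec x hx
  have hsum : ∑ x, (m x : ℝ) ≤ (1 + r * δ) * N := by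
    have h1 : ∑ x, (m x : ℝ) = ∑ i, codeg F (f i) := by
      have := Finset.sum_card_bipartiteAbove_eq_sum_card_bipartiteBelow
        (s := (univ : Finset V)) (t := (univ : Finset (Fin r))) (fun x i => ¬ F.Adj (f i) x)
      simp only [bipartiteAbove, bipartiteBelow] at this
      simp only [hm, codeg]
      exact_mod_cast this
    rw [h1]
    calc ∑ i, codeg F (f i) ≤ ∑ i : Fin r, (1 / r + δ) * N := Finset.sum_le_sum fun i _ => hdeg i
      _ = (1 + r * δ) * N := by
        have : (r : ℝ) ≠ 0 := by exact_mod_cast hr.ne'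
        simp only [sum_const, card_univ, Fintype.card_fin, nsmul_eq_mul]
        field_simp
  have hOcard : (O.card : ℝ) ≤ (r * δ + τ) * N := by
    have hpt : ∀ x, (1 : ℝ) + (if x ∈ O then 1 else 0) - (if x ∈ commonNbhd F f then 1 else 0)
        ≤ m x := by
      intro x
      by_cases h1 : x ∈ O
      · have : 1 < m x := (mem_filter.1 h1).2
        have : (2 : ℝ) ≤ m x := by exact_mod_cast this
        simp only [h1, if_true]
        split_ifs <;> linarith
      · by_cases h2 : x ∈ commonNbhd F f
        · simp [h1, h2]
        · have : 0 < m x := Finset.card_pos.2 ⟨P x, by simpa using hPspec x h2⟩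
          have : (1 : ℝ) ≤ m x := by exact_mod_cast this
          simp only [h1, h2, if_false]
          linarith
    have h := Finset.sum_le_sum fun x (_ : x ∈ (univ : Finset V)) => hpt x
    rw [Finset.sum_sub_distrib, Finset.sum_add_distrib] at h
    simp only [sum_const, card_univ, nsmul_eq_mul, mul_one, sum_ite_mem, univ_inter] at h
    rw [← hN] at h
    linarith
  refine ⟨P, ?_⟩
  set Z : Finset V := O ∪ commonNbhd F f with hZ
  have hZcard : (Z.card : ℝ) ≤ (r * δ + 2 * τ) * N := by
    have : (Z.card : ℝ) ≤ O.card + (commonNbhd F f).card := by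
      exact_mod_cast Finset.card_union_le _ _
    linarith
  -- Two adjacent ordinary vertices of part i are joined to every other entry of f, so they form a
  -- link pair for i.
  have hsub : (univ.filter fun z : V × V => F.Adj z.1 z.2 ∧ P z.1 = P z.2)
      ⊆ (univ.biUnion fun i => linkPairs F f i) ∪ (Z ×ˢ univ ∪ univ ×ˢ Z) := by
    rintro ⟨x, y⟩ h
    simp only [mem_filter, mem_univ, true_and] at h
    by_cases hx : x ∈ Z
    · simp [hx]
    by_cases hy : y ∈ Z
    · simp [hy]
    refine mem_union_left _ (mem_biUnion.2 ⟨P x, mem_univ _, ?_⟩)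
    simp only [hZ, mem_union, not_or] at hx hy
    simp only [linkPairs, mem_filter, mem_univ, true_and]
    exact ⟨h.1, fun j hj => ⟨hPuniq x hx.2 hx.1 j hj, hPuniq y hy.2 hy.1 j (h.2 ▸ hj)⟩⟩
  have h1 := (Finset.card_le_card hsub).trans (Finset.card_union_le _ _)
  have h2 := Finset.card_union_le (Z ×ˢ (univ : Finset V)) (univ ×ˢ Z)
  have h3 := Finset.card_biUnion_le (s := (univ : Finset (Fin r))) (t := fun i => linkPairs F f i)
  rw [card_product, card_product, card_univ] at h2
  have h4 : ((∑ i, (linkPairs F f i).card : ℕ) : ℝ) ≤ r * (τ * N ^ 2) := by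
    push_cast
    calc _ ≤ ∑ i : Fin r, τ * N ^ 2 := Finset.sum_le_sum fun i _ => hlink i
      _ = _ := by simp
  have h5 : ((univ.filter fun z : V × V => F.Adj z.1 z.2 ∧ P z.1 = P z.2).card : ℝ)
      ≤ ((∑ i, (linkPairs F f i).card : ℕ) : ℝ) + (Z.card * N + N * Z.card) := by
    rw [hN]
    exact_mod_cast h1.trans (add_le_add h3 h2)
  have h6 : (Z.card : ℝ) * N ≤ (r * δ + 2 * τ) * N * N := by gcongr
  linarith

/-- Stability in Turán's theorem, for graphs with few cliques of size `r + 1` in which almost all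
vertices have co-degree at most about `n / r`. -/
lemma exists_turan_partition {r : ℕ} (hr : 0 < r) {ε : ℝ} (hε : 0 < ε) :
    ∃ δ : ℝ, 0 < δ ∧ ∀ (V : Type) [Fintype V] (F : SimpleGraph V),
      ((cliqueTuples F (r + 1) univ).card : ℝ) ≤ δ * (Fintype.card V : ℝ) ^ (r + 1) →
      ((univ.filter fun u => (1 / r + δ) * Fintype.card V < codeg F u).card : ℝ)
        ≤ δ * Fintype.card V →
      (∃ P : V → Fin r, ((univ.filter fun z : V × V => F.Adj z.1 z.2 ↔ P z.1 = P z.2).card : ℝ)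
        ≤ ε * (Fintype.card V : ℝ) ^ 2) ∧
      (1 / r - ε) * (Fintype.card V : ℝ) ^ 2 ≤ ∑ u, codeg F u := by
  have hr' : (0 : ℝ) < r := by exact_mod_cast hr
  set τ := ε / (8 * (r + 4)) with hτ
  have hτ0 : 0 < τ := by positivity
  set γ : ℝ := (1 / (2 * r)) ^ r with hγ
  have hγ0 : 0 < γ := by positivity
  -- The bound 1/(2r²) leaves the greedy construction room N/(2r). The last bound keeps the bad
  -- cliques, at most (r + 1)(δ/τ)N^r, below the γN^r cliques constructed.
  set δ := min (min (ε / (16 * r)) (ε / 4)) (min (1 / (2 * r ^ 2)) (γ * τ / (2 * (r + 1)))) with hδ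
  have hδ0 : 0 < δ := by positivity
  have hδ1 : δ ≤ ε / (16 * r) := (min_le_left _ _).trans (min_le_left _ _)
  have hδ2 : δ ≤ ε / 4 := (min_le_left _ _).trans (min_le_right _ _)
  have hδ3 : δ ≤ 1 / (2 * r ^ 2) := (min_le_right _ _).trans (min_le_left _ _)
  have hδ4 : δ ≤ γ * τ / (2 * (r + 1)) := (min_le_right _ _).trans (min_le_right _ _)
  refine ⟨δ, hδ0, fun V _ F hcl hdeg => ?_⟩
  set N : ℝ := (Fintype.card V : ℝ) with hN
  have hN0 : 0 ≤ N := Nat.cast_nonneg _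
  rcases hN0.eq_or_lt with hNz | hNpos
  · have hemp : IsEmpty V := by
      rw [← Fintype.card_eq_zero_iff]
      rw [hN] at hNz
      exact_mod_cast hNz.symm
    exact ⟨⟨fun x => hemp.elim x, by simp [← hNz]⟩, by simp [← hNz]⟩
  set U := univ.filter fun u => ¬ (1 / r + δ) * N < codeg F u with hU
  have hUcard : (1 - δ) * N ≤ U.card := by
    have h : (univ.filter fun u => (1 / r + δ) * N < codeg F u).card + U.card
        = Fintype.card V := Finset.card_filter_add_card_filter_not _
    have h' : ((univ.filter fun u => (1 / r + δ) * N < codeg F u).card : ℝ) + U.card = N := by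
      rw [hN]; exact_mod_cast h
    linarith
  have hgreedy : γ * N ^ r ≤ (cliqueTuples F r U).card := by
    have := pow_le_card_cliqueTuples F (μ := (1 / r + δ) * N) (ρ := 1 / (2 * r) * N)
      (by positivity) (by positivity) r U (fun v hv => not_lt.1 (mem_filter.1 hv).2) (by
        refine le_trans ?_ hUcard
        have hkey : ((r : ℝ) - 1) * (1 / r + δ) + 1 / (2 * r) ≤ 1 - δ := by
          have e1 : r * δ ≤ 1 / (2 * r) := by
            calc r * δ ≤ r * (1 / (2 * r ^ 2)) := by gcongr
              _ = 1 / (2 * r) := by field_simp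
          have e2 : ((r : ℝ) - 1) * (1 / r + δ) + 1 / (2 * r)
              = 1 - δ + (r * δ - 1 / (2 * r)) := by field_simp; ring
          linarith
        nlinarith)
    rw [mul_pow] at this
    exact this
  have hbad1 : ((((cliqueTuples F r univ).filter fun f =>
      τ * N < (commonNbhd F f).card).card : ℕ) : ℝ) ≤ δ / τ * N ^ r := by
    have := mul_card_filter_lt_le (cliqueTuples F r univ) (fun f => (commonNbhd F f).card)
      (θ := τ * N) (T := δ * N ^ (r + 1)) (by rw [sum_card_commonNbhd]; exact hcl)
    rw [div_mul_eq_mul_div δ τ, le_div_iff₀ hτ0]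
    refine le_of_mul_le_mul_right ?_ hNpos
    calc _ = _ := by rw [mul_assoc, mul_comm]
      _ ≤ _ := this
      _ = _ := by ring
  have hbad2 : ∀ i, ((((cliqueTuples F r univ).filter fun f =>
      τ * N ^ 2 < (linkPairs F f i).card).card : ℕ) : ℝ) ≤ δ / τ * N ^ r := by
    intro i
    have := mul_card_filter_lt_le (cliqueTuples F r univ) (fun f => (linkPairs F f i).card)
      (θ := τ * N ^ 2) (T := N * (δ * N ^ (r + 1))) (by
        have h : ((∑ f ∈ cliqueTuples F r univ, (linkPairs F f i).card : ℕ) : ℝ)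
            ≤ N * (cliqueTuples F (r + 1) univ).card := by
          rw [hN]
          exact_mod_cast sum_card_linkPairs_le F i
        exact h.trans (by gcongr))
    rw [div_mul_eq_mul_div δ τ, le_div_iff₀ hτ0]
    refine le_of_mul_le_mul_right ?_ (by positivity : 0 < N ^ 2)
    calc _ = _ := by rw [mul_assoc, mul_comm]
      _ ≤ _ := this
      _ = _ := by ring
  obtain ⟨f, hfU, hf1, hf2⟩ : ∃ f ∈ cliqueTuples F r U,
      ((commonNbhd F f).card : ℝ) ≤ τ * N ∧
      ∀ i, ((linkPairs F f i).card : ℝ) ≤ τ * N ^ 2 := by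
    by_contra! hcon
    have hsub : cliqueTuples F r U ⊆
        ((cliqueTuples F r univ).filter fun f => τ * N < (commonNbhd F f).card) ∪
        univ.biUnion fun i => (cliqueTuples F r univ).filter fun f =>
          τ * N ^ 2 < (linkPairs F f i).card := by
      intro f hf
      have hf' := cliqueTuples_mono (subset_univ U) hf
      by_cases h : ((commonNbhd F f).card : ℝ) ≤ τ * N
      · obtain ⟨i, hi⟩ := hcon f hf h
        exact mem_union_right _ (mem_biUnion.2 ⟨i, mem_univ _, mem_filter.2 ⟨hf', hi⟩⟩)
      · exact mem_union_left _ (mem_filter.2 ⟨hf', not_le.1 h⟩)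
    have h1 := (Finset.card_le_card hsub).trans ((Finset.card_union_le _ _).trans
      (Nat.add_le_add_left Finset.card_biUnion_le _))
    have h2 : ((cliqueTuples F r U).card : ℝ)
        ≤ δ / τ * N ^ r + ∑ _i : Fin r, δ / τ * N ^ r := by
      refine le_trans (Nat.cast_le.2 h1) ?_
      push_cast
      exact add_le_add hbad1 (Finset.sum_le_sum fun i _ => hbad2 i)
    simp only [sum_const, card_univ, Fintype.card_fin, nsmul_eq_mul] at h2
    have h3 : (r + 1) * (δ / τ) ≤ γ / 2 := by
      calc (r + 1) * (δ / τ) ≤ (r + 1) * ((γ * τ / (2 * (r + 1))) / τ) := by gcongr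
        _ = γ / 2 := by field_simp
    have h4 : (r + 1) * (δ / τ) * N ^ r ≤ γ / 2 * N ^ r := by gcongr
    have h5 : 0 < γ * N ^ r := by positivity
    linarith
  obtain ⟨P, hP⟩ := exists_partition_of_clique F hr f
    (fun i => not_lt.1 (mem_filter.1 ((mem_cliqueTuples.1 hfU).1 i)).2) hf1 hf2
  set T1 : ℝ := ((univ.filter fun z : V × V => F.Adj z.1 z.2 ∧ P z.1 = P z.2).card : ℝ) with hT1
  have hT1' : T1 ≤ ε / 4 * N ^ 2 := by
    refine hP.trans ?_
    gcongr
    have e1 : (r + 4) * τ = ε / 8 := by rw [hτ]; field_simp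
    have e2 : r * δ ≤ ε / 16 := by
      calc r * δ ≤ r * (ε / (16 * r)) := by gcongr
        _ = ε / 16 := by field_simp
    linarith
  have hS := sq_div_le_card_filter_eq hr P
  set S : ℝ := ((univ.filter fun z : V × V => P z.1 = P z.2).card : ℝ) with hSdef
  set Q : ℝ := ((univ.filter fun z : V × V => ¬ F.Adj z.1 z.2).card : ℝ) with hQ
  set T2 : ℝ := ((univ.filter fun z : V × V => ¬ F.Adj z.1 z.2 ∧ ¬ P z.1 = P z.2).card : ℝ)
    with hT2
  set T3 : ℝ := ((univ.filter fun z : V × V => ¬ F.Adj z.1 z.2 ∧ P z.1 = P z.2).card : ℝ)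
    with hT3
  have hST : T1 + T3 = S := by
    have h := Finset.card_filter_add_card_filter_not
      (s := univ.filter fun z : V × V => P z.1 = P z.2) (fun z => F.Adj z.1 z.2)
    simp only [filter_filter] at h
    rw [hT1, hT3, hSdef, ← h]
    push_cast
    congr 3 <;> (ext z; simp [and_comm])
  have hQT : T3 + T2 = Q := by
    have h := Finset.card_filter_add_card_filter_not
      (s := univ.filter fun z : V × V => ¬ F.Adj z.1 z.2) (fun z => P z.1 = P z.2)
    simp only [filter_filter] at h
    rw [hT2, hT3, hQ, ← h]
    push_cast
    rfl
  have hbadpairs : ((univ.filter fun z : V × V => F.Adj z.1 z.2 ↔ P z.1 = P z.2).card : ℝ)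
      ≤ T1 + T2 := by
    have hsub : (univ.filter fun z : V × V => F.Adj z.1 z.2 ↔ P z.1 = P z.2) ⊆
        (univ.filter fun z : V × V => F.Adj z.1 z.2 ∧ P z.1 = P z.2) ∪
        (univ.filter fun z : V × V => ¬ F.Adj z.1 z.2 ∧ ¬ P z.1 = P z.2) := by
      intro z hz
      simp only [mem_filter, mem_univ, true_and, mem_union] at hz ⊢
      tauto
    rw [hT1, hT2]
    exact_mod_cast (Finset.card_le_card hsub).trans (Finset.card_union_le _ _)
  -- Since S ≥ N²/r, the non-edges inside parts number T3 ≥ N²/r - T1. The codegree bound caps T3 +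
  -- T2 near N²/r, so few non-edges T2 run across parts.
  have hQle : Q ≤ (1 / r + 2 * δ) * N ^ 2 := by
    rw [hQ, ← sum_codeg, ← Finset.sum_filter_add_sum_filter_not univ
      (fun u => (1 / r + δ) * N < codeg F u)]
    have e1 : ∑ u ∈ univ.filter (fun u => (1 / r + δ) * N < codeg F u), codeg F u
        ≤ δ * N * N := by
      calc _ ≤ ((univ.filter fun u => (1 / r + δ) * N < codeg F u).card : ℝ) * N := by
            rw [← nsmul_eq_mul]
            exact Finset.sum_le_card_nsmul _ _ _ fun u _ => codeg_le F u
        _ ≤ _ := by gcongr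
    have e2 : ∑ u ∈ U, codeg F u ≤ N * ((1 / r + δ) * N) := by
      calc _ ≤ (U.card : ℝ) * ((1 / r + δ) * N) := by
            rw [← nsmul_eq_mul]
            exact Finset.sum_le_card_nsmul _ _ _ fun u hu => not_lt.1 (mem_filter.1 hu).2
        _ ≤ _ := by
            gcongr
            rw [hN]
            exact_mod_cast Finset.card_le_univ _
    linarith
  have hNr : N ^ 2 / r = 1 / r * N ^ 2 := by ring
  have hN2 : 0 ≤ N ^ 2 := by positivity
  have hδN : δ * N ^ 2 ≤ ε / 4 * N ^ 2 := by gcongr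
  have hεN : 0 ≤ ε * N ^ 2 := by positivity
  refine ⟨⟨P, ?_⟩, ?_⟩
  · linarith
  · rw [sum_codeg]
    have : 0 ≤ T2 := Nat.cast_nonneg _
    linarith

end TuranStability

/-! ### Almost all vertices rich: red degrees close to n/k. -/

section RedCase

open Finset
open scoped Classical

/-- A vertex whose loss is at most about `c` and whose green neighbourhood has few blue cliques
of size `k`. -/
def IsTypical {V : Type*} [Fintype V] (p c : ℝ) (k : ℕ) (δ : ℝ) (R B : SimpleGraph V)
    (u : V) : Prop :=
  p * codeg R u + (1 - p) * codeg B u ≤ (c + δ) * Fintype.card V ∧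
  ((cliqueTuples B k (nbhd R u ∩ nbhd B u)).card : ℝ) ≤ δ * (Fintype.card V : ℝ) ^ k

lemma IsTypical.mono {V : Type*} [Fintype V] {p c : ℝ} {k : ℕ} {δ δ' : ℝ} {R B : SimpleGraph V}
    {u : V} (h : IsTypical p c k δ R B u) (hδ : δ ≤ δ') : IsTypical p c k δ' R B u := by
  refine ⟨h.1.trans ?_, h.2.trans ?_⟩ <;> gcongr

variable {V : Type*} [Fintype V]

lemma card_le_green_add_codeg (R B : SimpleGraph V) (u : V) :
    (Fintype.card V : ℝ) ≤ (nbhd R u ∩ nbhd B u).card + codeg B u + codeg R u := by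
  have h1 := card_sub_codeg_le B (nbhd R u) u
  have h2 := card_sub_codeg_le R univ u
  rw [univ_inter, Finset.card_univ] at h2
  linarith

/-- A green neighbourhood with few blue cliques cannot contain many vertices of small red
degree. -/
lemma card_green_le {B : SimpleGraph V} {k : ℕ} {W U : Finset V} {δ ρ κ t : ℝ}
    (hN : 0 < (Fintype.card V : ℝ)) (ht : 0 ≤ t) (hρ : 0 < ρ) (hδ : δ < ρ ^ k)
    (hW : ((cliqueTuples B k W).card : ℝ) ≤ δ * (Fintype.card V : ℝ) ^ k)
    (hU : ∀ v ∈ U, codeg B v ≤ t) (hUc : ((Uᶜ).card : ℝ) ≤ κ * Fintype.card V) :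
    (W.card : ℝ) ≤ ((k : ℝ) - 1) * t + (ρ + κ) * Fintype.card V := by
  by_contra! hcon
  have h1 : (W.card : ℝ) ≤ (W ∩ U).card + (Uᶜ).card := by
    have : W ⊆ (W ∩ U) ∪ Uᶜ := by
      intro x hx
      by_cases h : x ∈ U <;> simp [h, hx]
    exact_mod_cast (Finset.card_le_card this).trans (Finset.card_union_le _ _)
  have h2 := pow_le_card_cliqueTuples B ht (mul_pos hρ hN).le k (W ∩ U)
    (fun v hv => hU v (mem_inter.1 hv).2) (by linarith)
  have h3 : ((cliqueTuples B k (W ∩ U)).card : ℝ) ≤ (cliqueTuples B k W).card := by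
    exact_mod_cast Finset.card_le_card (cliqueTuples_mono inter_subset_left)
  rw [mul_pow] at h2
  have h4 : δ * (Fintype.card V : ℝ) ^ k < ρ ^ k * (Fintype.card V : ℝ) ^ k := by gcongr
  linarith

/-- If the green degree `g` is at most `k - 1` times the red degree `r`, then the loss is at least
`min p (q / k)`; near equality determines `r`. -/
lemma exists_loss_rigidity {p c : ℝ} {k : ℕ} (hk : 0 < k) (hp0 : 0 < p) (hp1 : p < 1)
    (hc1 : c ≤ p / 2) (hc2 : c ≤ (1 - p) / k) {σ : ℝ} (hσ : 0 < σ) :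
    ∃ θ : ℝ, 0 < θ ∧ ∀ N g r β δ ρ : ℝ, 0 < N → 0 ≤ r → 0 ≤ β → 0 ≤ δ → 0 ≤ ρ → δ + ρ ≤ θ →
      N ≤ g + r + β → g ≤ ((k : ℝ) - 1) * r + ρ * N → p * β + (1 - p) * r ≤ (c + δ) * N →
      (1 / k - σ) * N ≤ r ∧ (1 - p) / k - σ ≤ c := by
  have hk0 : (0 : ℝ) < k := by exact_mod_cast hk
  have hk1 : (1 : ℝ) ≤ k := by exact_mod_cast hk
  set q := 1 - p with hq
  have hq0 : 0 < q := by linarith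
  have hqk : q / k ≤ 1 := by
    rw [div_le_one hk0]; linarith
  -- Eliminating g leaves N ≤ kr + β up to ρN. If q/k < p, blue pairs are the dearer way to cover N,
  -- so β is small and r is near N/k. Otherwise the loss is at least about pN, contradicting c ≤
  -- p/2.
  by_cases hs : q / k < p
  · set s := p - q / k with hsdef
    have hs0 : 0 < s := by linarith
    refine ⟨min (σ / 2) (s * σ / 2), by positivity,
      fun N g r β δ ρ hN hr hβ hδ hρ hθ h1 h2 h3 => ?_⟩
    have hθ1 : δ + ρ ≤ σ / 2 := hθ.trans (min_le_left _ _)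
    have hθ2 : δ + ρ ≤ s * σ / 2 := hθ.trans (min_le_right _ _)
    have e1 : N ≤ k * r + β + ρ * N := by linarith
    have e2 : q / k * N ≤ q * r + q / k * β + ρ * N := by
      calc q / k * N ≤ q / k * (k * r + β + ρ * N) := by gcongr
        _ = q * r + q / k * β + q / k * (ρ * N) := by field_simp
        _ ≤ q * r + q / k * β + 1 * (ρ * N) := by gcongr
        _ = _ := by ring
    have e3 : s * β ≤ (c + δ + ρ - q / k) * N := by
      rw [hsdef]; linarith
    have e4 : s * β ≤ s * (σ / 2 * N) := by
      calc s * β ≤ (c + δ + ρ - q / k) * N := e3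
        _ ≤ (s * σ / 2) * N := by gcongr; linarith
        _ = _ := by ring
    have e5 : β ≤ σ / 2 * N := le_of_mul_le_mul_left e4 hs0
    have e6 : 0 ≤ (c + δ + ρ - q / k) * N := (by positivity : 0 ≤ s * β).trans e3
    have e7 : 0 ≤ c + δ + ρ - q / k := by
      by_contra! h
      linarith [mul_neg_of_neg_of_pos h hN]
    refine ⟨?_, by linarith⟩
    have e8 : ρ * N ≤ σ / 2 * N := by gcongr; linarith
    have e9 : (1 - σ) * N ≤ k * r := by linarith
    have e10 : (1 - σ) / k * N ≤ r := by
      rw [div_mul_eq_mul_div, div_le_iff₀ hk0]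
      linarith
    refine le_trans ?_ e10
    gcongr
    rw [sub_div]
    have : σ / k ≤ σ := div_le_self hσ.le hk1
    linarith
  · refine ⟨p / 4, by positivity, fun N g r β δ ρ hN hr hβ hδ hρ hθ h1 h2 h3 => ?_⟩
    exfalso
    push Not at hs
    rw [le_div_iff₀ hk0] at hs
    have e1 : N ≤ k * r + β + ρ * N := by linarith
    have e2 : p * N ≤ q * r + p * β + ρ * N := by
      calc p * N ≤ p * (k * r + β + ρ * N) := by gcongr
        _ = (p * k) * r + p * β + p * (ρ * N) := by ring
        _ ≤ q * r + p * β + 1 * (ρ * N) := by gcongr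
        _ = _ := by ring
    have e3 : p * N ≤ (c + δ + ρ) * N := by linarith
    have e4 := le_of_mul_le_mul_right e3 hN
    linarith

/-- For the vertex of U with the largest codegree r in B, the greedy bound limits the green degree
to about (k - 1)r, and `exists_loss_rigidity` applies. For k = 1 the term (k - 1)r vanishes, so the
argument covers every vertex of U. -/
lemma exists_typical_of_red_degree_ge {p c : ℝ} {k : ℕ} (hk : 0 < k) (hp0 : 0 < p) (hp1 : p < 1)
    (hc1 : c ≤ p / 2) (hc2 : c ≤ (1 - p) / k) {σ : ℝ} (hσ : 0 < σ) :
    ∃ δ : ℝ, 0 < δ ∧ ∀ (V : Type) [Fintype V] (R B : SimpleGraph V) (U : Finset V),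
      0 < Fintype.card V → (∀ u ∈ U, IsTypical p c k δ R B u) →
      ((Uᶜ).card : ℝ) ≤ δ * Fintype.card V →
      (∃ u ∈ U, (1 / k - σ) * Fintype.card V ≤ codeg B u) ∧ (1 - p) / k - σ ≤ c ∧
      (k = 1 → ∀ u ∈ U, (1 / k - σ) * Fintype.card V ≤ codeg B u) := by
  obtain ⟨θ, hθ, hrig⟩ := exists_loss_rigidity hk hp0 hp1 hc1 hc2 hσ
  set ρ := θ / 4 with hρ
  have hρ0 : 0 < ρ := by positivity
  refine ⟨min (min ρ (1 / 2)) (ρ ^ k / 2), by positivity, fun V _ R B U hV hU hUc => ?_⟩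
  set δ := min (min ρ (1 / 2)) (ρ ^ k / 2) with hδ
  have hδ0 : 0 < δ := by positivity
  have hδ1 : δ ≤ ρ := (min_le_left _ _).trans (min_le_left _ _)
  have hδ2 : δ ≤ 1 / 2 := (min_le_left _ _).trans (min_le_right _ _)
  have hδ3 : δ < ρ ^ k := by
    have : 0 < ρ ^ k := by positivity
    linarith [min_le_right (min ρ (1 / 2)) (ρ ^ k / 2)]
  have hN : 0 < (Fintype.card V : ℝ) := by exact_mod_cast hV
  set N : ℝ := (Fintype.card V : ℝ) with hNdef
  have hUne : U.Nonempty := by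
    rw [Finset.nonempty_iff_ne_empty]
    rintro rfl
    rw [compl_empty, Finset.card_univ, ← hNdef] at hUc
    nlinarith
  obtain ⟨u, hu, hmax⟩ := Finset.exists_max_image U (fun v => codeg B v) hUne
  have hmain : ∀ v ∈ U, ((nbhd R v ∩ nbhd B v).card : ℝ)
      ≤ ((k : ℝ) - 1) * codeg B v + (ρ + δ) * N →
      (1 / k - σ) * N ≤ codeg B v ∧ (1 - p) / k - σ ≤ c := by
    intro v hv hg
    exact hrig N _ _ _ δ (ρ + δ) hN (codeg_nonneg B v) (codeg_nonneg R v) hδ0.le (by positivity)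
      (by linarith) (card_le_green_add_codeg R B v) hg (hU v hv).1
  have hgreen := card_green_le hN (codeg_nonneg B u) hρ0 hδ3 (hU u hu).2 hmax hUc
  have hu' := hmain u hu hgreen
  refine ⟨⟨u, hu, hu'.1⟩, hu'.2, fun hk1 v hv => (hmain v hv ?_).1⟩
  have h := card_green_le hN (codeg_nonneg B u) hρ0 hδ3 (hU v hv).2 hmax hUc
  subst hk1
  simpa using h

/-- Red degrees close to `n / k` propagate along green pairs. -/
lemma exists_red_degree_propagation {p c : ℝ} {k : ℕ} (hk : 2 ≤ k) (hp0 : 0 < p) (hp1 : p < 1)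
    (hc2 : c ≤ (1 - p) / k) {σ : ℝ} (hσ : 0 < σ) :
    ∃ σ' : ℝ, 0 < σ' ∧ σ' ≤ σ ∧ ∃ δ : ℝ, 0 < δ ∧
      ∀ (V : Type) [Fintype V] (R B : SimpleGraph V) (U : Finset V),
      0 < Fintype.card V → (∀ u ∈ U, IsTypical p c k δ R B u) →
      ((Uᶜ).card : ℝ) ≤ δ * Fintype.card V →
      ∀ u ∈ U, (1 / k - σ') * Fintype.card V ≤ codeg B u →
        codeg R u ≤ σ * Fintype.card V ∧
        (1 - 1 / k - 2 * σ) * Fintype.card V ≤ (nbhd R u ∩ nbhd B u ∩ U).card ∧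
        (((nbhd R u ∩ nbhd B u ∩ U).filter fun v =>
          codeg B v < (1 / k - σ) * Fintype.card V).card : ℝ) ≤ σ * Fintype.card V := by
  have hk0 : (0 : ℝ) < k := by exact_mod_cast (by omega : 0 < k)
  set q := 1 - p with hq
  have hq0 : 0 < q := by linarith
  set ρ := σ / 4 with hρ
  have hρ0 : 0 < ρ := by positivity
  set δ := min (min (q * σ / (8 * k)) (p * σ / 16)) (σ * ρ ^ (k - 1) / 2) with hδ
  have hδ0 : 0 < δ := by positivity
  have hδ1 : δ ≤ q * σ / (8 * k) := (min_le_left _ _).trans (min_le_left _ _)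
  have hδ2 : δ ≤ p * σ / 16 := (min_le_left _ _).trans (min_le_right _ _)
  have hδ3 : δ ≤ σ * ρ ^ (k - 1) / 2 := min_le_right _ _
  have hδ4 : k * (δ / q) ≤ σ / 8 := by
    calc k * (δ / q) ≤ k * ((q * σ / (8 * k)) / q) := by gcongr
      _ = σ / 8 := by field_simp
  have hδ5 : δ ≤ σ / 16 := hδ2.trans (by
    have : p * σ ≤ 1 * σ := by gcongr
    linarith)
  have hδq : δ / q ≤ σ / 8 := by
    refine le_trans ?_ hδ4
    refine le_mul_of_one_le_left (by positivity) ?_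
    exact_mod_cast (by omega : 1 ≤ k)
  -- A red deficit of σ'N frees loss at most qσ'N, which pays for at most σN/4 blue pairs.
  refine ⟨p * σ / 4, by positivity, ?_, δ, hδ0, fun V _ R B U hV hU hUc u hu hr => ?_⟩
  · have : p * σ ≤ 1 * σ := by gcongr
    linarith
  have hN : 0 < (Fintype.card V : ℝ) := by exact_mod_cast hV
  set N : ℝ := (Fintype.card V : ℝ) with hNdef
  have hred : ∀ v ∈ U, codeg B v ≤ (1 / k + δ / q) * N := by
    intro v hv
    have h1 := (hU v hv).1
    have h2 : 0 ≤ p * codeg R v := mul_nonneg hp0.le (codeg_nonneg R v)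
    have h3 : q * codeg B v ≤ q * ((1 / k + δ / q) * N) := by
      calc q * codeg B v ≤ (c + δ) * N := by linarith
        _ ≤ (q / k + δ) * N := by gcongr
        _ = _ := by field_simp
    exact le_of_mul_le_mul_left h3 hq0
  have hblue : codeg R u ≤ 5 / 16 * σ * N := by
    have h1 := (hU u hu).1
    have h2 : q * ((1 / k - p * σ / 4) * N) ≤ q * codeg B u := by gcongr
    have h3 : c * N ≤ q / k * N := by gcongr
    have h4 : q * (p * σ / 4 * N) ≤ 1 * (p * σ / 4 * N) := by
      gcongr
      linarith
    have h5 : δ * N ≤ p * σ / 16 * N := by gcongr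
    have h6 : q * ((1 / k - p * σ / 4) * N) = q / k * N - q * (p * σ / 4 * N) := by ring
    have h7 : p * codeg R u ≤ p * (5 / 16 * σ * N) := by
      linarith
    exact le_of_mul_le_mul_left h7 hp0
  have hσN : 0 < σ * N := by positivity
  have hUN : δ * N ≤ σ / 16 * N := by gcongr
  have hqN : δ / q * N ≤ σ / 8 * N := by gcongr
  have hcap : ((nbhd R u ∩ nbhd B u).card : ℝ) ≤ (nbhd R u ∩ nbhd B u ∩ U).card + (Uᶜ).card := by
    have : nbhd R u ∩ nbhd B u ⊆ (nbhd R u ∩ nbhd B u ∩ U) ∪ Uᶜ := by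
      intro x hx
      by_cases h : x ∈ U
      · exact mem_union_left _ (mem_inter.2 ⟨hx, h⟩)
      · exact mem_union_right _ (mem_compl.2 h)
    exact_mod_cast (Finset.card_le_card this).trans (Finset.card_union_le _ _)
  have hS : (1 - 1 / k - δ / q - 3 / 8 * σ) * N ≤ (nbhd R u ∩ nbhd B u ∩ U).card := by
    have h1 := card_le_green_add_codeg R B u
    have h2 := hred u hu
    rw [← hNdef] at h1
    linarith
  refine ⟨by linarith, by linarith, ?_⟩
  set S := nbhd R u ∩ nbhd B u ∩ U with hSdef
  set X := S.filter fun v => codeg B v < (1 / k - σ) * N with hX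
  by_contra! hcon
  obtain ⟨j, rfl⟩ : ∃ j, k = j + 1 := ⟨k - 1, by omega⟩
  -- Starting the greedy clique at a vertex of X saves σN, which makes S large enough for j + 1 = k
  -- vertices. With X large this yields too many B-cliques in the green neighbourhood of u.
  have hclq := mul_pow_le_card_cliqueTuples B (μ₀ := (1 / ((j + 1 : ℕ) : ℝ) - σ) * N)
    (μ := (1 / ((j + 1 : ℕ) : ℝ) + δ / q) * N)
    (ρ := ρ * N) (by positivity) (by positivity) j S X (filter_subset _ _)
    (fun v hv => (mem_filter.1 hv).2.le) (fun v hv => hred v (mem_inter.1 hv).2) (by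
      refine le_trans ?_ hS
      rw [← mul_assoc, ← add_mul, ← add_mul]
      refine mul_le_mul_of_nonneg_right ?_ hN.le
      push_cast at hδ4 ⊢
      have e1 : ((j : ℝ) - 1) * (1 / (j + 1)) = 1 - 2 * (1 / (j + 1)) := by
        have : (j : ℝ) + 1 ≠ 0 := by positivity
        field_simp
        ring
      have e2 : 0 ≤ δ / q := by positivity
      rw [mul_add, e1, hρ]
      linarith)
  have h1 : ((cliqueTuples B (j + 1) S).card : ℝ) ≤ δ * N ^ (j + 1) :=
    le_trans (by exact_mod_cast Finset.card_le_card (cliqueTuples_mono inter_subset_left))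
      (hU u hu).2
  have h2 : σ * N * (ρ * N) ^ j ≤ X.card * (ρ * N) ^ j := by gcongr
  have h3 : σ * N * (ρ * N) ^ j = σ * ρ ^ j * N ^ (j + 1) := by rw [mul_pow]; ring
  have h4 : δ * N ^ (j + 1) ≤ σ * ρ ^ j / 2 * N ^ (j + 1) := by
    gcongr
    simpa using hδ3
  have h5 : 0 < σ * ρ ^ j * N ^ (j + 1) := by positivity
  linarith

/-- Almost all vertices have red degree nearly `n / k`. -/
lemma exists_red_degrees {p c : ℝ} {k : ℕ} (hk : 0 < k) (hp0 : 0 < p) (hp1 : p < 1)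
    (hc1 : c ≤ p / 2) (hc2 : c ≤ (1 - p) / k) {σ : ℝ} (hσ : 0 < σ) :
    ∃ δ : ℝ, 0 < δ ∧ ∀ (V : Type) [Fintype V] (R B : SimpleGraph V) (U : Finset V),
      0 < Fintype.card V → (∀ u ∈ U, IsTypical p c k δ R B u) →
      ((Uᶜ).card : ℝ) ≤ δ * Fintype.card V →
      ((U.filter fun v => codeg B v < (1 / k - σ) * Fintype.card V).card : ℝ)
        ≤ σ * Fintype.card V ∧ (1 - p) / k - σ ≤ c := by
  rcases (by omega : k = 1 ∨ 2 ≤ k) with hk1 | hk2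
  · obtain ⟨δ, hδ, h⟩ := exists_typical_of_red_degree_ge hk hp0 hp1 hc1 hc2 hσ
    refine ⟨δ, hδ, fun V _ R B U hV hU hUc => ?_⟩
    obtain ⟨-, h2, h3⟩ := h V R B U hV hU hUc
    refine ⟨?_, h2⟩
    rw [filter_eq_empty_iff.2 fun v hv => not_lt.2 (h3 hk1 v hv)]
    simp only [card_empty, Nat.cast_zero]
    positivity
  · set ω := min (σ / 8) (σ ^ 2 / 4) with hω
    have hω0 : 0 < ω := by positivity
    have hω1 : ω ≤ σ / 8 := min_le_left _ _
    have hω2 : ω ≤ σ ^ 2 / 4 := min_le_right _ _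
    -- Propagation is used twice: from one vertex u₀ to a set E of nearly n/k vertices, then from
    -- every u in E. The first round needs k ≥ 2, as the green neighbourhood of u₀ has nearly (1 -
    -- 1/k)n ≥ n/k vertices.
    obtain ⟨ω₁, hω₁, hωω₁, δ₁, hδ₁, H₁⟩ := exists_red_degree_propagation hk2 hp0 hp1 hc2 hω0
    obtain ⟨ω₂, hω₂, hωω₂, δ₂, hδ₂, H₂⟩ := exists_red_degree_propagation hk2 hp0 hp1 hc2 hω₁
    obtain ⟨δ₃, hδ₃, H₃⟩ := exists_typical_of_red_degree_ge hk hp0 hp1 hc1 hc2 hω₂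
    refine ⟨min δ₁ (min δ₂ δ₃), by positivity, fun V _ R B U hV hU hUc => ?_⟩
    have hN : 0 < (Fintype.card V : ℝ) := by exact_mod_cast hV
    have g1 : min δ₁ (min δ₂ δ₃) ≤ δ₁ := min_le_left _ _
    have g2 : min δ₁ (min δ₂ δ₃) ≤ δ₂ := (min_le_right _ _).trans (min_le_left _ _)
    have g3 : min δ₁ (min δ₂ δ₃) ≤ δ₃ := (min_le_right _ _).trans (min_le_right _ _)
    have H₁' := H₁ V R B U hV (fun u hu => (hU u hu).mono g1) (hUc.trans (by gcongr))
    have H₂' := H₂ V R B U hV (fun u hu => (hU u hu).mono g2) (hUc.trans (by gcongr))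
    obtain ⟨⟨u₀, hu₀, hr₀⟩, hc, -⟩ :=
      H₃ V R B U hV (fun u hu => (hU u hu).mono g3) (hUc.trans (by gcongr))
    refine ⟨?_, by linarith⟩
    set N : ℝ := (Fintype.card V : ℝ) with hNdef
    set E := U.filter fun v => ¬ codeg B v < (1 / k - ω₁) * N with hE
    set X := U.filter fun v => codeg B v < (1 / k - σ) * N with hX
    have hEcard : (1 / k - 3 * ω) * N ≤ E.card := by
      obtain ⟨-, h1, h2⟩ := H₂' u₀ hu₀ hr₀
      set S := nbhd R u₀ ∩ nbhd B u₀ ∩ U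
      have h3 : (S.filter fun v => codeg B v < (1 / k - ω₁) * N).card
          + (S.filter fun v => ¬ codeg B v < (1 / k - ω₁) * N).card = S.card :=
        Finset.card_filter_add_card_filter_not _
      have h4 : (S.filter fun v => ¬ codeg B v < (1 / k - ω₁) * N) ⊆ E :=
        filter_subset_filter _ inter_subset_right
      have h5 : (S.card : ℝ) ≤ (S.filter fun v => codeg B v < (1 / k - ω₁) * N).card + E.card := by
        rw [← h3]
        push_cast
        have : ((S.filter fun v => ¬ codeg B v < (1 / k - ω₁) * N).card : ℝ) ≤ E.card := by
          exact_mod_cast Finset.card_le_card h4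
        linarith
      have hkk : (1 : ℝ) / k ≤ 1 / 2 := by
        apply one_div_le_one_div_of_le (by norm_num)
        exact_mod_cast hk2
      have h6 : (1 / k - 3 * ω) * N ≤ (1 - 1 / k - 3 * ω₁) * N := by
        gcongr
        linarith
      linarith
    -- Few vertices of X are blue or green to u, so nearly all are red to u.
    have hout : ∀ u ∈ E, (X.card : ℝ) - 2 * ω * N ≤ (X.filter fun x => ¬ B.Adj u x).card := by
      intro u hu
      rw [hE, mem_filter, not_lt] at hu
      obtain ⟨h1, -, h2⟩ := H₁' u hu.1 hu.2
      have hsub : X ⊆ (X.filter fun x => ¬ B.Adj u x) ∪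
          ((univ.filter fun y => ¬ R.Adj u y) ∪ (nbhd R u ∩ nbhd B u ∩ U).filter fun v =>
          codeg B v < (1 / k - ω) * N) := by
        intro x hx
        have hx' := mem_filter.1 hx
        simp only [mem_union, mem_filter, mem_univ, true_and, mem_inter, mem_nbhd, hx, hx'.1]
        have h3 : codeg B x < (1 / k - ω) * N := by
          refine hx'.2.trans_le ?_
          gcongr
          linarith
        tauto
      have h3 := (Finset.card_le_card hsub).trans ((Finset.card_union_le _ _).trans
        (Nat.add_le_add_left (Finset.card_union_le _ _) _))
      have h4 : (X.card : ℝ) ≤ (X.filter fun x => ¬ B.Adj u x).card + (codeg R u +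
          ((nbhd R u ∩ nbhd B u ∩ U).filter fun v => codeg B v < (1 / k - ω) * N).card) := by
        unfold codeg
        exact_mod_cast h3
      linarith
    have hdc : (∑ u ∈ E, (X.filter fun x => ¬ B.Adj u x).card)
        = ∑ x ∈ X, (E.filter fun u => ¬ B.Adj u x).card :=
      Finset.sum_card_bipartiteAbove_eq_sum_card_bipartiteBelow _
    -- Red pairs between E and X are counted twice: on average a vertex of X is red to nearly |E|
    -- vertices, yet its red degree is below |E| by order σN. So X is small.
    have hlow : E.card * ((X.card : ℝ) - 2 * ω * N) ≤ X.card * ((1 / k - σ) * N) := by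
      calc E.card * ((X.card : ℝ) - 2 * ω * N)
          ≤ ∑ u ∈ E, ((X.filter fun x => ¬ B.Adj u x).card : ℝ) := by
            rw [← nsmul_eq_mul]
            exact Finset.card_nsmul_le_sum _ _ _ hout
        _ = ∑ x ∈ X, ((E.filter fun u => ¬ B.Adj u x).card : ℝ) := by exact_mod_cast hdc
        _ ≤ X.card * ((1 / k - σ) * N) := by
            rw [← nsmul_eq_mul]
            refine Finset.sum_le_card_nsmul _ _ _ fun x hx => le_trans ?_ (mem_filter.1 hx).2.le
            unfold codeg
            have : (E.filter fun u => ¬ B.Adj u x) ⊆ univ.filter fun y => ¬ B.Adj x y := by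
              intro y hy
              have := (mem_filter.1 hy).2
              simpa [SimpleGraph.adj_comm] using this
            exact_mod_cast Finset.card_le_card this
    have hEN : (E.card : ℝ) ≤ N := by rw [hNdef]; exact_mod_cast Finset.card_le_univ _
    have hX0 : (0 : ℝ) ≤ X.card := Nat.cast_nonneg _
    have f1 : X.card * ((1 / k - 3 * ω) * N) ≤ X.card * (E.card : ℝ) := by gcongr
    have f2 : (E.card : ℝ) * (2 * ω * N) ≤ N * (2 * ω * N) := by gcongr
    have f3 : (X.card : ℝ) * (σ / 2 * N) ≤ (X.card : ℝ) * ((σ - 3 * ω) * N) := by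
      gcongr
      linarith
    have f4 : N * (2 * ω * N) ≤ N * (2 * (σ ^ 2 / 4) * N) := by gcongr
    have f5 : (X.card : ℝ) * (σ / 2 * N) ≤ σ * N * (σ / 2 * N) := by linarith
    exact le_of_mul_le_mul_right f5 (by positivity)

/-- Cliques in the blue neighbourhood of `u` either lie in its green neighbourhood or use a pair
at `u` that is not red. -/
lemma card_cliqueTuples_nbhd_le (R B : SimpleGraph V) (j : ℕ) (u : V) :
    ((cliqueTuples B (j + 1) (nbhd B u)).card : ℝ)
      ≤ (cliqueTuples B (j + 1) (nbhd R u ∩ nbhd B u)).card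
        + (j + 1) * (codeg R u * (Fintype.card V : ℝ) ^ j) := by
  have hsub : cliqueTuples B (j + 1) (nbhd B u) ⊆
      cliqueTuples B (j + 1) (nbhd R u ∩ nbhd B u) ∪
      univ.biUnion fun i : Fin (j + 1) => univ.filter fun f : Fin (j + 1) → V =>
        ¬ R.Adj u (f i) := by
    intro f hf
    rw [mem_cliqueTuples] at hf
    by_cases h : ∀ i, R.Adj u (f i)
    · refine mem_union_left _ (mem_cliqueTuples.2 ⟨fun i => ?_, hf.2⟩)
      exact mem_inter.2 ⟨mem_nbhd.2 (h i), hf.1 i⟩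
    · push Not at h
      obtain ⟨i, hi⟩ := h
      exact mem_union_right _ (mem_biUnion.2 ⟨i, mem_univ _, by simpa using hi⟩)
  have hone : ∀ i : Fin (j + 1), (univ.filter fun f : Fin (j + 1) → V => ¬ R.Adj u (f i)).card
      ≤ (univ.filter fun y => ¬ R.Adj u y).card * Fintype.card V ^ j := by
    intro i
    have : Fintype.card V ^ j = (univ : Finset (Fin j → V)).card := by simp
    rw [this, ← Finset.card_product]
    refine Finset.card_le_card_of_injOn (fun f => (f i, i.removeNth f)) ?_ ?_
    · intro f hf
      simpa using hf
    · intro f _ g _ h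
      simp only [Prod.mk.injEq] at h
      rw [← Fin.insertNth_self_removeNth i f, ← Fin.insertNth_self_removeNth i g, h.1, h.2]
  have h1 := (Finset.card_le_card hsub).trans ((Finset.card_union_le _ _).trans
    (Nat.add_le_add_left (Finset.card_biUnion_le.trans (Finset.sum_le_sum fun i _ => hone i)) _))
  simp only [sum_const, card_univ, Fintype.card_fin, smul_eq_mul] at h1
  unfold codeg
  exact_mod_cast h1

lemma sum_le_of_compl_card_le {f : V → ℝ} {U : Finset V} {M m κ : ℝ} (hM : 0 ≤ M) (hm : 0 ≤ m)
    (hfM : ∀ u, f u ≤ M) (hfm : ∀ u ∈ U, f u ≤ m) (hU : ((Uᶜ).card : ℝ) ≤ κ) :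
    ∑ u, f u ≤ Fintype.card V * m + κ * M := by
  rw [← Finset.sum_add_sum_compl U]
  have h1 : ∑ u ∈ U, f u ≤ U.card * m := by
    rw [← nsmul_eq_mul]
    exact Finset.sum_le_card_nsmul _ _ _ hfm
  have h2 : ∑ u ∈ Uᶜ, f u ≤ (Uᶜ).card * M := by
    rw [← nsmul_eq_mul]
    exact Finset.sum_le_card_nsmul _ _ _ fun u _ => hfM u
  have h3 : (U.card : ℝ) * m ≤ Fintype.card V * m := by
    gcongr
    exact Finset.card_le_univ _
  have h4 : ((Uᶜ).card : ℝ) * M ≤ κ * M := by gcongr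
  linarith

lemma card_compl_filter_not_le (U : Finset V) (P : V → Prop) [DecidablePred P] :
    (((U.filter fun v => ¬ P v)ᶜ).card : ℝ) ≤ (Uᶜ).card + (U.filter P).card := by
  have : (U.filter fun v => ¬ P v)ᶜ ⊆ Uᶜ ∪ U.filter P := by
    intro x hx
    simp only [mem_compl, mem_filter, not_and, not_not, mem_union] at hx ⊢
    tauto
  exact_mod_cast (Finset.card_le_card this).trans (Finset.card_union_le _ _)

/-- If almost all vertices are typical, then there are few blue pairs, few blue cliques of size
`k + 1`, and red degrees at most about `n / k`. -/
lemma exists_red_structure {p c : ℝ} {k : ℕ} (hk : 0 < k) (hp0 : 0 < p) (hp1 : p < 1)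
    (hc1 : c ≤ p / 2) (hc2 : c ≤ (1 - p) / k) {ε : ℝ} (hε : 0 < ε) :
    ∃ δ : ℝ, 0 < δ ∧ ∀ (V : Type) [Fintype V] (R B : SimpleGraph V) (U : Finset V),
      0 < Fintype.card V → (∀ u ∈ U, IsTypical p c k δ R B u) →
      ((Uᶜ).card : ℝ) ≤ δ * Fintype.card V →
      ∑ u, codeg R u ≤ ε * (Fintype.card V : ℝ) ^ 2 ∧
      ((cliqueTuples B (k + 1) univ).card : ℝ) ≤ ε * (Fintype.card V : ℝ) ^ (k + 1) ∧
      ((univ.filter fun u => (1 / k + ε) * Fintype.card V < codeg B u).card : ℝ)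
        ≤ ε * Fintype.card V ∧
      (1 - p) / k - ε ≤ c := by
  have hk0 : (0 : ℝ) < k := by exact_mod_cast hk
  have hk1 : (1 : ℝ) ≤ k := by exact_mod_cast hk
  set q := 1 - p with hq
  have hq0 : 0 < q := by linarith
  set μ := ε / (4 * k) with hμ
  have hμ0 : 0 < μ := by positivity
  have hμ1 : k * μ ≤ ε / 4 := by
    rw [hμ]
    apply le_of_eq
    field_simp
  have hμε : μ ≤ ε / 4 := (le_mul_of_one_le_left hμ0.le hk1).trans hμ1
  set σ := p * μ / 4 with hσ
  have hσ0 : 0 < σ := by positivity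
  have hσμ : σ ≤ μ / 4 := by
    have : p * μ ≤ 1 * μ := by gcongr
    linarith
  obtain ⟨δ₁, hδ₁, H⟩ := exists_red_degrees hk hp0 hp1 hc1 hc2 hσ0
  set δ := min δ₁ (q * σ) with hδ
  have hδ0 : 0 < δ := by positivity
  have hδ2 : δ ≤ q * σ := min_le_right _ _
  have hδσ : δ ≤ σ := hδ2.trans (mul_le_of_le_one_left hσ0.le (by linarith))
  refine ⟨δ, hδ0, fun V _ R B U hV hU hUc => ?_⟩
  have hN : 0 < (Fintype.card V : ℝ) := by exact_mod_cast hV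
  obtain ⟨hlow, hc⟩ := H V R B U hV (fun u hu => (hU u hu).mono (min_le_left _ _))
    (hUc.trans (by gcongr; exact min_le_left _ _))
  set N : ℝ := (Fintype.card V : ℝ) with hNdef
  set T := U.filter fun v => ¬ codeg B v < (1 / k - σ) * N with hT
  have hTc : ((Tᶜ).card : ℝ) ≤ μ / 2 * N := by
    have h := card_compl_filter_not_le U (fun v => codeg B v < (1 / k - σ) * N)
    have h2 : δ * N ≤ μ / 4 * N := by gcongr; linarith
    have h3 : σ * N ≤ μ / 4 * N := by gcongr
    linarith
  have hblue : ∀ u ∈ T, codeg R u ≤ μ / 2 * N := by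
    intro u hu
    rw [hT, mem_filter, not_lt] at hu
    have h1 := (hU u hu.1).1
    have h2 : q * ((1 / k - σ) * N) ≤ q * codeg B u := by gcongr; exact hu.2
    have h3 : c * N ≤ q / k * N := by gcongr
    have h4 : q * (σ * N) ≤ 1 * (σ * N) := by gcongr; linarith
    have h5 : δ * N ≤ σ * N := by gcongr
    have h6 : q * ((1 / k - σ) * N) = q / k * N - q * (σ * N) := by ring
    have h7 : p * codeg R u ≤ p * (μ / 2 * N) := by
      have h8 : σ * N = p * μ / 4 * N := by rw [hσ]
      linarith
    exact le_of_mul_le_mul_left h7 hp0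
  have hsumblue : ∑ u, codeg R u ≤ μ * N ^ 2 := by
    have := sum_le_of_compl_card_le hN.le (by positivity) (codeg_le R) hblue hTc
    linarith
  have hμN : μ * N ^ 2 ≤ ε / 4 * N ^ 2 := by gcongr
  have hεN : 0 ≤ ε * N ^ 2 := by positivity
  refine ⟨by linarith, ?_, ?_, by linarith⟩
  · obtain ⟨j, rfl⟩ : ∃ j, k = j + 1 := ⟨k - 1, by omega⟩
    rw [card_cliqueTuples_succ]
    push_cast
    simp only [univ_inter]
    have h1 : ∑ u, ((cliqueTuples B (j + 1) (nbhd R u ∩ nbhd B u)).card : ℝ)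
        ≤ N * (δ * N ^ (j + 1)) + δ * N * N ^ (j + 1) :=
      sum_le_of_compl_card_le (by positivity) (by positivity)
        (fun u => card_cliqueTuples_le _ _ _) (fun u hu => (hU u hu).2) hUc
    have h2 : ∑ u, ((cliqueTuples B (j + 1) (nbhd B u)).card : ℝ)
        ≤ ∑ u, ((cliqueTuples B (j + 1) (nbhd R u ∩ nbhd B u)).card : ℝ)
          + ∑ u, ((j : ℝ) + 1) * (codeg R u * N ^ j) := by
      rw [← Finset.sum_add_distrib]
      exact Finset.sum_le_sum fun u _ => card_cliqueTuples_nbhd_le R B j u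
    have h3 : ∑ u, ((j : ℝ) + 1) * (codeg R u * N ^ j) ≤ (j + 1) * (μ * N ^ 2 * N ^ j) := by
      rw [← Finset.mul_sum, ← Finset.sum_mul]
      gcongr
    have h4 : ((j : ℝ) + 1) * (μ * N ^ 2 * N ^ j) ≤ ε / 4 * N ^ (j + 2) := by
      push_cast at hμ1
      calc ((j : ℝ) + 1) * (μ * N ^ 2 * N ^ j) = ((j + 1) * μ) * N ^ (j + 2) := by ring
        _ ≤ _ := by gcongr
    have h5 : δ * N ^ (j + 2) ≤ ε / 4 * N ^ (j + 2) := by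
      gcongr
      linarith
    have h6 : N * (δ * N ^ (j + 1)) + δ * N * N ^ (j + 1) = 2 * (δ * N ^ (j + 2)) := by ring
    have h7 : 0 ≤ ε * N ^ (j + 2) := by positivity
    linarith
  · have hsub : (univ.filter fun u => (1 / k + ε) * N < codeg B u) ⊆ Uᶜ := by
      intro u hu
      rw [mem_compl]
      intro huU
      have h1 := (hU u huU).1
      have h2 := (mem_filter.1 hu).2
      have h3 : 0 ≤ p * codeg R u := mul_nonneg hp0.le (codeg_nonneg R u)
      have h4 : q * ((1 / k + ε) * N) < q * codeg B u := by gcongr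
      have h5 : c * N ≤ q / k * N := by gcongr
      have h6 : q * ((1 / k + ε) * N) = q / k * N + q * (ε * N) := by ring
      have h7 : δ * N ≤ q * σ * N := by gcongr
      have h8 : q * (σ * N) ≤ q * (ε * N) := by gcongr; linarith
      linarith
    calc _ ≤ ((Uᶜ).card : ℝ) := by exact_mod_cast Finset.card_le_card hsub
      _ ≤ δ * N := hUc
      _ ≤ ε * N := by gcongr; linarith

end RedCase

/-! ### Stability for an arbitrary loss bound c. -/

section AbstractStability

open Finset
open scoped Classical

lemma lossBetween_univ {V : Type*} [Fintype V] (p : ℝ) (R B : SimpleGraph V) :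
    lossBetween p R B univ univ = p * ∑ u, codeg R u + (1 - p) * ∑ u, codeg B u := by
  rw [lossBetween_univ_eq_sum]
  simp only [lossBetween_singleton_univ, Finset.sum_add_distrib, Finset.mul_sum]

/-- Few red cliques of size `a + 1` in a near-extremal igraph: it is close to `a` blue cliques
joined by green pairs. -/
lemma exists_blue_stability {p c : ℝ} {a : ℕ} (ha : 0 < a) (hp0 : 0 < p) (hp1 : p < 1)
    (hc : c ≤ p / a) {ε : ℝ} (hε : 0 < ε) :
    ∃ δ : ℝ, 0 < δ ∧ ∀ (V : Type) [Fintype V] (R B : SimpleGraph V), 0 < Fintype.card V →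
      ((cliqueTuples R (a + 1) univ).card : ℝ) ≤ δ * (Fintype.card V : ℝ) ^ (a + 1) →
      ((univ.filter fun u => (c + δ) * Fintype.card V < lossBetween p R B {u} univ).card : ℝ)
        ≤ δ * Fintype.card V →
      lossBetween p R B univ univ ≤ (c + δ) * (Fintype.card V : ℝ) ^ 2 →
      p / a - ε ≤ c ∧ ∑ u, codeg B u ≤ ε * (Fintype.card V : ℝ) ^ 2 ∧
      ∃ P : V → Fin a, ((univ.filter fun z : V × V => R.Adj z.1 z.2 ↔ P z.1 = P z.2).card : ℝ)
        ≤ ε * (Fintype.card V : ℝ) ^ 2 := by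
  set q := 1 - p with hq
  have hq0 : 0 < q := by linarith
  have ha0 : (0 : ℝ) < a := by exact_mod_cast ha
  set ε₁ := q * ε / 2 with hε₁
  have hε₁0 : 0 < ε₁ := by positivity
  have hε₁ε : ε₁ ≤ ε / 2 := by
    have : q * ε ≤ 1 * ε := by gcongr; linarith
    linarith
  obtain ⟨δ₁, hδ₁, H⟩ := exists_turan_partition ha hε₁0
  set δ := min (p * δ₁) ε₁ with hδ
  have hδ0 : 0 < δ := by positivity
  have hδp : δ ≤ p * δ₁ := min_le_left _ _
  have hδδ₁ : δ ≤ δ₁ := hδp.trans (mul_le_of_le_one_left hδ₁.le hp1.le)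
  have hδε : δ ≤ ε₁ := min_le_right _ _
  refine ⟨δ, hδ0, fun V _ R B hV hcl hdeg hloss => ?_⟩
  have hN : 0 < (Fintype.card V : ℝ) := by exact_mod_cast hV
  set N : ℝ := (Fintype.card V : ℝ) with hNdef
  obtain ⟨⟨P, hP⟩, hsum⟩ := H V R (hcl.trans (by gcongr)) (by
    refine le_trans ?_ (hdeg.trans (by gcongr))
    have hsub : (univ.filter fun u => (1 / a + δ₁) * N < codeg R u) ⊆
        univ.filter fun u => (c + δ) * N < lossBetween p R B {u} univ := by
      intro u hu
      simp only [mem_filter, mem_univ, true_and] at hu ⊢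
      rw [lossBetween_singleton_univ]
      have h1 : p * ((1 / a + δ₁) * N) < p * codeg R u := by gcongr
      have h2 : 0 ≤ q * codeg B u := mul_nonneg hq0.le (codeg_nonneg B u)
      have h3 : (c + δ) * N ≤ (p / a + p * δ₁) * N := by gcongr
      have h4 : p * ((1 / a + δ₁) * N) = (p / a + p * δ₁) * N := by ring
      linarith
    exact_mod_cast Finset.card_le_card hsub)
  rw [lossBetween_univ] at hloss
  have hB0 : 0 ≤ ∑ u, codeg B u := Finset.sum_nonneg fun u _ => codeg_nonneg B u
  have h1 : p * ((1 / a - ε₁) * N ^ 2) ≤ p * ∑ u, codeg R u := by gcongr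
  have h2 : p * ((1 / a - ε₁) * N ^ 2) = (p / a - p * ε₁) * N ^ 2 := by ring
  have h3 : p * ε₁ ≤ ε₁ := mul_le_of_le_one_left hε₁0.le hp1.le
  -- Pairs outside R already lose nearly (p/a)N². What remains of the budget bounds the pairs
  -- outside B, and its nonnegativity bounds c from below.
  have h4 : q * ∑ u, codeg B u ≤ (c + δ - (p / a - p * ε₁)) * N ^ 2 := by linarith
  have hN2 : 0 < N ^ 2 := by positivity
  refine ⟨?_, ?_, P, hP.trans (by gcongr; linarith)⟩
  · have h5 : 0 ≤ (c + δ - (p / a - p * ε₁)) * N ^ 2 :=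
      (mul_nonneg hq0.le hB0).trans h4
    have h6 : 0 ≤ c + δ - (p / a - p * ε₁) := by
      by_contra! h
      linarith [mul_neg_of_neg_of_pos h hN2]
    linarith
  · have h5 : q * ∑ u, codeg B u ≤ q * (ε * N ^ 2) := by
      calc q * ∑ u, codeg B u ≤ (c + δ - (p / a - p * ε₁)) * N ^ 2 := h4
        _ ≤ (q * ε) * N ^ 2 := by
          gcongr
          linarith
        _ = _ := by ring
    exact le_of_mul_le_mul_left h5 hq0

/-- Almost all vertices typical: the igraph is close to `k` red cliques joined by green pairs. -/
lemma exists_red_stability {p c : ℝ} {k : ℕ} (hk : 0 < k) (hp0 : 0 < p) (hp1 : p < 1)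
    (hc1 : c ≤ p / 2) (hc2 : c ≤ (1 - p) / k) {ε : ℝ} (hε : 0 < ε) :
    ∃ δ : ℝ, 0 < δ ∧ ∀ (V : Type) [Fintype V] (R B : SimpleGraph V) (U : Finset V),
      0 < Fintype.card V → (∀ u ∈ U, IsTypical p c k δ R B u) →
      ((Uᶜ).card : ℝ) ≤ δ * Fintype.card V →
      (1 - p) / k - ε ≤ c ∧ ∑ u, codeg R u ≤ ε * (Fintype.card V : ℝ) ^ 2 ∧
      ∃ P : V → Fin k, ((univ.filter fun z : V × V => B.Adj z.1 z.2 ↔ P z.1 = P z.2).card : ℝ)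
        ≤ ε * (Fintype.card V : ℝ) ^ 2 := by
  obtain ⟨δ₁, hδ₁, H⟩ := exists_turan_partition hk hε
  obtain ⟨δ, hδ, H'⟩ := exists_red_structure hk hp0 hp1 hc1 hc2 (ε := min ε δ₁) (by positivity)
  refine ⟨δ, hδ, fun V _ R B U hV hU hUc => ?_⟩
  obtain ⟨h1, h2, h3, h4⟩ := H' V R B U hV hU hUc
  have e1 : min ε δ₁ ≤ ε := min_le_left _ _
  have e2 : min ε δ₁ ≤ δ₁ := min_le_right _ _
  refine ⟨by linarith, h1.trans (by gcongr), (H V B (h2.trans (by gcongr)) ?_).1⟩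
  refine le_trans ?_ (h3.trans (by gcongr))
  have hsub : (univ.filter fun u => (1 / k + δ₁) * Fintype.card V < codeg B u) ⊆
      univ.filter fun u => (1 / k + min ε δ₁) * Fintype.card V < codeg B u := by
    intro u hu
    simp only [mem_filter, mem_univ, true_and] at hu ⊢
    refine lt_of_le_of_lt ?_ hu
    gcongr
  exact_mod_cast Finset.card_le_card hsub

/-- Superstability, in terms of a loss bound `c`. -/
theorem IsLossBound.exists_stability {p c : ℝ} {a k : ℕ} (h : IsLossBound p a (k + 1) c)
    (ha : 2 ≤ a) (hk : 0 < k) (hp0 : 0 < p) (hp1 : p < 1) (hc0 : 0 ≤ c) (hc1 : c ≤ p / a)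
    (hc2 : c ≤ (1 - p) / k) {ε : ℝ} (hε : 0 < ε) :
    ∃ δ : ℝ, 0 < δ ∧ ∃ n₀ : ℕ, ∀ (V : Type) [Fintype V] (R B : SimpleGraph V),
      R ⊔ B = ⊤ → n₀ ≤ Fintype.card V →
      ((eyeTuples R B a (k + 1)).card : ℝ) ≤ δ * (Fintype.card V : ℝ) ^ (a + (k + 1)) →
      lossBetween p R B univ univ ≤ (c + δ) * (Fintype.card V : ℝ) ^ 2 →
      (p / a - ε ≤ c ∧ ∑ u, codeg B u ≤ ε * (Fintype.card V : ℝ) ^ 2 ∧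
        ∃ P : V → Fin a,
          ((univ.filter fun z : V × V => R.Adj z.1 z.2 ↔ P z.1 = P z.2).card : ℝ)
            ≤ ε * (Fintype.card V : ℝ) ^ 2) ∨
      ((1 - p) / k - ε ≤ c ∧ ∑ u, codeg R u ≤ ε * (Fintype.card V : ℝ) ^ 2 ∧
        ∃ P : V → Fin k,
          ((univ.filter fun z : V × V => B.Adj z.1 z.2 ↔ P z.1 = P z.2).card : ℝ)
            ≤ ε * (Fintype.card V : ℝ) ^ 2) := by
  have hcp : c ≤ p / 2 := by
    refine hc1.trans (div_le_div_of_nonneg_left hp0.le (by norm_num) ?_)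
    exact_mod_cast ha
  obtain ⟨δ₁, hδ₁, H₁⟩ := exists_blue_stability (by omega : 0 < a) hp0 hp1 hc1 hε
  obtain ⟨δ₂, hδ₂, H₂⟩ := exists_red_stability hk hp0 hp1 hcp hc2 hε
  set τ := min δ₁ (δ₂ / 3) with hτ
  have hτ0 : 0 < τ := by positivity
  have hτ1 : τ ≤ δ₁ := min_le_left _ _
  have hτ2 : τ ≤ δ₂ / 3 := min_le_right _ _
  obtain ⟨η, hη, δ₃, hδ₃, n₃, H₃⟩ := h.dichotomy hp0 hp1.le hc0 hcp hτ0
  obtain ⟨δ₄, hδ₄, n₄, H₄⟩ := h.card_filter_le hp0.le hp1.le hc0 (by linarith) hτ0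
  obtain ⟨δ₅, hδ₅, n₅, H₅⟩ := exists_few_blue_cliques a k hη hτ0
  refine ⟨min τ (min δ₃ (min δ₄ δ₅)), by positivity, max 1 (max n₃ (max n₄ n₅)),
    fun V _ R B hRB hV hE hloss => ?_⟩
  have g0 : min τ (min δ₃ (min δ₄ δ₅)) ≤ τ := min_le_left _ _
  have g3 : min τ (min δ₃ (min δ₄ δ₅)) ≤ δ₃ := (min_le_right _ _).trans (min_le_left _ _)
  have g4 : min τ (min δ₃ (min δ₄ δ₅)) ≤ δ₄ :=
    (min_le_right _ _).trans ((min_le_right _ _).trans (min_le_left _ _))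
  have g5 : min τ (min δ₃ (min δ₄ δ₅)) ≤ δ₅ :=
    (min_le_right _ _).trans ((min_le_right _ _).trans (min_le_right _ _))
  have hV1 : 0 < Fintype.card V := by
    have := (le_max_left _ _).trans hV
    omega
  have hV2 := (le_max_right _ _).trans hV
  have hdeg := H₄ V R B hRB (((le_max_left _ _).trans (le_max_right _ _)).trans hV2)
    (hE.trans (by gcongr)) (hloss.trans (by gcongr))
  rcases H₃ V R B hRB ((le_max_left _ _).trans hV2) (hE.trans (by gcongr))
    (hloss.trans (by gcongr)) with hcl | hD
  · left
    refine H₁ V R B hV1 (hcl.trans (by gcongr)) ?_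
      (hloss.trans (by gcongr; exact g0.trans hτ1))
    refine le_trans ?_ (hdeg.trans (by gcongr))
    have hsub : (univ.filter fun u => (c + δ₁) * Fintype.card V < lossBetween p R B {u} univ) ⊆
        univ.filter fun u => (c + τ) * Fintype.card V < lossBetween p R B {u} univ := by
      intro u hu
      simp only [mem_filter, mem_univ, true_and] at hu ⊢
      refine lt_of_le_of_lt ?_ hu
      gcongr
    exact_mod_cast Finset.card_le_card hsub
  · right
    have hfew := H₅ V R B hRB (((le_max_right _ _).trans (le_max_right _ _)).trans hV2)
      (hE.trans (by gcongr))
    set U : Finset V := univ.filter fun u => IsTypical p c k δ₂ R B u with hU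
    refine H₂ V R B U hV1 (fun u hu => (mem_filter.1 hu).2) ?_
    set N : ℝ := (Fintype.card V : ℝ) with hN
    -- An atypical vertex has excess loss, is poor, or is an exception to `exists_few_blue_cliques`.
    -- Each class has at most τN members, hence τ ≤ δ₂/3.
    have hsub : Uᶜ ⊆ (univ.filter fun u => (c + τ) * N < lossBetween p R B {u} univ) ∪
        ((univ.filter fun u => ¬ η * N ^ a ≤ (cliqueTuples R a (nbhd R u)).card) ∪
        univ.filter fun u => η * N ^ a ≤ (cliqueTuples R a (nbhd R u)).card ∧
          τ * N ^ k < (cliqueTuples B k (nbhd R u ∩ nbhd B u)).card) := by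
      intro u hu
      rw [mem_compl] at hu
      simp only [mem_union, mem_filter, mem_univ, true_and]
      by_contra! hcon
      obtain ⟨h1, h2, h3⟩ := hcon
      refine hu (mem_filter.2 ⟨mem_univ _, ?_, ?_⟩)
      · rw [lossBetween_singleton_univ] at h1
        refine h1.trans ?_
        gcongr
        linarith
      · refine (h3 h2).trans ?_
        gcongr
        linarith
    have h1 := (Finset.card_le_card hsub).trans ((Finset.card_union_le _ _).trans
      (Nat.add_le_add_left (Finset.card_union_le _ _) _))
    have h2 : ((Uᶜ).card : ℝ) ≤ τ * N + (τ * N + τ * N) := by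
      refine le_trans (Nat.cast_le.2 h1) ?_
      push_cast
      exact add_le_add hdeg (add_le_add hD hfew)
    have h3 : τ * N ≤ δ₂ / 3 * N := by gcongr
    linarith

end AbstractStability

/-! ### From pairs of graphs back to igraphs; the extremal examples. -/

namespace IGraph

open Finset
open scoped Classical

lemma redGraph_adj {V : Type*} {C : IGraph V} {x y : V} :
    C.redGraph.Adj x y ↔ ∃ h : x ≠ y, C.get x y h ≠ EyeColour.blue := by
  simp only [redGraph, SimpleGraph.sup_adj, SimpleGraph.TopEdgeLabeling.labelGraph_adj]
  rw [← exists_or]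
  refine exists_congr fun h => ?_
  cases C.get x y h <;> simp

lemma blueGraph_adj {V : Type*} {C : IGraph V} {x y : V} :
    C.blueGraph.Adj x y ↔ ∃ h : x ≠ y, C.get x y h ≠ EyeColour.red := by
  simp only [blueGraph, SimpleGraph.sup_adj, SimpleGraph.TopEdgeLabeling.labelGraph_adj]
  rw [← exists_or]
  refine exists_congr fun h => ?_
  cases C.get x y h <;> simp

lemma redGraph_sup_blueGraph {V : Type*} (C : IGraph V) : C.redGraph ⊔ C.blueGraph = ⊤ := by
  ext x y
  rw [SimpleGraph.sup_adj, redGraph_adj, blueGraph_adj, SimpleGraph.top_adj, ← exists_or]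
  refine ⟨fun ⟨h, _⟩ => h, fun h => ⟨h, ?_⟩⟩
  cases C.get x y h <;> simp

lemma sum_codeg_eq {V : Type*} [Fintype V] (F : SimpleGraph V) :
    ∑ u, codeg F u = (Fintype.card V : ℝ) ^ 2 - 2 * (F.edgeSet.ncard : ℝ) := by
  have h1 : ∀ u, codeg F u = Fintype.card V - (F.degree u : ℝ) := by
    intro u
    have h : (univ.filter fun y => F.Adj u y).card + (univ.filter fun y => ¬ F.Adj u y).card
        = Fintype.card V := Finset.card_filter_add_card_filter_not _
    have h2 : (univ.filter fun y => F.Adj u y).card = F.degree u := by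
      rw [← SimpleGraph.card_neighborFinset_eq_degree, SimpleGraph.neighborFinset_eq_filter]
    rw [h2] at h
    unfold codeg
    have h3 : ((F.degree u : ℝ)) + ((univ.filter fun y => ¬ F.Adj u y).card : ℝ)
        = Fintype.card V := by exact_mod_cast h
    linarith
  have h2 : (∑ u, (F.degree u : ℝ)) = 2 * (F.edgeSet.ncard : ℝ) := by
    rw [← SimpleGraph.coe_edgeFinset (G := F), Set.ncard_coe_finset]
    exact_mod_cast F.sum_degrees_eq_twice_card_edges
  simp only [h1, Finset.sum_sub_distrib, h2]
  simp
  ring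

lemma lossBetween_eq {V : Type*} [Fintype V] (p : ℝ) (C : IGraph V) :
    lossBetween p C.redGraph C.blueGraph univ univ
      = (Fintype.card V : ℝ) ^ 2 - 2 * C.weight p := by
  rw [lossBetween_univ, sum_codeg_eq, sum_codeg_eq, weight]
  ring

lemma places_of_mem_eyeTuples {V : Type*} [Fintype V] {C : IGraph V} {a b : ℕ}
    {t : (Fin a → V) × (Fin b → V)} (ht : t ∈ eyeTuples C.redGraph C.blueGraph a b) :
    ∃ f : Fin a ⊕ Fin b ↪ V, ⇑f = Sum.elim t.1 t.2 ∧ C.Places (eye a b) f := by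
  rw [mem_eyeTuples, mem_cliqueTuples, mem_cliqueTuples] at ht
  obtain ⟨⟨-, hα⟩, hβ', hβ⟩ := ht
  simp only [mem_commonNbhd] at hβ'
  have hinj : Function.Injective (Sum.elim t.1 t.2) := by
    rintro (i | i) (j | j) h
    · by_contra hij
      exact (hα i j fun h' => hij (congrArg _ h')).ne h
    · exact absurd h (hβ' j i).ne
    · exact absurd h.symm (hβ' i j).ne
    · by_contra hij
      exact (hβ i j fun h' => hij (congrArg _ h')).ne h
  refine ⟨⟨_, hinj⟩, rfl, ?_, ?_⟩
  · rw [SimpleGraph.map_le_iff_le_comap]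
    rintro (i | i) (j | j) h
    · exact hα i j fun h' => h.ne (congrArg _ h')
    · exact hβ' j i
    · exact (hβ' i j).symm
    · exfalso
      simp only [eye, SimpleGraph.sdiff_adj] at h
      refine h.2 ?_
      rw [SimpleGraph.map_adj]
      exact ⟨i, j, fun h' => h.1 (congrArg _ h'), rfl, rfl⟩
  · rw [SimpleGraph.map_le_iff_le_comap]
    have hred : ∀ x y, (eye a b)ᶜ.Adj x y →
        ((⊤ : SimpleGraph (Fin b)).map Function.Embedding.inr).Adj x y := by
      intro x y h
      rw [SimpleGraph.compl_adj] at h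
      by_contra h'
      exact h.2 ⟨h.1, h'⟩
    intro x y h
    have h1 := hred x y h
    rw [SimpleGraph.map_adj] at h1
    obtain ⟨i, j, hij, rfl, rfl⟩ := h1
    exact hβ i j hij

/-- Placements with the same copy take their a + b values in its vertex set, which has a + b
elements. -/
lemma card_eyeTuples_le {V : Type*} [Fintype V] (C : IGraph V) (a b : ℕ) :
    (eyeTuples C.redGraph C.blueGraph a b).card
      ≤ (a + b) ^ (a + b) * (C.copies (eye a b)).ncard := by
  have hfin : (C.copies (eye a b)).Finite := Set.toFinite _
  set F : (Fin a → V) × (Fin b → V) → Set V × SimpleGraph V × SimpleGraph V := fun t =>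
    (Set.range (Sum.elim t.1 t.2), (eye a b).map (Sum.elim t.1 t.2),
      (eye a b)ᶜ.map (Sum.elim t.1 t.2)) with hF
  rw [Set.ncard_eq_toFinset_card _ hfin]
  refine Finset.card_le_mul_card_image_of_maps_to (f := F) ?_ _ ?_
  · intro t ht
    obtain ⟨f, hf, hp⟩ := places_of_mem_eyeTuples ht
    rw [Set.Finite.mem_toFinset]
    refine ⟨f, hp, ?_⟩
    simp only [hF]
    rw [← hf]
  · intro K hK
    rw [Set.Finite.mem_toFinset] at hK
    obtain ⟨f, -, hKf⟩ := hK
    have hS : (univ.filter fun x => x ∈ K.1).card = a + b := by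
      have : (univ.filter fun x => x ∈ K.1) = univ.map f := by
        ext x
        simp [hKf]
      rw [this, Finset.card_map, Finset.card_univ, Fintype.card_sum, Fintype.card_fin,
        Fintype.card_fin]
    have hpi : (a + b) ^ (a + b) = (Fintype.piFinset
        fun _ : Fin a ⊕ Fin b => univ.filter fun x => x ∈ K.1).card := by
      rw [Fintype.card_piFinset, Finset.prod_const, hS, Finset.card_univ, Fintype.card_sum,
        Fintype.card_fin, Fintype.card_fin]
    rw [hpi]
    refine Finset.card_le_card_of_injOn (fun t => Sum.elim t.1 t.2) ?_ ?_
    · intro t ht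
      have ht2 := (mem_filter.1 (mem_coe.1 ht)).2
      rw [mem_coe, Fintype.mem_piFinset]
      intro x
      rw [← ht2]
      simp only [hF, mem_filter, mem_univ, true_and]
      exact ⟨x, rfl⟩
    · rintro ⟨α, β⟩ - ⟨α', β'⟩ - h
      simp only at h
      ext i
      · exact congrFun h (Sum.inl i)
      · exact congrFun h (Sum.inr i)

/-- The igraph whose parts are cliques of colour `c`, joined by green pairs. -/
def partitionGraph {V : Type*} {k : ℕ} (c : EyeColour) (P : V → Fin k) : IGraph V :=
  SimpleGraph.EdgeLabeling.mk (fun x y _ => if P x = P y then c else EyeColour.green)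
    (fun x y _ => by simp only [eq_comm])

lemma partitionGraph_get {V : Type*} {k : ℕ} (c : EyeColour) (P : V → Fin k) (x y : V)
    (h : x ≠ y) : (partitionGraph c P).get x y h = if P x = P y then c else EyeColour.green :=
  rfl

lemma isCliquePartition_partitionGraph {V : Type*} {k : ℕ} (c : EyeColour) (P : V → Fin k) :
    (partitionGraph c P).IsCliquePartition c k :=
  ⟨P, fun _ _ _ => rfl⟩

lemma Places.adj_red {V W : Type*} {C : IGraph V} {H : SimpleGraph W} {f : W ↪ V}
    (h : C.Places H f) {x y : W} (hxy : H.Adj x y) : C.redGraph.Adj (f x) (f y) :=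
  (SimpleGraph.map_le_iff_le_comap ..).1 h.1 hxy

lemma Places.adj_blue {V W : Type*} {C : IGraph V} {H : SimpleGraph W} {f : W ↪ V}
    (h : C.Places H f) {x y : W} (hxy : Hᶜ.Adj x y) : C.blueGraph.Adj (f x) (f y) :=
  (SimpleGraph.map_le_iff_le_comap ..).1 h.2 hxy

/-- The centre and one further vertex, represented by `none`, are pairwise adjacent in the eye and
would need a + 1 different parts. -/
lemma free_partitionGraph_blue {V : Type*} {a b : ℕ} (hb : 0 < b) (P : V → Fin a) :
    (partitionGraph EyeColour.blue P).Free (eye a b) := by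
  intro f hf
  have hne : ∀ x y, (eye a b).Adj x y → P (f x) ≠ P (f y) := by
    intro x y hxy h
    obtain ⟨h1, h2⟩ := redGraph_adj.1 (hf.adj_red hxy)
    rw [partitionGraph_get, if_pos h] at h2
    exact h2 rfl
  have hinj : Function.Injective (fun o : Option (Fin a) =>
      P (f (o.elim (Sum.inr ⟨0, hb⟩) Sum.inl))) := by
    have hadj : ∀ o o' : Option (Fin a), o ≠ o' → (eye a b).Adj
        (o.elim (Sum.inr ⟨0, hb⟩) Sum.inl) (o'.elim (Sum.inr ⟨0, hb⟩) Sum.inl) := by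
      intro o o' hoo
      simp only [eye, SimpleGraph.sdiff_adj, SimpleGraph.top_adj, SimpleGraph.map_adj]
      rcases o with _ | i <;> rcases o' with _ | j <;> simp at hoo ⊢
      exact hoo
    intro o o' h
    by_contra hoo
    exact hne _ _ (hadj o o' hoo) h
  have := Fintype.card_le_of_injective _ hinj
  simp at this

/-- The k + 1 independent vertices of the eye would need different parts. -/
lemma free_partitionGraph_red {V : Type*} {a k : ℕ} (P : V → Fin k) :
    (partitionGraph EyeColour.red P).Free (eye a (k + 1)) := by
  intro f hf
  have hinj : Function.Injective (fun i : Fin (k + 1) => P (f (Sum.inr i))) := by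
    intro i j h
    by_contra hij
    have hadj : (eye a (k + 1))ᶜ.Adj (Sum.inr i) (Sum.inr j) := by
      simp [eye, hij]
    obtain ⟨h1, h2⟩ := blueGraph_adj.1 (hf.adj_blue hadj)
    rw [partitionGraph_get, if_pos h] at h2
    exact h2 rfl
  have := Fintype.card_le_of_injective _ hinj
  simp at this

lemma eyeTuples_eq_empty {V : Type*} [Fintype V] {C : IGraph V} {a b : ℕ}
    (h : C.Free (eye a b)) : eyeTuples C.redGraph C.blueGraph a b = ∅ := by
  rw [Finset.eq_empty_iff_forall_notMem]
  intro t ht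
  obtain ⟨f, -, hf⟩ := places_of_mem_eyeTuples ht
  exact h f hf

/-- The part of a vertex in a partition of `k * t` vertices into `k` parts of size `t`. -/
def balancedPart (k t : ℕ) (x : Fin (k * t)) : Fin k := (finProdFinEquiv.symm x).1

lemma card_balancedPart (k t : ℕ) (u : Fin (k * t)) :
    (univ.filter fun y => balancedPart k t u = balancedPart k t y).card = t := by
  have hinj : Function.Injective fun j : Fin t => finProdFinEquiv (balancedPart k t u, j) := by
    intro i j h
    exact congrArg Prod.snd (finProdFinEquiv.injective h)
  have : (univ.filter fun y => balancedPart k t u = balancedPart k t y)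
      = univ.image fun j : Fin t => finProdFinEquiv (balancedPart k t u, j) := by
    ext y
    rw [Finset.mem_filter, Finset.mem_image]
    constructor
    · rintro ⟨-, h⟩
      refine ⟨(finProdFinEquiv.symm y).2, mem_univ _, ?_⟩
      rw [h]
      exact finProdFinEquiv.apply_symm_apply y
    · rintro ⟨j, -, rfl⟩
      exact ⟨mem_univ _,
        (congrArg Prod.fst (finProdFinEquiv.symm_apply_apply (balancedPart k t u, j))).symm⟩
  rw [this, Finset.card_image_of_injective _ hinj, Finset.card_univ, Fintype.card_fin]

/-- The second summand is the diagonal's share: each vertex is its own only non-neighbour in B. -/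
lemma lossBetween_partition_blue (p : ℝ) (k t : ℕ) :
    lossBetween p (partitionGraph EyeColour.blue (balancedPart k t)).redGraph
      (partitionGraph EyeColour.blue (balancedPart k t)).blueGraph univ univ
      = p * (k * t ^ 2) + (1 - p) * (k * t) := by
  have h1 : ∀ u, codeg (partitionGraph EyeColour.blue (balancedPart k t)).redGraph u = t := by
    intro u
    unfold codeg
    refine congrArg _ (Eq.trans ?_ (card_balancedPart k t u))
    congr 1
    ext y
    simp only [redGraph_adj, partitionGraph_get]
    by_cases huy : u = y
    · simp [huy]
    · by_cases h : balancedPart k t u = balancedPart k t y <;> simp [huy, h]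
  have h2 : ∀ u, codeg (partitionGraph EyeColour.blue (balancedPart k t)).blueGraph u = 1 := by
    intro u
    unfold codeg
    have : (univ.filter fun y =>
        ¬ (partitionGraph EyeColour.blue (balancedPart k t)).blueGraph.Adj u y) = {u} := by
      ext y
      simp only [blueGraph_adj, partitionGraph_get, mem_filter, mem_univ, true_and, mem_singleton]
      by_cases huy : u = y
      · simp [huy]
      · by_cases h : balancedPart k t u = balancedPart k t y <;> simp [huy, h, Ne.symm huy]
    rw [this]
    simp
  rw [lossBetween_univ]
  simp only [h1, h2, sum_const, card_univ, Fintype.card_fin, nsmul_eq_mul]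
  push_cast
  ring

lemma lossBetween_partition_red (p : ℝ) (k t : ℕ) :
    lossBetween p (partitionGraph EyeColour.red (balancedPart k t)).redGraph
      (partitionGraph EyeColour.red (balancedPart k t)).blueGraph univ univ
      = (1 - p) * (k * t ^ 2) + p * (k * t) := by
  have h1 : ∀ u, codeg (partitionGraph EyeColour.red (balancedPart k t)).blueGraph u = t := by
    intro u
    unfold codeg
    refine congrArg _ (Eq.trans ?_ (card_balancedPart k t u))
    congr 1
    ext y
    simp only [blueGraph_adj, partitionGraph_get]
    by_cases huy : u = y
    · simp [huy]
    · by_cases h : balancedPart k t u = balancedPart k t y <;> simp [huy, h]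
  have h2 : ∀ u, codeg (partitionGraph EyeColour.red (balancedPart k t)).redGraph u = 1 := by
    intro u
    unfold codeg
    have : (univ.filter fun y =>
        ¬ (partitionGraph EyeColour.red (balancedPart k t)).redGraph.Adj u y) = {u} := by
      ext y
      simp only [redGraph_adj, partitionGraph_get, mem_filter, mem_univ, true_and, mem_singleton]
      by_cases huy : u = y
      · simp [huy]
      · by_cases h : balancedPart k t u = balancedPart k t y <;> simp [huy, h, Ne.symm huy]
    rw [this]
    simp
  rw [lossBetween_univ]
  simp only [h1, h2, sum_const, card_univ, Fintype.card_fin, nsmul_eq_mul]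
  push_cast
  ring

/-- Free igraphs of small loss on multiples of `k` vertices bound `kappa` from below. -/
lemma one_sub_le_kappa {W : Type*} {H : SimpleGraph W} {p w : ℝ} {k : ℕ} (hk : 0 < k)
    (hp0 : 0 ≤ p) (hp1 : p ≤ 1) (hw : 0 ≤ w)
    (hex : ∀ t : ℕ, ∃ C : IGraph (Fin (k * t)), C.Free H ∧
      lossBetween p C.redGraph C.blueGraph univ univ = w * (k * t ^ 2) + (1 - w) * (k * t)) :
    1 - w / k ≤ kappa p H := by
  have hk1 : (1 : ℝ) ≤ k := by exact_mod_cast hk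
  -- As the limit exists, it may be computed along multiples of k, where balanced partitions are
  -- exact.
  have hlim : Tendsto (fun t : ℕ => kex p H (k * t) / ((k * t).choose 2 : ℝ)) atTop
      (𝓝 (kappa p H)) :=
    (tendsto_kappa hp0 hp1 H).comp (tendsto_id.const_mul_atTop' hk)
  refine ge_of_tendsto hlim ?_
  filter_upwards [eventually_ge_atTop 2] with t ht
  obtain ⟨C, hC, hloss⟩ := hex t
  rw [lossBetween_eq, Fintype.card_fin] at hloss
  have hle : C.weight p ≤ kex p H (k * t) := le_csSup (kex_bddAbove p H _) ⟨C, hC, rfl⟩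
  have ht' : (2 : ℝ) ≤ t := by exact_mod_cast ht
  have hkt : (2 : ℝ) ≤ k * t := by nlinarith
  have hpos : (0 : ℝ) < (k * t) * (k * t - 1) / 2 := by
    have : (0 : ℝ) < k * t - 1 := by linarith
    positivity
  rw [Nat.cast_choose_two]
  push_cast at hloss ⊢
  rw [le_div_iff₀ hpos]
  refine le_trans ?_ hle
  have hwk : w / k ≤ w := div_le_self hw hk1
  have e1 : w / k * (k * t * (k * t)) = w * (k * t ^ 2) := by
    have : (k : ℝ) ≠ 0 := by positivity
    field_simp
  have e2 : w / k * (k * t) ≤ w * (k * t) := by gcongr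
  linarith

/-- Free igraphs of small loss on multiples of `k` vertices bound loss bounds from above. -/
lemma isLossBound_le {p w c : ℝ} {a b k : ℕ} (hk : 0 < k) (hw0 : 0 ≤ w) (hc : IsLossBound p a b c)
    (hex : ∀ t : ℕ, ∃ C : IGraph (Fin (k * t)), C.Free (eye a b) ∧
      lossBetween p C.redGraph C.blueGraph univ univ = w * (k * t ^ 2) + (1 - w) * (k * t)) :
    c ≤ w / k := by
  refine le_of_forall_pos_le_add fun ε hε => ?_
  obtain ⟨δ, hδ, n₀, H⟩ := hc (ε / 2) (by positivity)
  obtain ⟨m, hm⟩ := exists_nat_gt (2 / ε)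
  set t := max n₀ m with ht
  obtain ⟨C, hC, hloss⟩ := hex t
  have h := H (Fin (k * t)) C.redGraph C.blueGraph C.redGraph_sup_blueGraph (by
    rw [Fintype.card_fin]
    calc n₀ ≤ t := le_max_left _ _
      _ ≤ k * t := Nat.le_mul_of_pos_left _ hk) (by
    rw [eyeTuples_eq_empty hC]
    simp only [card_empty, Nat.cast_zero]
    positivity)
  rw [hloss, Fintype.card_fin] at h
  push_cast at h
  have hk1 : (1 : ℝ) ≤ k := by exact_mod_cast hk
  have hmt : (m : ℝ) ≤ t := by exact_mod_cast le_max_right n₀ m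
  have htm : 2 / ε < t := hm.trans_le hmt
  have ht0 : (0 : ℝ) < t := lt_trans (by positivity) htm
  have hn : 2 / ε < k * t := htm.trans_le (le_mul_of_one_le_left ht0.le hk1)
  rw [div_lt_iff₀ hε] at hn
  have hpos : (0 : ℝ) < (k * t) ^ 2 := by positivity
  have e1 : w * (k * t ^ 2) = w / k * (k * t) ^ 2 := by field_simp
  have e2 : (1 - w) * (k * t : ℝ) ≤ ε / 2 * (k * t) ^ 2 := by
    calc (1 - w) * (k * t : ℝ) ≤ 1 * (k * t) := by gcongr; linarith
      _ ≤ (k * t * ε / 2) * (k * t) := by gcongr; linarith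
      _ = _ := by ring
  have e3 : (c - ε / 2) * (k * t : ℝ) ^ 2 ≤ (w / k + ε / 2) * (k * t) ^ 2 := by linarith
  have := le_of_mul_le_mul_right e3 hpos
  linarith

/-- Editing an igraph to a partition igraph costs at most the number of wrong ordered pairs. -/
lemma editDist_le {V : Type*} [Fintype V] (G G' : IGraph V) (S : Finset (V × V))
    (h : ∀ x y (hxy : x ≠ y), (x, y) ∉ S → G.get x y hxy = G'.get x y hxy) :
    G.editDist G' ≤ S.card := by
  unfold editDist
  rw [← Set.ncard_coe_finset S]
  -- Each unordered pair is charged to the ordered representative chosen by `Quot.out`.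
  refine Set.ncard_le_ncard_of_injOn (fun e => (Quot.out e.1 : V × V)) ?_ ?_ (Set.toFinite _)
  · rintro ⟨e, he⟩ hne
    by_contra hS
    refine hne ?_
    have hout : s((Quot.out e).1, (Quot.out e).2) = e := Quot.out_eq e
    have hxy : (Quot.out e).1 ≠ (Quot.out e).2 := by
      have h2 : s((Quot.out e).1, (Quot.out e).2) ∈ (⊤ : SimpleGraph V).edgeSet := hout.symm ▸ he
      simpa using h2
    have h3 := h _ _ hxy hS
    simp only [SimpleGraph.EdgeLabeling.get_eq, hout] at h3
    exact h3
  · rintro ⟨e, he⟩ - ⟨e', he'⟩ - hee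
    simp only at hee
    rw [Subtype.mk.injEq, ← Quot.out_eq e, ← Quot.out_eq e', hee]

end IGraph

/-! ### The optimal loss bound and the choice of the extremal family. -/

namespace IGraph

open Finset
open scoped Classical

lemma isLossBound_zero {p : ℝ} (h0 : 0 ≤ p) (h1 : p ≤ 1) (a b : ℕ) : IsLossBound p a b 0 := by
  intro ε hε
  refine ⟨1, one_pos, 0, fun V _ R B _ _ _ => ?_⟩
  have : (0 - ε) * (Fintype.card V : ℝ) ^ 2 ≤ 0 :=
    mul_nonpos_of_nonpos_of_nonneg (by linarith) (by positivity)
  exact this.trans (lossBetween_nonneg h0 h1 _ _)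

/-- The optimal loss bound is `min (p / a) ((1 - p) / k)`. -/
theorem isLossBound_min {p : ℝ} {a k : ℕ} (ha : 2 ≤ a) (hk : 0 < k) (hp0 : 0 < p) (hp1 : p < 1) :
    IsLossBound p a (k + 1) (min (p / a) ((1 - p) / k)) := by
  set S : Set ℝ := {c | IsLossBound p a (k + 1) c} with hS
  have hbd1 : ∀ c ∈ S, c ≤ p / a := fun c hc =>
    isLossBound_le (by omega) hp0.le hc fun t => ⟨partitionGraph EyeColour.blue (balancedPart a t),
      free_partitionGraph_blue (Nat.succ_pos k) _, lossBetween_partition_blue p a t⟩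
  have hbd2 : ∀ c ∈ S, c ≤ (1 - p) / k := fun c hc =>
    isLossBound_le hk (by linarith) hc fun t => ⟨partitionGraph EyeColour.red (balancedPart k t),
      free_partitionGraph_red _, by rw [lossBetween_partition_red]; ring⟩
  have hne : S.Nonempty := ⟨0, isLossBound_zero hp0.le hp1.le a (k + 1)⟩
  have hbdd : BddAbove S := ⟨_, hbd1⟩
  set c := sSup S with hc
  have hc0 : 0 ≤ c := le_csSup hbdd (isLossBound_zero hp0.le hp1.le a (k + 1))
  have hc1 : c ≤ p / a := csSup_le hne hbd1
  have hc2 : c ≤ (1 - p) / k := csSup_le hne hbd2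
  -- The slack ε in the definition makes the supremum itself a loss bound.
  have hcS : IsLossBound p a (k + 1) c := by
    intro ε hε
    obtain ⟨c', hc', hlt⟩ := exists_lt_of_lt_csSup hne (show c - ε / 2 < sSup S by linarith)
    obtain ⟨δ, hδ, n₀, H⟩ := hc' (ε / 2) (by positivity)
    refine ⟨δ, hδ, n₀, fun V _ R B hRB hV hE => le_trans ?_ (H V R B hRB hV hE)⟩
    exact mul_le_mul_of_nonneg_right (by linarith) (by positivity)
  suffices h : min (p / a) ((1 - p) / k) ≤ c by
    rwa [← le_antisymm (le_min hc1 hc2) h]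
  refine le_of_forall_pos_le_add fun ε hε => ?_
  obtain ⟨δ, hδ, n₀, H⟩ := hcS.exists_stability ha hk hp0 hp1 hc0 hc1 hc2 hε
  -- Maximality of c supplies a large igraph with few eyes and loss below (c + δ)n². Whichever
  -- structure it is close to gives min(p/a, q/k) ≤ c + ε.
  have hnot : ¬ IsLossBound p a (k + 1) (c + δ) := fun h => by
    have : c + δ ≤ c := le_csSup hbdd h
    linarith
  unfold IsLossBound at hnot
  push Not at hnot
  obtain ⟨ε', hε', hbad⟩ := hnot
  obtain ⟨V, _, R, B, hRB, hV, hE, hloss⟩ := hbad δ hδ n₀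
  rcases H V R B hRB hV hE (hloss.le.trans (by gcongr; linarith)) with h | h
  · linarith [h.1, min_le_left (p / a) ((1 - p) / k)]
  · linarith [h.1, min_le_right (p / a) ((1 - p) / k)]

/-- The lower bound on `kappa` is all that is needed to turn large weight into small loss. -/
lemma one_sub_min_le_kappa {p : ℝ} {a k : ℕ} (ha : 2 ≤ a) (hk : 0 < k) (hp0 : 0 < p)
    (hp1 : p < 1) : 1 - min (p / a) ((1 - p) / k) ≤ kappa p (eye a (k + 1)) := by
  have h1 : 1 - p / a ≤ kappa p (eye a (k + 1)) :=
    one_sub_le_kappa (by omega) hp0.le hp1.le hp0.le fun t =>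
      ⟨partitionGraph EyeColour.blue (balancedPart a t),
        free_partitionGraph_blue (Nat.succ_pos k) _, lossBetween_partition_blue p a t⟩
  have h2 : 1 - (1 - p) / k ≤ kappa p (eye a (k + 1)) :=
    one_sub_le_kappa hk hp0.le hp1.le (by linarith) fun t =>
      ⟨partitionGraph EyeColour.red (balancedPart k t),
        free_partitionGraph_red _, by rw [lossBetween_partition_red]; ring⟩
  rcases min_choice (p / a) ((1 - p) / k) with h | h <;> rw [h] <;> assumption

lemma card_filter_not_adj_union_le {n k : ℕ} {F F' : SimpleGraph (Fin n)}
    {P : Fin n → Fin k} {ε : ℝ}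
    (h1 : ∑ u, codeg F u ≤ ε / 2 * (n : ℝ) ^ 2)
    (h2 : ((univ.filter fun z : Fin n × Fin n => F'.Adj z.1 z.2 ↔ P z.1 = P z.2).card : ℝ)
      ≤ ε / 2 * (n : ℝ) ^ 2) :
    ((((univ.filter fun z : Fin n × Fin n => ¬ F.Adj z.1 z.2) ∪
      univ.filter fun z : Fin n × Fin n => F'.Adj z.1 z.2 ↔ P z.1 = P z.2).card : ℕ) : ℝ)
      ≤ ε * (n : ℝ) ^ 2 := by
  rw [sum_codeg] at h1
  calc _ ≤ ((univ.filter fun z : Fin n × Fin n => ¬ F.Adj z.1 z.2).card : ℝ)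
        + (univ.filter fun z : Fin n × Fin n => F'.Adj z.1 z.2 ↔ P z.1 = P z.2).card := by
        exact_mod_cast Finset.card_union_le _ _
    _ ≤ _ := by linarith

/-- Off the exceptional pairs nothing is truly red, and being truly blue agrees with lying in one
part; this determines the colour. -/
lemma exists_blueFamily_editDist_le {n a : ℕ} {G : IGraph (Fin n)} {ε : ℝ} {P : Fin n → Fin a}
    (h1 : ∑ u, codeg G.blueGraph u ≤ ε / 2 * (n : ℝ) ^ 2)
    (h2 : ((univ.filter fun z : Fin n × Fin n =>
      G.redGraph.Adj z.1 z.2 ↔ P z.1 = P z.2).card : ℝ) ≤ ε / 2 * (n : ℝ) ^ 2) :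
    ∃ G' ∈ blueFamily a n, (G.editDist G' : ℝ) ≤ ε * (n : ℝ) ^ 2 := by
  refine ⟨partitionGraph EyeColour.blue P, isCliquePartition_partitionGraph _ P, ?_⟩
  have h3 := card_filter_not_adj_union_le h1 h2
  refine le_trans (Nat.cast_le.2 (editDist_le _ _ _ ?_)) h3
  intro x y hxy hS
  simp only [mem_union, mem_filter, mem_univ, true_and, not_or, not_not, redGraph_adj,
    blueGraph_adj] at hS
  obtain ⟨⟨hne, h4⟩, h5⟩ := hS
  replace h4 : G.get x y hxy ≠ EyeColour.red := h4
  have h6 : ¬ (G.get x y hxy ≠ EyeColour.blue ↔ P x = P y) := fun h =>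
    h5 ⟨fun ⟨_, h'⟩ => h.1 h', fun h' => ⟨hxy, h.2 h'⟩⟩
  rw [partitionGraph_get]
  revert h4 h6
  generalize G.get x y hxy = col
  by_cases hP : P x = P y <;> cases col <;> simp [hP]

lemma exists_redFamily_editDist_le {n k : ℕ} {G : IGraph (Fin n)} {ε : ℝ} {P : Fin n → Fin k}
    (h1 : ∑ u, codeg G.redGraph u ≤ ε / 2 * (n : ℝ) ^ 2)
    (h2 : ((univ.filter fun z : Fin n × Fin n =>
      G.blueGraph.Adj z.1 z.2 ↔ P z.1 = P z.2).card : ℝ) ≤ ε / 2 * (n : ℝ) ^ 2) :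
    ∃ G' ∈ redFamily k n, (G.editDist G' : ℝ) ≤ ε * (n : ℝ) ^ 2 := by
  refine ⟨partitionGraph EyeColour.red P, isCliquePartition_partitionGraph _ P, ?_⟩
  have h3 := card_filter_not_adj_union_le h1 h2
  refine le_trans (Nat.cast_le.2 (editDist_le _ _ _ ?_)) h3
  intro x y hxy hS
  simp only [mem_union, mem_filter, mem_univ, true_and, not_or, not_not, redGraph_adj,
    blueGraph_adj] at hS
  obtain ⟨⟨hne, h4⟩, h5⟩ := hS
  replace h4 : G.get x y hxy ≠ EyeColour.blue := h4
  have h6 : ¬ (G.get x y hxy ≠ EyeColour.red ↔ P x = P y) := fun h =>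
    h5 ⟨fun ⟨_, h'⟩ => h.1 h', fun h' => ⟨hxy, h.2 h'⟩⟩
  rw [partitionGraph_get]
  revert h4 h6
  generalize G.get x y hxy = col
  by_cases hP : P x = P y <;> cases col <;> simp [hP]

/-- Clearing denominators gives p ≤ a/(a + k), where a + k = a + b - 1. -/
lemma blueFamily_subset_extremalFamily {a k : ℕ} {p : ℝ} (ha : 0 < a) (hk : 0 < k)
    (h : p / a ≤ (1 - p) / k) (n : ℕ) : blueFamily a n ⊆ extremalFamily a (k + 1) p n := by
  have ha' : (0 : ℝ) < a := by exact_mod_cast ha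
  have hk' : (0 : ℝ) < k := by exact_mod_cast hk
  rw [div_le_div_iff₀ ha' hk'] at h
  have hp : ¬ p > (a : ℝ) / ((a : ℝ) + ((k + 1 : ℕ) : ℝ) - 1) := by
    push_cast
    rw [gt_iff_lt, not_lt, le_div_iff₀ (by linarith)]
    linarith
  unfold extremalFamily
  rw [if_neg hp]
  split_ifs
  · exact subset_rfl
  · exact Set.subset_union_left

lemma redFamily_subset_extremalFamily {a k : ℕ} {p : ℝ} (ha : 0 < a) (hk : 0 < k)
    (h : (1 - p) / k ≤ p / a) (n : ℕ) : redFamily k n ⊆ extremalFamily a (k + 1) p n := by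
  have ha' : (0 : ℝ) < a := by exact_mod_cast ha
  have hk' : (0 : ℝ) < k := by exact_mod_cast hk
  rw [div_le_div_iff₀ hk' ha'] at h
  have hp : ¬ p < (a : ℝ) / ((a : ℝ) + ((k + 1 : ℕ) : ℝ) - 1) := by
    push_cast
    rw [not_lt, div_le_iff₀ (by linarith)]
    linarith
  unfold extremalFamily
  rw [if_neg hp, Nat.add_sub_cancel]
  split_ifs
  · exact subset_rfl
  · exact Set.subset_union_right

/-- Stability compares p/a with q/k only up to an error. An error below the gap between them makes
the comparison exact and so selects the right family. -/
lemma exists_pos_le_abs_sub (x y : ℝ) : ∃ μ : ℝ, 0 < μ ∧ (x - μ ≤ y → x ≤ y) ∧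
    (y - μ ≤ x → y ≤ x) := by
  by_cases h : x = y
  · exact ⟨1, one_pos, fun _ => h.le, fun _ => h.ge⟩
  · refine ⟨|x - y| / 2, by have := abs_pos.2 (sub_ne_zero.2 h); linarith, ?_, ?_⟩ <;>
    · intro h1
      by_contra! h2
      rcases abs_cases (x - y) with h3 | h3 <;> linarith

end IGraph

theorem theorem1p2 (ε : ℝ) (hε : 0 < ε) (a b : ℕ) (ha : 2 ≤ a) (hb : 2 ≤ b)
    (p : ℝ) (hp0 : 0 < p) (hp1 : p < 1) :
    ∃ (n₀ : ℕ) (δ : ℝ), 0 < δ ∧ ∀ n : ℕ, n₀ < n → ∀ G : IGraph (Fin n),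
      ((G.copies (eye a b)).ncard : ℝ) < δ * (n : ℝ) ^ (a + b) →
      G.weight p > (IGraph.kappa p (eye a b) - δ) * (n.choose 2 : ℝ) →
      ∃ G' ∈ IGraph.extremalFamily a b p n, (G.editDist G' : ℝ) ≤ ε * (n : ℝ) ^ 2 := by
  obtain ⟨k, rfl⟩ : ∃ k, b = k + 1 := ⟨b - 1, by omega⟩
  have hk : 0 < k := by omega
  have ha0 : 0 < a := by omega
  have ha' : (0 : ℝ) < a := by exact_mod_cast ha0
  have hk' : (0 : ℝ) < k := by exact_mod_cast hk
  obtain ⟨μ, hμ, hμ1, hμ2⟩ := IGraph.exists_pos_le_abs_sub (p / a) ((1 - p) / k)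
  set c := min (p / a) ((1 - p) / k) with hc
  have hc0 : 0 ≤ c := le_min (by positivity) (div_nonneg (by linarith) hk'.le)
  obtain ⟨δ₀, hδ₀, n₀, H⟩ := (IGraph.isLossBound_min ha hk hp0 hp1).exists_stability ha hk hp0 hp1
    hc0 (min_le_left _ _) (min_le_right _ _) (ε := min (ε / 2) μ) (by positivity)
  have hκ := IGraph.one_sub_min_le_kappa ha hk hp0 hp1
  set M : ℝ := ((a + (k + 1) : ℕ) : ℝ) ^ (a + (k + 1)) with hM
  have hM0 : 0 < M := by positivity
  obtain ⟨n₁, hn₁⟩ := exists_nat_ge (2 / δ₀)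
  -- The bound δ₀/M pays for passing from copies to placements, δ₀/2 for the weight deficit; n₁
  -- makes the diagonal term n at most (δ₀/2)n².
  refine ⟨max n₀ n₁, min (δ₀ / M) (δ₀ / 2), by positivity, fun n hn G hG hw => ?_⟩
  set δ := min (δ₀ / M) (δ₀ / 2) with hδ
  have hδ1 : δ ≤ δ₀ / M := min_le_left _ _
  have hδ2 : δ ≤ δ₀ / 2 := min_le_right _ _
  have hn0 : n₀ ≤ n := (le_max_left _ _).trans hn.le
  have hn1 : 2 / δ₀ ≤ n := hn₁.trans (by exact_mod_cast (le_max_right n₀ n₁).trans hn.le)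
  have hnpos : (1 : ℝ) ≤ n := by
    have : 1 ≤ n := by omega
    exact_mod_cast this
  have hE : ((eyeTuples G.redGraph G.blueGraph a (k + 1)).card : ℝ)
      ≤ δ₀ * (n : ℝ) ^ (a + (k + 1)) := by
    calc ((eyeTuples G.redGraph G.blueGraph a (k + 1)).card : ℝ)
        ≤ M * (G.copies (eye a (k + 1))).ncard := by
          rw [hM]
          exact_mod_cast IGraph.card_eyeTuples_le G a (k + 1)
      _ ≤ M * (δ₀ / M * (n : ℝ) ^ (a + (k + 1))) := by
          gcongr
          exact hG.le.trans (by gcongr)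
      _ = _ := by field_simp
  have hloss : lossBetween p G.redGraph G.blueGraph Finset.univ Finset.univ
      ≤ (c + δ₀) * (n : ℝ) ^ 2 := by
    rw [IGraph.lossBetween_eq, Fintype.card_fin]
    rw [Nat.cast_choose_two] at hw
    have h1 : (1 - c - δ) * ((n : ℝ) * (n - 1) / 2)
        ≤ (IGraph.kappa p (eye a (k + 1)) - δ) * ((n : ℝ) * (n - 1) / 2) := by
      have : (0 : ℝ) ≤ (n : ℝ) - 1 := by linarith
      gcongr
    have h2 : (n : ℝ) ≤ δ₀ / 2 * n ^ 2 := by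
      rw [div_le_iff₀ hδ₀] at hn1
      nlinarith
    have h3 : δ * (n : ℝ) ^ 2 ≤ δ₀ / 2 * n ^ 2 := by gcongr
    have h4 : 0 ≤ c * (n : ℝ) := by positivity
    have h5 : 0 ≤ δ * (n : ℝ) := by positivity
    linarith
  have hε2 : min (ε / 2) μ ≤ ε / 2 := min_le_left _ _
  have hεμ : min (ε / 2) μ ≤ μ := min_le_right _ _
  rcases H (Fin n) G.redGraph G.blueGraph G.redGraph_sup_blueGraph (by simpa using hn0)
    (by simpa using hE) (by simpa using hloss) with ⟨h1, h2, P, h3⟩ | ⟨h1, h2, P, h3⟩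
  · have hle : p / a ≤ (1 - p) / k := hμ1 (by linarith [min_le_right (p / a) ((1 - p) / k)])
    rw [Fintype.card_fin] at h2 h3
    obtain ⟨G', hG', hd⟩ := IGraph.exists_blueFamily_editDist_le (G := G) (P := P) (ε := ε)
      (h2.trans (by gcongr)) (h3.trans (by gcongr))
    exact ⟨G', IGraph.blueFamily_subset_extremalFamily ha0 hk hle n hG', hd⟩
  · have hle : (1 - p) / k ≤ p / a := hμ2 (by linarith [min_le_left (p / a) ((1 - p) / k)])
    rw [Fintype.card_fin] at h2 h3
    obtain ⟨G', hG', hd⟩ := IGraph.exists_redFamily_editDist_le (G := G) (P := P) (ε := ε)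
      (h2.trans (by gcongr)) (h3.trans (by gcongr))
    exact ⟨G', IGraph.redFamily_subset_extremalFamily ha0 hk hle n hG', hd⟩
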